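/- **Setting.** Let $s,m\in\mathbb N=\{1,2,\dots\}$, $\alpha\in\mathbb N_0$, $\lambda\in(0,1]$. Let $f:[0,1]^s\to\mathbb R$ be such that for every $\boldsymbol a\in\{0,\dots,\alpha\}^s$ the mixed partial derivative $f^{(\boldsymbol a)}=\partial^{\|\boldsymbol a\|_1}f/\partial x_1^{a_1}\cdots\partial x_s^{a_s}$ exists and is continuous on $[0,1]^s$, and put $\mu=\int_{[0,1]^s}f(\boldsymbol x)\,\mathrm d\boldsymbol x$. *Norms.* For $u\subseteq\{1,\dots,s\}$ the ANOVA components are $f_u(\boldsymbol x)=\int_{[0,1]^{s-|u|}}f(\boldsymbol x)\,\mathrm d\boldsymbol x_{u^c}-\sum_{v\subsetneq u}f_v(\boldsymbol x)$, regarded as functions of $\boldsymbol x_u\in[0,1]^{|u|}$. For $g:[0,1]^n\to\mathbb R$ let $$V^{(n)}_\lambda(g)=\sup_{\mathcal P}\Big(\sum_{J\in\mathcal P}\mathrm{Vol}(J)\Big|\frac{\Delta(g,J)}{\mathrm{Vol}(J)^\lambda}\Big|^2\Big)^{1/2},$$ the supremum being over all finite partitions $\mathcal P$ of $[0,1)^n$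 into nonempty boxes $J=\prod_j[a_j,b_j)$, where $\Delta(g,J)=\sum_{v\subseteq\{1,\dots,n\}}(-1)^{n-|v|}g(\boldsymbol a_v,\boldsymbol b_{v^c})$ is the alternating sum over the vertices of $J$; $V^{(0)}_\lambda(g)=|g|$. For $v\subseteq\{1,\dots,n\}$ let $V^v_\lambda(g)=\sup_\rho V^{(|v|)}_\lambda\big(\int_{[0,1]^{n-|v|}}g\rho\,\mathrm d\boldsymbol x_{v^c}\big)$ over all $\rho(\boldsymbol x)=\prod_{j\in v^c}\rho_j(x_j)$ with $\rho_j\in C([0,1])$, $0\le\rho_j\le1$. For $u\ne\emptyset$ let $\|f\|_{u,\alpha,\lambda}=\sup V^v_\lambda\big(f_u^{(\boldsymbol a)}\big)$ over all $v\subseteq u$ and $\boldsymbol a\in\{0,\dots,\alpha\}^{u}$ with $a_j=\alpha$ for $j\in v$ and $a_j>0$ for $j\in u\setminus v$. Put $\|f\|_{\emptyset,\alpha,\lambda}=0$, $\|f\|_{\alpha,\lambda}=\max_{u}\|f\|_{u,\alpha,\lambda}$ and $\gamma_u=\|f\|_{u,\alpha,\lambda}/\|f\|_{\alpha,\lambda}$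 (with $\gamma_u=0$ if $\|f\|_{\alpha,\lambda}=0$). *Randomization.* A randomization scheme is a probability law of matrices $C_1,\dots,C_s\in\{0,1\}^{\infty\times m}$ (rows indexed by $\mathbb N$). Given such random matrices, let $\vec D_1,\dots,\vec D_s\in\{0,1\}^\infty$ be digital shifts whose entries are all independent Bernoulli$(1/2)$ and which are independent of the matrices. For $0\le i<2^m$ with binary digit vector $\vec i\in\{0,1\}^m$ (least significant digit first), $\boldsymbol x_i\in[0,1]^s$ is the point whose $j$-th coordinate has the binary digits $C_j\vec i+\vec D_j \bmod 2$, and $\hat\mu_\infty=2^{-m}\sum_{i=0}^{2^m-1}f(\boldsymbol x_i)$. For $r\in\mathbb N$, $\hat\mu^{(r)}_\infty$ is the sample median of $2r-1$ independent replicates of $\hat\mu_\infty$ (each with its own matrices and shifts, from the same scheme). For $\boldsymbol k\in\mathbb N_0^s\setminus\{\boldsymbol 0\}$ let $\vec k_j$ be the binary digit vector of $k_j$ (least significant digit first), $\kappa_j\subset\mathbb N$ the set of positions of its nonzero entries, $\boldsymbol s(\boldsymbol k)=\{j: k_j\ne0\}$, and let $Z(\boldsymbol k)$ be the indicator of the event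 $\sum_{j}\vec k_j^{\mathsf T}C_j=\boldsymbol 0\bmod 2$. For finite $\kappa\subset\mathbb N$ and $d\in\mathbb N$ let $\|\kappa\|_{(d)}$ be the sum of the $\min(d,|\kappa|)$ largest elements of $\kappa$. *Assumption (order $d$, parameters $\tilde t_u$):* $d\in\mathbb N$, and $\tilde t_u\in\mathbb N_0$ for nonempty $u\subseteq\{1,\dots,s\}$, are such that for every $\boldsymbol k\in\mathbb N_0^s\setminus\{\boldsymbol 0\}$, with $u=\boldsymbol s(\boldsymbol k)$, $$\Pr(Z(\boldsymbol k)=1)\le 2^{-m+\tilde t_u}\,\boldsymbol 1\Big\{\sum_{j\in u}\|\kappa_j\|_{(d)}>d(m-\tilde t_u)\Big\}.$$ **Theorem.** Suppose $\|f\|_{\alpha,\lambda}<\infty$, and let $r\in\mathbb N$ and $\theta\in(0,1)$. If the randomization scheme satisfies the Assumption with $d\ge\alpha+\lambda$, then $$\Pr\Big(\big|\hat\mu^{(r)}_\infty-\mu\big|^2>\Gamma\,\|f\|^2_{\alpha,\lambda}\,2^{-(2\theta(\alpha+\lambda)+1)m}\Big)\le2^{-r},$$ where $$\Gamma=16\sum_{\emptyset\ne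 u\subseteq\{1,\dots,s\}}\gamma_u^2\,C_{\alpha,\lambda,\theta}^{|u|}\,2^{\tilde t_u(2\theta(\alpha+\lambda)+1)},$$ $$C_{\alpha,\lambda,\theta}=\frac{4^{-\alpha}}{\alpha!\,(4^{(\alpha+\lambda)(1-\theta)}-1)(4^{1-\theta}-1)^{\alpha}}+\sum_{\alpha'=0}^{\alpha}\frac{4^{-\alpha'+1}}{(\alpha')!\,(4^{1-\theta}-1)^{\alpha'}}.$$ -/

import Mathlib

open MeasureTheory ProbabilityTheory
open scoped ENNReal

noncomputable section

namespace MedianNet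

/-! ### Binary digits and digit weights -/

/-- The set `κ` of positions `ℓ ≥ 1` of the nonzero bits of `k = ∑ a_ℓ 2^(ℓ-1)`. -/
def bitPos (k : ℕ) : Finset ℕ := k.bitIndices.toFinset.image (· + 1)

/-- `‖κ‖`, the sum of the elements of `κ`. -/
def weight (κ : Finset ℕ) : ℕ := ∑ l ∈ κ, l

/-- The set of the `q` largest elements of `κ` (all of `κ` if it has at most `q` elements):
those elements that have fewer than `q` larger ones in `κ`. -/
def largest (q : ℕ) (κ : Finset ℕ) : Finset ℕ := κ.filter (fun l => (κ.filter (l < ·)).card < q)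

/-- `‖κ‖_(d)`. -/
def orderWeight (d : ℕ) (κ : Finset ℕ) : ℕ :=
  if κ.card ≤ d then weight κ else weight (largest d κ)

/-- The set of coordinates `j` with `k_j ≠ 0`. -/
def supp {s : ℕ} (k : Fin s → ℕ) : Finset (Fin s) := Finset.univ.filter (fun j => k j ≠ 0)

/-! ### Randomized digital nets of infinite precision -/

/-- `s` binary matrices with rows indexed by all of `ℕ` (infinite precision) and `m` columns:
`C j i c` is the entry of `C_j` in row `i + 1` (the digit of weight `2^(-(i+1))`), column `c + 1`. -/
abbrev GenMatrices (s m : ℕ) : Type := Fin s → ℕ → Fin m → ZMod 2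

/-- `s` digital shifts of infinite precision: `D j i` is the digit of `D_j` of weight
`2^(-(i+1))`. -/
abbrev Shifts (s : ℕ) : Type := Fin s → ℕ → ZMod 2

/-- The binary digits of the `j`-th coordinate of the point number `i`:
the digits of `C_j i + D_j` modulo 2, where `i` is read as the column vector of its bits. -/
def pointDigit {s m : ℕ} (C : GenMatrices s m) (D : Shifts s) (i : ℕ) (j : Fin s) (l : ℕ) :
    ZMod 2 :=
  (∑ c : Fin m, C j l c * (if i.testBit c then 1 else 0)) + D j l

/-- The point number `i` of the net, `x_{ij} = ∑_{l ≥ 1} (digit l) 2^(-l)`. -/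
def point {s m : ℕ} (C : GenMatrices s m) (D : Shifts s) (i : ℕ) : Fin s → ℝ :=
  fun j => ∑' l : ℕ, ((pointDigit C D i j l).val : ℝ) / 2 ^ (l + 1)

/-- The quasi-Monte Carlo estimator: the mean of `f` over the `2^m` points of the net. -/
def estimator {s m : ℕ} (f : (Fin s → ℝ) → ℝ) (C : GenMatrices s m) (D : Shifts s) : ℝ :=
  (∑ i ∈ Finset.range (2 ^ m), f (point C D i)) / 2 ^ m

/-- The event `Z(k) = 1`: the row vector `∑_j k_j^T C_j` vanishes modulo 2. -/
def collision {s m : ℕ} (k : Fin s → ℕ) : Set (GenMatrices s m) :=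
  {C | ∀ c : Fin m, ∑ j : Fin s, ∑ l ∈ bitPos (k j), C j (l - 1) c = 0}

/-- The law `ν` of the random matrices `(C_1, …, C_s)` is a randomization scheme of order `d` with
parameters `t u`: for `k ≠ 0` with support `u`,
`Pr(Z(k) = 1) ≤ 2^(-m + t u) * 1{∑_{j ∈ u} ‖κ_j‖_(d) > d (m - t u)}`. -/
def SchemeOfOrder {s m : ℕ} (ν : Measure (GenMatrices s m)) (d : ℕ) (t : Finset (Fin s) → ℕ) :
    Prop :=
  ∀ k : Fin s → ℕ, k ≠ 0 →
    ν.real (collision k) ≤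
      (2 : ℝ) ^ (-(m : ℤ) + (t (supp k) : ℤ)) *
        (if (d : ℤ) * ((m : ℤ) - (t (supp k) : ℤ))
            < ((∑ j ∈ supp k, orderWeight d (bitPos (k j)) : ℕ) : ℤ) then 1 else 0)

/-- `C` and `D` are random generating matrices of law `ν` and random digital shifts: all digits of
the shifts are independent and Bernoulli(1/2), and the shifts are independent of the matrices. -/
structure IsRandomizedNet {s m : ℕ} {Ω : Type*} [MeasurableSpace Ω] (P : Measure Ω)
    (ν : Measure (GenMatrices s m)) (C : Ω → GenMatrices s m) (D : Ω → Shifts s) : Prop where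
  measurable_matrices : Measurable C
  measurable_shifts : Measurable D
  law_matrices : P.map C = ν
  indep_digits : iIndepFun (fun (p : Fin s × ℕ) (ω : Ω) => D ω p.1 p.2) P
  bernoulli_digits : ∀ (j : Fin s) (l : ℕ) (b : ZMod 2), P {ω | D ω j l = b} = 1 / 2
  indep_matrices_shifts : IndepFun C D P

/-- The sample median of `2r - 1` numbers: the `r`-th smallest of them. -/
def sampleMedian (r : ℕ) (hr : 1 ≤ r) (x : Fin (2 * r - 1) → ℝ) : ℝ :=
  x (Tuple.sort x ⟨r - 1, by omega⟩)

/-! ### Smoothness -/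

/-- The closed unit cube. -/
def cube (ι : Type*) : Set (ι → ℝ) := Set.Icc 0 1

section Smoothness

variable {ι : Type*} [Fintype ι] [LinearOrder ι]

/-- The partial derivative in coordinate `j` of a function on the closed unit cube (one-sided on the
boundary). -/
def partialDeriv (j : ι) (g : (ι → ℝ) → ℝ) : (ι → ℝ) → ℝ :=
  fun x => derivWithin (fun t => g (Function.update x j t)) (Set.Icc 0 1) (x j)

/-- The mixed partial derivative `g^(a) = ∂^|a| g / ∂x_1^(a_1) ⋯ ∂x_s^(a_s)`
(the derivatives in the last coordinate are taken first). -/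
def mixedDeriv (a : ι → ℕ) (g : (ι → ℝ) → ℝ) : (ι → ℝ) → ℝ :=
  (Finset.univ.sort (fun i j : ι => i ≤ j)).foldr (fun j h => (partialDeriv j)^[a j] h) g

/-- `g ∈ C^(α,…,α)([0,1]^ι)`: for every `a ≤ (α,…,α)` the mixed partial derivative `g^(a)` exists and
is continuous on the closed cube. Existence is required exactly where the iterated derivative
`mixedDeriv` differentiates: `g^(a + e_j) = ∂_j g^(a)` when `a_i = 0` for all `i < j`. -/
def MixedSmooth (α : ℕ) (g : (ι → ℝ) → ℝ) : Prop :=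
  ∀ a : ι → ℕ, (∀ j, a j ≤ α) →
    ContinuousOn (mixedDeriv a g) (cube ι) ∧
    ∀ j, a j < α → (∀ i < j, a i = 0) → ∀ x ∈ cube ι,
      DifferentiableWithinAt ℝ (fun t => mixedDeriv a g (Function.update x j t))
        (Set.Icc 0 1) (x j)

/-! ### ANOVA components -/

/-- The ANOVA component `f_u(x) = ∫ f(x) dx_{u^c} - ∑_{v ⊊ u} f_v(x)`. The integral over `x_{u^c}` is
written as an integral over the full cube, in which the coordinates in `u` of the integration
variable are not used and integrate to `1`. -/
def anova (f : (ι → ℝ) → ℝ) (u : Finset ι) : (ι → ℝ) → ℝ := fun x =>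
  (∫ y in cube ι, f (u.piecewise x y)) - ∑ v ∈ u.ssubsets.attach, anova f v.1 x
termination_by u.card
decreasing_by exact Finset.card_lt_card (Finset.mem_ssubsets.1 v.2)

theorem anova_eq (f : (ι → ℝ) → ℝ) (u : Finset ι) (x : ι → ℝ) :
    anova f u x = (∫ y in cube ι, f (u.piecewise x y)) - ∑ v ∈ u.ssubsets, anova f v x := by
  rw [anova, ← Finset.sum_attach u.ssubsets]

/-- The ANOVA component `f_u` as a function of the variables `x_u` only. -/
def anovaOn (f : (ι → ℝ) → ℝ) (u : Finset ι) : (u → ℝ) → ℝ :=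
  fun y => anova f u (fun j => if h : j ∈ u then y ⟨j, h⟩ else 0)

/-! ### Fractional Vitali variation -/

/-- The half-open box with corners `J.1` and `J.2`. -/
def box (J : (ι → ℝ) × (ι → ℝ)) : Set (ι → ℝ) :=
  Set.univ.pi (fun j => Set.Ico (J.1 j) (J.2 j))

/-- The volume of a box. -/
def boxVol (J : (ι → ℝ) × (ι → ℝ)) : ℝ := ∏ j, (J.2 j - J.1 j)

/-- The alternating sum of `g` over the vertices of a box. -/
def altSum (g : (ι → ℝ) → ℝ) (J : (ι → ℝ) × (ι → ℝ)) : ℝ :=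
  ∑ v : Finset ι, (-1) ^ (Fintype.card ι - v.card) * g (v.piecewise J.1 J.2)

/-- A finite partition of `[0,1)^ι` into nonempty boxes. -/
structure IsBoxPartition (Q : Finset ((ι → ℝ) × (ι → ℝ))) : Prop where
  nondegenerate : ∀ J ∈ Q, ∀ j, J.1 j < J.2 j
  disjoint : (Q : Set ((ι → ℝ) × (ι → ℝ))).PairwiseDisjoint box
  cover : (⋃ J ∈ Q, box J) = Set.univ.pi (fun _ : ι => Set.Ico (0 : ℝ) 1)

/-- The fractional Vitali variation of order `lam`. If `ι` is empty it is `|g|`. -/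
def vitali (lam : ℝ) (g : (ι → ℝ) → ℝ) : ℝ≥0∞ :=
  (⨆ (Q : Finset ((ι → ℝ) × (ι → ℝ))) (_ : IsBoxPartition Q),
    ∑ J ∈ Q, ENNReal.ofReal (boxVol J * |altSum g J / boxVol J ^ lam| ^ 2)) ^ (1 / 2 : ℝ)

/-- The partial integral `I_v(g)(x_v) = ∫ g(x_{v^c}; x_v) dx_{v^c}`, written as an integral over the
full cube, in which the coordinates in `v` of the integration variable are not used. -/
def partialIntegral (v : Finset ι) (g : (ι → ℝ) → ℝ) : (v → ℝ) → ℝ :=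
  fun y => ∫ x in cube ι, g (fun j => if h : j ∈ v then y ⟨j, h⟩ else x j)

/-- The class of products over `v^c` of continuous univariate weights with values in `[0,1]`. -/
def weightClass (v : Finset ι) : Set ((ι → ℝ) → ℝ) :=
  {ρ | ∃ w : ι → ℝ → ℝ,
    (∀ j, ContinuousOn (w j) (Set.Icc 0 1) ∧ ∀ t ∈ Set.Icc (0 : ℝ) 1, 0 ≤ w j t ∧ w j t ≤ 1) ∧
    ρ = fun x => ∏ j ∈ vᶜ, w j (x j)}

/-- The partial fractional Vitali variation of order `lam` with respect to the coordinates `v`. -/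
def partialVitali (lam : ℝ) (v : Finset ι) (g : (ι → ℝ) → ℝ) : ℝ≥0∞ :=
  ⨆ ρ ∈ weightClass v, vitali lam (partialIntegral v (fun x => g x * ρ x))

/-! ### Variation norms -/

/-- `‖f‖_{u,α,lam}`: the supremum of `V^v_lam(f_u^(a))` over `v ⊆ u` and multi-orders `a ≤ α` on `u`
with `a_j = α` on `v` and `a_j > 0` on `u \ v`; it is `0` for empty `u`. -/
def componentNorm (α : ℕ) (lam : ℝ) (f : (ι → ℝ) → ℝ) (u : Finset ι) : ℝ≥0∞ :=
  if u = ∅ then 0 else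
    ⨆ (v : Finset u) (a : u → ℕ)
      (_ : (∀ j, a j ≤ α) ∧ (∀ j ∈ v, a j = α) ∧ (∀ j ∉ v, 0 < a j)),
      partialVitali lam v (mixedDeriv a (anovaOn f u))

/-- The global variation norm `‖f‖_{α,lam}`. -/
def variationNorm (α : ℕ) (lam : ℝ) (f : (ι → ℝ) → ℝ) : ℝ≥0∞ :=
  ⨆ u : Finset ι, componentNorm α lam f u

/-- The relative variation `γ_u = ‖f‖_{u,α,lam} / ‖f‖_{α,lam}` (it is `0` if `‖f‖_{α,lam} = 0`). -/
def relVariation (α : ℕ) (lam : ℝ) (f : (ι → ℝ) → ℝ) (u : Finset ι) : ℝ :=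
  (componentNorm α lam f u / variationNorm α lam f).toReal

end Smoothness

/-! ### Constants of the error bound -/

/-- The constant `C_{α,lam,θ}`. -/
def constC (α : ℕ) (lam θ : ℝ) : ℝ :=
  (4 : ℝ) ^ (-(α : ℤ)) /
      ((α.factorial : ℝ) * ((4 : ℝ) ^ (((α : ℝ) + lam) * (1 - θ)) - 1)
        * ((4 : ℝ) ^ (1 - θ) - 1) ^ α)
    + ∑ a ∈ Finset.range (α + 1),
        (4 : ℝ) ^ (-(a : ℤ) + 1) / ((a.factorial : ℝ) * ((4 : ℝ) ^ (1 - θ) - 1) ^ a)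

/-- The constant `Γ = 16 ∑_{u ≠ ∅} γ_u^2 C_{α,lam,θ}^|u| 2^(t_u (2θ(α+lam)+1))`. -/
def constGamma {s : ℕ} (α : ℕ) (lam : ℝ) (f : (Fin s → ℝ) → ℝ) (t : Finset (Fin s) → ℕ)
    (θ : ℝ) : ℝ :=
  16 * ∑ u ∈ Finset.univ.filter (fun u : Finset (Fin s) => u ≠ ∅),
    relVariation α lam f u ^ 2 * constC α lam θ ^ u.card
      * (2 : ℝ) ^ ((t u : ℝ) * (2 * θ * ((α : ℝ) + lam) + 1))

end MedianNet

end

/-!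
The error of one replicate is expanded in Walsh functions. Averaged over the points of a digital
net, the Walsh function of frequency `k` gives its value at the digital shift if `Z(k) = 1`, and
zero otherwise. Under the random shift different Walsh functions are uncorrelated, and so the mean
squared error of one replicate is `∑_{k ≠ 0} \hat f(k)² Pr(Z(k) = 1)`. Since `f` is continuous, its
dyadic partial Walsh sums converge uniformly, and only finite Walsh sums have to be treated.

The core is a bound for the Walsh coefficients. A coefficient of `f` at a frequency with support `u`
is the coefficient of the ANOVA component `f_u` (`integral_mul_walProd_eq_anovaOn`). In each
coordinate the frequency is cut into its at most `α + 1` leading bits and the free bits below them.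
Integration by parts in the finest bits (`MixedFamily.abs_integral_wal`) replaces the Rademacher
functions of these bits by iterated primitives, which are nonnegative, periodic at the scale of
their coarsest bit, and bounded by twice their mean. In the coordinates with more than `α` bits,
`α` integrations leave one leading bit and the free bits; in the other coordinates all bits are
used up, and the normalized primitive becomes a weight `ρ_j` of the partial variation
`partialVitali`. In the former coordinates the sum over all free bits is evaluated by Parseval's
identity on a dyadic grid. The leading bit acts as a difference operator on the dyadic boxes, so
that the Cauchy-Schwarz inequality produces alternating sums of the integrand over shifted dyadic
boxes, which are controlled by the fractional Vitali variation (`sum_sq_integral_le_vitali`).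
Together this bounds the sum of `\hat f(k)²` over all frequencies with given leading bits
(`sum_sq_walsh_leading_le`).

An order-`d` weight `‖κ‖_(d)` with `d ≥ α + λ` is at most `d / (α + λ)` times a weight of the
leading bits alone (`mul_orderWeight_le`). Hence the bounds can be multiplied by
`4^(θ (α + λ) ‖κ‖_(d) / d)` and summed over the leading bits as geometric series, which gives the
constant `C_{α,λ,θ}` to the power `|u|` (`sum_leadFactor_le`, `sum_sq_walsh_mul_weight_le`). The
indicator in the assumption on the scheme is at most an exponential with exactly this exponent
(`SchemeOfOrder.real_freqCollision_le`), and so the mean squared error is at most one sixteenth of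
the threshold in the theorem.

By Chebyshev's inequality one replicate is bad with probability at most `1/8`. The median of
`2r - 1` replicates is bad only if `r` of them are; there are at most `4^r` ways to choose these, and by
independence each has probability at most `8^(-r)`.
-/

namespace MedianNet

open Filter Topology

/-! ### Rademacher and Walsh functions -/

/-- The Rademacher function `(-1)^(x_(l+1))`, where `x_(l+1)` is the binary digit of `x` of weight
`2^(-(l+1))`. -/
noncomputable def rad (l : ℕ) (x : ℝ) : ℝ := (-1) ^ ⌊2 ^ (l + 1) * x⌋

/-- The Walsh function whose binary frequency has its nonzero bits at the (zero-based) positions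
in `K`. -/
noncomputable def wal (K : Finset ℕ) (x : ℝ) : ℝ := ∏ l ∈ K, rad l x

theorem rad_eq_or (l : ℕ) (x : ℝ) : rad l x = 1 ∨ rad l x = -1 := by
  rcases Int.even_or_odd ⌊2 ^ (l + 1) * x⌋ with h | h
  · exact Or.inl h.neg_one_zpow
  · exact Or.inr h.neg_one_zpow

theorem rad_mul_self (l : ℕ) (x : ℝ) : rad l x * rad l x = 1 := by
  rcases rad_eq_or l x with h | h <;> rw [h] <;> norm_num

theorem abs_rad (l : ℕ) (x : ℝ) : |rad l x| = 1 := by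
  rcases rad_eq_or l x with h | h <;> rw [h] <;> norm_num

theorem abs_wal (K : Finset ℕ) (x : ℝ) : |wal K x| = 1 := by
  simp [wal, Finset.abs_prod, abs_rad]

theorem measurable_rad (l : ℕ) : Measurable (rad l) := by
  have h : Measurable (fun n : ℤ => (-1 : ℝ) ^ n) := measurable_from_top
  exact h.comp (Int.measurable_floor.comp (measurable_const.mul measurable_id))

theorem measurable_wal (K : Finset ℕ) : Measurable (wal K) :=
  Finset.measurable_fun_prod K fun l _ => measurable_rad l

theorem rad_antiperiodic (l : ℕ) : Function.Antiperiodic (rad l) (1 / 2 ^ (l + 1)) := by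
  intro x
  have h : (2 : ℝ) ^ (l + 1) * (x + 1 / 2 ^ (l + 1)) = 2 ^ (l + 1) * x + 1 := by field_simp
  rw [rad, rad, h, Int.floor_add_one, zpow_add_one₀ (by norm_num)]
  ring

theorem rad_periodic {n l : ℕ} (h : n ≤ l) : Function.Periodic (rad l) (1 / 2 ^ n) := by
  have h1 := (rad_antiperiodic l).periodic_two_mul.nat_mul (2 ^ (l - n))
  have h2 : ((2 ^ (l - n) : ℕ) : ℝ) * (2 * (1 / 2 ^ (l + 1))) = 1 / 2 ^ n := by
    obtain ⟨q, rfl⟩ := Nat.exists_eq_add_of_le h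
    rw [Nat.add_sub_cancel_left]
    push_cast
    field_simp
    ring
  rwa [h2] at h1

theorem rad_eq_one {l : ℕ} {x : ℝ} (h0 : 0 ≤ x) (h1 : x < 1 / 2 ^ (l + 1)) : rad l x = 1 := by
  have : ⌊2 ^ (l + 1) * x⌋ = 0 := by
    rw [Int.floor_eq_zero_iff]
    refine ⟨by positivity, ?_⟩
    rw [lt_div_iff₀ (by positivity)] at h1
    linarith
  rw [rad, this, zpow_zero]

/-- `rad l` is a function of the first `l + 1` binary digits. -/
theorem rad_eq_of_floor_eq {l n : ℕ} (h : l < n) {x y : ℝ}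
    (hxy : ⌊2 ^ n * x⌋ = ⌊2 ^ n * y⌋) : rad l x = rad l y := by
  obtain ⟨q, rfl⟩ := Nat.exists_eq_add_of_le (Nat.succ_le_of_lt h)
  have key : ∀ z : ℝ, ⌊2 ^ (l + 1) * z⌋ = ⌊2 ^ (l.succ + q) * z⌋ / ((2 ^ q : ℕ) : ℤ) := by
    intro z
    rw [← Int.floor_div_natCast]
    congr 1
    push_cast
    rw [Nat.succ_eq_add_one, pow_add _ (l + 1) q]
    field_simp
  rw [rad, rad, key, key, hxy]

theorem wal_eq_of_floor_eq {n : ℕ} {K : Finset ℕ} (h : ∀ l ∈ K, l < n) {x y : ℝ}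
    (hxy : ⌊2 ^ n * x⌋ = ⌊2 ^ n * y⌋) : wal K x = wal K y :=
  Finset.prod_congr rfl fun l hl => rad_eq_of_floor_eq (h l hl) hxy

theorem eventually_floor_eq_right (x : ℝ) (n : ℕ) :
    ∀ᶠ y in 𝓝[≥] x, ⌊2 ^ n * y⌋ = ⌊2 ^ n * x⌋ := by
  have h1 : (2 : ℝ) ^ n * x < ⌊(2 : ℝ) ^ n * x⌋ + 1 := Int.lt_floor_add_one _
  have h2 : ∀ᶠ y in 𝓝 x, (2 : ℝ) ^ n * y < ⌊(2 : ℝ) ^ n * x⌋ + 1 :=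
    (continuous_const.mul continuous_id).continuousAt.eventually_lt continuousAt_const h1
  filter_upwards [h2.filter_mono nhdsWithin_le_nhds, self_mem_nhdsWithin] with y hy hxy
  rw [Int.floor_eq_iff]
  refine ⟨(Int.floor_le _).trans ?_, hy⟩
  exact mul_le_mul_of_nonneg_left hxy (by positivity)

theorem eventually_floor_eq {x : ℝ} {n : ℕ} (hx : (⌊2 ^ n * x⌋ : ℝ) ≠ 2 ^ n * x) :
    ∀ᶠ y in 𝓝 x, ⌊2 ^ n * y⌋ = ⌊2 ^ n * x⌋ := by
  have h1 : (2 : ℝ) ^ n * x < ⌊(2 : ℝ) ^ n * x⌋ + 1 := Int.lt_floor_add_one _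
  have h2 : ∀ᶠ y in 𝓝 x, (2 : ℝ) ^ n * y < ⌊(2 : ℝ) ^ n * x⌋ + 1 :=
    (continuous_const.mul continuous_id).continuousAt.eventually_lt continuousAt_const h1
  have h3 : ∀ᶠ y in 𝓝 x, (⌊(2 : ℝ) ^ n * x⌋ : ℝ) < (2 : ℝ) ^ n * y :=
    continuousAt_const.eventually_lt (continuous_const.mul continuous_id).continuousAt
      (lt_of_le_of_ne (Int.floor_le _) hx)
  filter_upwards [h2, h3] with y hy hy'
  rw [Int.floor_eq_iff]
  exact ⟨hy'.le, hy⟩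

/-- A point of `[0,1)` whose first `N` Rademacher signs are those of the digits `δ` lies in the
dyadic interval given by these digits. -/
theorem floor_eq_sum_digits {δ : ℕ → ℕ} (hδ : ∀ l, δ l = 0 ∨ δ l = 1) {y : ℝ}
    (h0 : 0 ≤ y) (h1 : y < 1) (N : ℕ) (h : ∀ l < N, rad l y = (-1) ^ δ l) :
    (⌊2 ^ N * y⌋ : ℝ) = 2 ^ N * ∑ l ∈ Finset.range N, (δ l : ℝ) / 2 ^ (l + 1) := by
  induction N with
  | zero =>
    have : ⌊y⌋ = 0 := Int.floor_eq_zero_iff.2 ⟨h0, h1⟩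
    simp [this]
  | succ N ih =>
    have ih := ih fun l hl => h l (by omega)
    have hN := h N (by omega)
    have hdiv : ⌊2 ^ N * y⌋ = ⌊2 ^ (N + 1) * y⌋ / 2 := by
      have := Int.floor_div_natCast ((2 : ℝ) ^ (N + 1) * y) 2
      rw [show (2 : ℤ) = ((2 : ℕ) : ℤ) from rfl, ← this]
      congr 1
      push_cast
      ring
    have hmod : ⌊2 ^ (N + 1) * y⌋ = 2 * ⌊2 ^ N * y⌋ + (δ N : ℤ) := by
      rw [rad] at hN
      rcases hδ N with hd | hd
      · rw [hd] at hN ⊢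
        rcases Int.even_or_odd ⌊2 ^ (N + 1) * y⌋ with he | ho
        · obtain ⟨c, hc⟩ := he
          rw [hdiv]; omega
        · rw [ho.neg_one_zpow] at hN; norm_num at hN
      · rw [hd] at hN ⊢
        rcases Int.even_or_odd ⌊2 ^ (N + 1) * y⌋ with he | ho
        · rw [he.neg_one_zpow] at hN; norm_num at hN
        · obtain ⟨c, hc⟩ := ho
          rw [hdiv]; omega
    rw [hmod, Finset.sum_range_succ]
    push_cast
    rw [ih, pow_succ]
    field_simp

theorem wal_mul_rad {K : Finset ℕ} {l : ℕ} (h : l ∉ K) (x : ℝ) :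
    wal (insert l K) x = wal K x * rad l x := by
  rw [wal, Finset.prod_insert h, mul_comm]; rfl

@[simp] theorem wal_empty (x : ℝ) : wal ∅ x = 1 := by simp [wal]

/-! ### Iterated integrals of Rademacher functions -/

/-- The iterated primitive `W` of the product of the Rademacher functions of the bits in a list,
the last entry of the list (the finest scale, when the list increases) being integrated first. -/
noncomputable def iterPrim : List ℕ → ℝ → ℝ
  | [] => fun _ => 1
  | l :: L => fun x => ∫ t in (0 : ℝ)..x, rad l t * iterPrim L t

/-- The mean value of `iterPrim L`. -/
noncomputable def primMean (L : List ℕ) : ℝ := (L.map fun l => (1 : ℝ) / 2 ^ (l + 2)).prod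

@[simp] theorem iterPrim_nil (x : ℝ) : iterPrim [] x = 1 := rfl

theorem iterPrim_cons (l : ℕ) (L : List ℕ) (x : ℝ) :
    iterPrim (l :: L) x = ∫ t in (0 : ℝ)..x, rad l t * iterPrim L t := rfl

@[simp] theorem primMean_nil : primMean [] = 1 := rfl

theorem primMean_cons (l : ℕ) (L : List ℕ) :
    primMean (l :: L) = 1 / 2 ^ (l + 2) * primMean L := by simp [primMean]

theorem primMean_pos (L : List ℕ) : 0 < primMean L := by
  induction L with
  | nil => simp
  | cons l L ih => rw [primMean_cons]; positivity

theorem continuous_iterPrim (L : List ℕ) : Continuous (iterPrim L) := by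
  induction L with
  | nil => exact continuous_const
  | cons l L ih =>
    have hint : ∀ a b : ℝ, IntervalIntegrable (fun t => rad l t * iterPrim L t) volume a b := by
      intro a b
      refine (ih.intervalIntegrable a b).mono_fun
        ((measurable_rad l).mul ih.measurable).aestronglyMeasurable (ae_of_all _ fun t => ?_)
      simp [abs_rad]
    exact intervalIntegral.continuous_primitive hint 0

theorem intervalIntegrable_rad_mul (l : ℕ) (L : List ℕ) (a b : ℝ) :
    IntervalIntegrable (fun t => rad l t * iterPrim L t) volume a b := by
  refine ((continuous_iterPrim L).intervalIntegrable a b).mono_fun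
    ((measurable_rad l).mul (continuous_iterPrim L).measurable).aestronglyMeasurable
    (ae_of_all _ fun t => ?_)
  simp [abs_rad]

/-- The properties of `iterPrim L` that the induction on `L` carries along: at every dyadic scale
`2^(-n)` not finer than the entries of `L` the function is periodic with mean `primMean L`, and it
takes values between `0` and twice its mean. -/
theorem iterPrim_spec (L : List ℕ) (hL : L.Pairwise (· < ·)) :
    (∀ n : ℕ, (∀ l ∈ L, n ≤ l) → Function.Periodic (iterPrim L) (1 / 2 ^ n) ∧
      ∫ x in (0 : ℝ)..1 / 2 ^ n, iterPrim L x = 1 / 2 ^ n * primMean L) ∧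
    ∀ x, 0 ≤ iterPrim L x ∧ (L ≠ [] → iterPrim L x ≤ 2 * primMean L) := by
  induction L with
  | nil =>
    refine ⟨fun n _ => ⟨fun x => rfl, ?_⟩, fun x => ⟨by simp, by simp⟩⟩
    simp
  | cons l L ih =>
    obtain ⟨hlL, hL'⟩ := List.pairwise_cons.1 hL
    obtain ⟨ih1, ih2⟩ := ih hL'
    obtain ⟨hper, hmean⟩ := ih1 (l + 1) fun l' hl' => hlL l' hl'
    set h : ℝ := 1 / 2 ^ (l + 1) with hh
    have hpos : 0 < h := by positivity
    have h2 : (1 : ℝ) / 2 ^ l = 2 * h := by rw [hh, pow_succ]; field_simp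
    set W := iterPrim (l :: L) with hW
    have hWd : ∀ x, W x = ∫ t in (0 : ℝ)..x, rad l t * iterPrim L t := fun x => rfl
    have hint := intervalIntegrable_rad_mul l L
    -- on `[0, h]` the Rademacher factor is `1`
    have hone : ∀ x ∈ Set.Icc 0 h, W x = ∫ t in (0 : ℝ)..x, iterPrim L t := by
      intro x hx
      rw [hWd]
      refine intervalIntegral.integral_congr_ae ?_
      have hne : ∀ᵐ t : ℝ, t ≠ h := by simp [ae_iff]
      filter_upwards [hne] with t hth ht
      rw [Set.uIoc_of_le hx.1] at ht
      rw [rad_eq_one ht.1.le (lt_of_le_of_ne (ht.2.trans hx.2) hth), one_mul]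
    have hWh : W h = h * primMean L := by rw [hone h ⟨hpos.le, le_rfl⟩, hmean]
    -- the Rademacher factor changes its sign under a shift by `h`
    have hanti : ∀ x, W (x + h) = W h - W x := by
      intro x
      have e1 : W (x + h) = W h + ∫ t in h..(x + h), rad l t * iterPrim L t := by
        rw [hWd, hWd, intervalIntegral.integral_add_adjacent_intervals (hint _ _) (hint _ _)]
      have e2 : ∫ t in h..(x + h), rad l t * iterPrim L t
          = ∫ t in (0 : ℝ)..x, rad l (t + h) * iterPrim L (t + h) := by
        rw [intervalIntegral.integral_comp_add_right (fun t => rad l t * iterPrim L t), zero_add]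
      have e3 : ∀ t, rad l (t + h) * iterPrim L (t + h) = -(rad l t * iterPrim L t) := by
        intro t
        rw [rad_antiperiodic l t, hper t]; ring
      rw [e1, e2]
      simp only [e3, intervalIntegral.integral_neg]
      rw [← hWd]; ring
    have hper2 : Function.Periodic W (2 * h) := by
      intro x
      rw [show x + 2 * h = x + h + h by ring, hanti, hanti]; ring
    have hcont : Continuous W := continuous_iterPrim _
    have hM : primMean (l :: L) = h / 2 * primMean L := by
      rw [primMean_cons, hh, pow_succ _ (l + 1)]; field_simp
    have hmean2 : ∫ x in (0 : ℝ)..2 * h, W x = h * (h * primMean L) := by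
      rw [← intervalIntegral.integral_add_adjacent_intervals
        (hcont.intervalIntegrable 0 h) (hcont.intervalIntegrable h (2 * h))]
      have e2 : ∫ t in h..(2 * h), W t = ∫ t in (0 : ℝ)..h, W (t + h) := by
        rw [intervalIntegral.integral_comp_add_right (fun t => W t), zero_add, two_mul]
      rw [e2]
      simp only [hanti]
      rw [intervalIntegral.integral_sub (by simp) (hcont.intervalIntegrable _ _), hWh]
      simp
    have hbd0 : ∀ x ∈ Set.Icc 0 h, 0 ≤ W x ∧ W x ≤ h * primMean L := by
      intro x hx
      have hc := continuous_iterPrim L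
      constructor
      · rw [hone x hx]
        exact intervalIntegral.integral_nonneg hx.1 fun t _ => (ih2 t).1
      · rw [← hWh, hone x hx, hone h ⟨hpos.le, le_rfl⟩,
          ← intervalIntegral.integral_add_adjacent_intervals
            (hc.intervalIntegrable 0 x) (hc.intervalIntegrable x h)]
        have := intervalIntegral.integral_nonneg (μ := volume) hx.2 fun t _ => (ih2 t).1
        linarith
    have hbd : ∀ x, 0 ≤ W x ∧ W x ≤ h * primMean L := by
      intro x
      obtain ⟨y, hy, hxy⟩ := hper2.exists_mem_Ico₀ (by positivity) x
      rw [hxy]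
      rcases le_total y h with hyh | hyh
      · exact hbd0 y ⟨hy.1, hyh⟩
      · have := hanti (y - h)
        rw [sub_add_cancel, hWh] at this
        have h3 := hbd0 (y - h) ⟨by linarith, by linarith [hy.2]⟩
        rw [this]
        exact ⟨by linarith, by linarith⟩
    refine ⟨fun n hn => ?_, fun x => ⟨(hbd x).1, fun _ => ?_⟩⟩
    · obtain ⟨q, hq⟩ := Nat.exists_eq_add_of_le (hn l (by simp))
      have hq2 : (1 : ℝ) / 2 ^ n = ((2 ^ q : ℕ) : ℝ) * (2 * h) := by
        rw [← h2, hq]; push_cast; field_simp; ring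
      rw [hq2]
      refine ⟨hper2.nat_mul _, ?_⟩
      have := hper2.intervalIntegral_add_zsmul_eq (2 ^ q : ℕ) 0
        (fun a b => hcont.intervalIntegrable a b)
      simp only [zero_add, zsmul_eq_mul, Int.cast_natCast] at this
      rw [this, hmean2, hM]
      push_cast
      ring
    · rw [hM]
      exact (hbd x).2.trans_eq (by ring)

theorem iterPrim_nonneg {L : List ℕ} (hL : L.Pairwise (· < ·)) (x : ℝ) : 0 ≤ iterPrim L x :=
  ((iterPrim_spec L hL).2 x).1

theorem iterPrim_le {L : List ℕ} (hL : L.Pairwise (· < ·)) (h0 : L ≠ []) (x : ℝ) :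
    iterPrim L x ≤ 2 * primMean L :=
  ((iterPrim_spec L hL).2 x).2 h0

theorem iterPrim_periodic {L : List ℕ} (hL : L.Pairwise (· < ·)) {n : ℕ} (hn : ∀ l ∈ L, n ≤ l) :
    Function.Periodic (iterPrim L) (1 / 2 ^ n) :=
  ((iterPrim_spec L hL).1 n hn).1

theorem integral_iterPrim {L : List ℕ} (hL : L.Pairwise (· < ·)) {n : ℕ} (hn : ∀ l ∈ L, n ≤ l) :
    ∫ x in (0 : ℝ)..1 / 2 ^ n, iterPrim L x = 1 / 2 ^ n * primMean L :=
  ((iterPrim_spec L hL).1 n hn).2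

/-- A nonempty iterated primitive vanishes at the grid points of the scale of its first entry. -/
theorem iterPrim_eq_zero {l : ℕ} {L : List ℕ} (hL : (l :: L).Pairwise (· < ·)) {x : ℝ}
    (hx : (⌊2 ^ l * x⌋ : ℝ) = 2 ^ l * x) : iterPrim (l :: L) x = 0 := by
  have hp := iterPrim_periodic hL (n := l) (by
    intro l' hl'
    rcases List.mem_cons.1 hl' with h | h
    · exact h.ge
    · exact ((List.pairwise_cons.1 hL).1 l' h).le)
  have := hp.int_mul_eq ⌊2 ^ l * x⌋
  rw [hx, show (2 : ℝ) ^ l * x * (1 / 2 ^ l) = x by field_simp] at this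
  rw [this, iterPrim_cons]
  simp

/-- Integration by parts against a Walsh function: the coarser Walsh factor `wal R` is constant
between the zeros of `iterPrim (l :: L)`. -/
theorem integral_mul_wal_rad_iterPrim {l : ℕ} {L : List ℕ} (hL : (l :: L).Pairwise (· < ·))
    {R : Finset ℕ} (hR : ∀ i ∈ R, i < l) {φ φ' : ℝ → ℝ}
    (hφ : ∀ x ∈ Set.Icc (0 : ℝ) 1, HasDerivWithinAt φ (φ' x) (Set.Icc 0 1) x)
    (hφ' : ContinuousOn φ' (Set.Icc 0 1)) :
    ∫ x in (0 : ℝ)..1, φ x * (wal (insert l R) x * iterPrim L x)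
      = -∫ x in (0 : ℝ)..1, φ' x * (wal R x * iterPrim (l :: L) x) := by
  have hlR : l ∉ R := fun h => (hR l h).false
  set W := iterPrim (l :: L) with hW
  have hWc : Continuous W := continuous_iterPrim _
  have hRloc : ∀ x : ℝ, ∀ᶠ y in 𝓝[≥] x, wal R y = wal R x := fun x => by
    filter_upwards [eventually_floor_eq_right x l] with y hy using wal_eq_of_floor_eq hR hy
  have hcont : Continuous fun x => wal R x * W x := by
    refine continuous_iff_continuousAt.2 fun x => ?_
    by_cases hx : (⌊2 ^ l * x⌋ : ℝ) = 2 ^ l * x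
    · have h0 : W x = 0 := iterPrim_eq_zero hL hx
      have ht : Tendsto (fun y => wal R y * W y) (𝓝 x) (𝓝 0) := by
        refine squeeze_zero_norm (a := fun y => |W y|) (fun y => ?_) ?_
        · rw [Real.norm_eq_abs, abs_mul, abs_wal, one_mul]
        · have := hWc.abs.tendsto x
          rwa [h0, abs_zero] at this
      rw [ContinuousAt, h0, mul_zero]
      exact ht
    · refine (continuousAt_const.mul hWc.continuousAt).congr
        (f := fun y => wal R x * W y) ?_
      filter_upwards [eventually_floor_eq hx] with y hy
      rw [wal_eq_of_floor_eq hR hy]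
  have hderivW : ∀ x : ℝ, HasDerivWithinAt W (rad l x * iterPrim L x) (Set.Ioi x) x := by
    intro x
    have hc : ContinuousWithinAt (fun t => rad l t * iterPrim L t) (Set.Ioi x) x := by
      have e : ∀ᶠ y in 𝓝[>] x, rad l y * iterPrim L y = rad l x * iterPrim L y := by
        filter_upwards [(eventually_floor_eq_right x (l + 1)).filter_mono
          (nhdsWithin_mono x Set.Ioi_subset_Ici_self)] with y hy
        rw [rad_eq_of_floor_eq (Nat.lt_succ_self l) hy]
      refine ContinuousWithinAt.congr_of_eventuallyEq
        ((continuous_const.mul (continuous_iterPrim L)).continuousWithinAt) e rfl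
    have hm : StronglyMeasurableAtFilter (fun t => rad l t * iterPrim L t) (𝓝[>] x) volume :=
      ((measurable_rad l).mul
        (continuous_iterPrim L).measurable).stronglyMeasurable.stronglyMeasurableAtFilter
    have := intervalIntegral.integral_hasDerivWithinAt_right (intervalIntegrable_rad_mul l L 0 x)
      (s := Set.Ici x) hm hc
    exact this.mono Set.Ioi_subset_Ici_self
  have hderiv : ∀ x : ℝ, HasDerivWithinAt (fun x => wal R x * W x)
      (wal (insert l R) x * iterPrim L x) (Set.Ioi x) x := by
    intro x
    have h1 := (hderivW x).const_mul (wal R x)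
    rw [wal_mul_rad hlR, mul_assoc]
    refine h1.congr_of_eventuallyEq ?_ rfl
    filter_upwards [(hRloc x).filter_mono (nhdsWithin_mono x Set.Ioi_subset_Ici_self)] with y hy
    rw [hy]
  have hW1 : W 1 = 0 := iterPrim_eq_zero hL (by
    have : (2 : ℝ) ^ l * 1 = ((2 ^ l : ℤ) : ℝ) := by push_cast; ring
    rw [this, Int.floor_intCast])
  have hW0 : W 0 = 0 := iterPrim_eq_zero hL (by simp)
  have hint : IntervalIntegrable (fun x => wal (insert l R) x * iterPrim L x) volume 0 1 := by
    refine ((continuous_iterPrim L).intervalIntegrable 0 1).mono_fun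
      ((measurable_wal _).mul (continuous_iterPrim L).measurable).aestronglyMeasurable
      (ae_of_all _ fun t => ?_)
    simp [abs_wal]
  have key := intervalIntegral.integral_mul_deriv_eq_deriv_mul_of_hasDeriv_right
    (a := (0 : ℝ)) (b := 1) (u := φ) (u' := φ') (v := fun x => wal R x * W x)
    (v' := fun x => wal (insert l R) x * iterPrim L x)
    (by
      rw [Set.uIcc_of_le zero_le_one]
      exact fun x hx => (hφ x hx).continuousWithinAt)
    hcont.continuousOn
    (by
      intro x hx
      rw [min_eq_left zero_le_one, max_eq_right zero_le_one] at hx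
      exact ((hφ x ⟨hx.1.le, hx.2.le⟩).hasDerivAt (Icc_mem_nhds hx.1 hx.2)).hasDerivWithinAt)
    (fun x _ => hderiv x)
    (ContinuousOn.intervalIntegrable (by rwa [Set.uIcc_of_le zero_le_one])) hint
  rw [key, hW0, hW1]
  simp

theorem integral_wal {K : Finset ℕ} (hK : K.Nonempty) : ∫ x in (0 : ℝ)..1, wal K x = 0 := by
  have h := integral_mul_wal_rad_iterPrim (l := K.max' hK) (L := []) (by simp)
    (R := K.erase (K.max' hK)) (fun i hi => K.lt_max'_of_mem_erase_max' hK hi)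
    (φ := fun _ => 1) (φ' := fun _ => 0) (fun x _ => hasDerivWithinAt_const _ _ _)
    continuousOn_const
  simpa [Finset.insert_erase (K.max'_mem hK)] using h

theorem primMean_le_one (L : List ℕ) : primMean L ≤ 1 := by
  induction L with
  | nil => simp
  | cons l L ih =>
    rw [primMean_cons]
    have : (1 : ℝ) / 2 ^ (l + 2) ≤ 1 := by
      rw [div_le_one (by positivity)]
      exact one_le_pow₀ (by norm_num)
    exact mul_le_one₀ this (primMean_pos L).le ih

theorem abs_iterPrim_le_one {L : List ℕ} (hL : L.Pairwise (· < ·)) (x : ℝ) :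
    |iterPrim L x| ≤ 1 := by
  rw [abs_of_nonneg (iterPrim_nonneg hL x)]
  cases L with
  | nil => simp
  | cons l L =>
    refine (iterPrim_le hL (by simp) x).trans ?_
    rw [primMean_cons]
    have : (1 : ℝ) / 2 ^ (l + 2) ≤ 1 / 2 := by
      refine one_div_le_one_div_of_le (by norm_num) ?_
      rw [pow_succ]
      have : (1 : ℝ) ≤ 2 ^ (l + 1) := one_le_pow₀ (by norm_num)
      linarith
    have h1 := primMean_le_one L
    have h2 := primMean_pos L
    nlinarith

/-! ### The uniform law on the cube -/

instance isProbabilityMeasure_Icc : IsProbabilityMeasure (volume.restrict (Set.Icc (0 : ℝ) 1)) :=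
  ⟨by simp⟩

/-- The uniform law on the unit cube, as a product measure. -/
noncomputable abbrev cubeMeasure (ι : Type*) [Fintype ι] : Measure (ι → ℝ) :=
  Measure.pi fun _ => volume.restrict (Set.Icc (0 : ℝ) 1)

section Measure

variable {ι : Type*}

theorem cube_eq_pi : cube ι = Set.univ.pi fun _ => Set.Icc (0 : ℝ) 1 :=
  (Set.pi_univ_Icc (0 : ι → ℝ) 1).symm

theorem mem_cube {x : ι → ℝ} : x ∈ cube ι ↔ ∀ i, x i ∈ Set.Icc (0 : ℝ) 1 := by
  rw [cube_eq_pi, Set.mem_univ_pi]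

theorem isCompact_cube : IsCompact (cube ι) := by
  rw [cube_eq_pi]
  exact isCompact_univ_pi fun _ => isCompact_Icc

theorem update_mem_cube [DecidableEq ι] {x : ι → ℝ} (hx : x ∈ cube ι) (j : ι) {t : ℝ}
    (ht : t ∈ Set.Icc (0 : ℝ) 1) : Function.update x j t ∈ cube ι := by
  rw [mem_cube] at hx ⊢
  intro i
  by_cases h : i = j
  · subst h; simpa using ht
  · simpa [h] using hx i

theorem piecewise_mem_cube [DecidableEq ι] {x y : ι → ℝ} (v : Finset ι) (hx : x ∈ cube ι)
    (hy : y ∈ cube ι) : v.piecewise x y ∈ cube ι := by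
  rw [mem_cube] at *
  intro i
  by_cases h : i ∈ v
  · simpa [h] using hx i
  · simpa [h] using hy i

/-- The point with the coordinates of `y` on `v` and those of `x` off `v`. -/
def glue [DecidableEq ι] (v : Finset ι) (y : v → ℝ) (x : ι → ℝ) : ι → ℝ :=
  fun j => if h : j ∈ v then y ⟨j, h⟩ else x j

theorem glue_mem_cube [DecidableEq ι] {v : Finset ι} {y : v → ℝ} {x : ι → ℝ} (hy : y ∈ cube v)
    (hx : x ∈ cube ι) : glue v y x ∈ cube ι := by
  rw [mem_cube] at *
  intro i
  by_cases h : i ∈ v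
  · simpa [glue, h] using hy ⟨i, h⟩
  · simpa [glue, h] using hx i

theorem measurable_glue [DecidableEq ι] (v : Finset ι) :
    Measurable fun p : (v → ℝ) × (ι → ℝ) => glue v p.1 p.2 := by
  refine measurable_pi_iff.2 fun i => ?_
  by_cases h : i ∈ v
  · simp only [glue, h, dite_true]
    fun_prop
  · simp only [glue, h, dite_false]
    fun_prop

variable [Fintype ι]

theorem measurableSet_cube : MeasurableSet (cube ι) := isCompact_cube.isClosed.measurableSet

theorem volume_restrict_cube :
    (volume : Measure (ι → ℝ)).restrict (cube ι) = cubeMeasure ι := by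
  rw [cube_eq_pi, volume_pi, Measure.restrict_pi_pi]

theorem ae_mem_cube : ∀ᵐ x ∂cubeMeasure ι, x ∈ cube ι := by
  rw [← volume_restrict_cube]
  exact ae_restrict_mem measurableSet_cube

theorem integrable_of_continuousOn {g : (ι → ℝ) → ℝ} (hg : ContinuousOn g (cube ι)) :
    Integrable g (cubeMeasure ι) := by
  rw [← volume_restrict_cube]
  exact hg.integrableOn_compact isCompact_cube

theorem integrable_mul_of_abs_le_one {g χ : (ι → ℝ) → ℝ} (hg : ContinuousOn g (cube ι))
    (hχ : Measurable χ) (hχ1 : ∀ x, |χ x| ≤ 1) :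
    Integrable (fun x => g x * χ x) (cubeMeasure ι) :=
  (integrable_of_continuousOn hg).mul_bdd (c := 1) hχ.aestronglyMeasurable
    (ae_of_all _ fun x => by simpa using hχ1 x)

theorem measurePreserving_update [DecidableEq ι] (j : ι) :
    MeasurePreserving (fun p : (ι → ℝ) × ℝ => Function.update p.1 j p.2)
      ((cubeMeasure ι).prod (volume.restrict (Set.Icc (0 : ℝ) 1))) (cubeMeasure ι) := by
  have hm : Measurable fun p : (ι → ℝ) × ℝ => Function.update p.1 j p.2 := by
    refine measurable_pi_iff.2 fun i => ?_
    by_cases h : i = j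
    · subst h; simpa using measurable_snd
    · simp only [h, Function.update_of_ne, ne_eq, not_false_eq_true]
      fun_prop
  refine ⟨hm, ?_⟩
  symm
  refine Measure.pi_eq fun s hs => ?_
  rw [Measure.map_apply hm (MeasurableSet.univ_pi hs)]
  have hpre : (fun p : (ι → ℝ) × ℝ => Function.update p.1 j p.2) ⁻¹' Set.univ.pi s
      = (Set.univ.pi (Function.update s j Set.univ)) ×ˢ s j := by
    ext p
    simp only [Set.mem_preimage, Set.mem_univ_pi, Set.mem_prod]
    constructor
    · intro h
      refine ⟨fun i => ?_, by simpa using h j⟩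
      by_cases hi : i = j
      · subst hi; simp
      · simpa [hi] using h i
    · rintro ⟨h, h'⟩ i
      by_cases hi : i = j
      · subst hi; simpa using h'
      · simpa [hi] using h i
  rw [hpre, Measure.prod_prod, Measure.pi_pi, ← Finset.mul_prod_erase _ _ (Finset.mem_univ j),
    ← Finset.mul_prod_erase _ (fun i => (volume.restrict (Set.Icc (0 : ℝ) 1)) (s i))
      (Finset.mem_univ j)]
  simp only [Function.update_self, measure_univ, one_mul]
  rw [mul_comm]
  congr 1
  refine Finset.prod_congr rfl fun i hi => ?_
  rw [Function.update_of_ne (Finset.ne_of_mem_erase hi)]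

theorem measurePreserving_piecewise [DecidableEq ι] (v : Finset ι) :
    MeasurePreserving (fun p : (ι → ℝ) × (ι → ℝ) => v.piecewise p.1 p.2)
      ((cubeMeasure ι).prod (cubeMeasure ι)) (cubeMeasure ι) := by
  have hm : Measurable fun p : (ι → ℝ) × (ι → ℝ) => v.piecewise p.1 p.2 := by
    refine measurable_pi_iff.2 fun i => ?_
    by_cases h : i ∈ v
    · simp only [h, Finset.piecewise_eq_of_mem]
      fun_prop
    · simp only [h, not_false_eq_true, Finset.piecewise_eq_of_notMem]
      fun_prop
  refine ⟨hm, ?_⟩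
  symm
  refine Measure.pi_eq fun s hs => ?_
  rw [Measure.map_apply hm (MeasurableSet.univ_pi hs)]
  have hpre : (fun p : (ι → ℝ) × (ι → ℝ) => v.piecewise p.1 p.2) ⁻¹' Set.univ.pi s
      = (Set.univ.pi (v.piecewise s fun _ => Set.univ)) ×ˢ
        (Set.univ.pi (v.piecewise (fun _ => Set.univ) s)) := by
    ext p
    simp only [Set.mem_preimage, Set.mem_univ_pi, Set.mem_prod, ← forall_and]
    refine forall_congr' fun i => ?_
    by_cases h : i ∈ v <;> simp [h]
  rw [hpre, Measure.prod_prod, Measure.pi_pi, Measure.pi_pi, ← Finset.prod_mul_distrib]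
  refine Finset.prod_congr rfl fun i _ => ?_
  by_cases h : i ∈ v <;> simp only [h, Finset.piecewise_eq_of_mem, Finset.piecewise_eq_of_notMem,
    not_false_eq_true, measure_univ, mul_one, one_mul]

theorem measurePreserving_glue [DecidableEq ι] (v : Finset ι) :
    MeasurePreserving (fun p : (v → ℝ) × (ι → ℝ) => glue v p.1 p.2)
      ((cubeMeasure v).prod (cubeMeasure ι)) (cubeMeasure ι) := by
  have hm := measurable_glue v
  refine ⟨hm, ?_⟩
  symm
  refine Measure.pi_eq fun s hs => ?_
  rw [Measure.map_apply hm (MeasurableSet.univ_pi hs)]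
  have hpre : (fun p : (v → ℝ) × (ι → ℝ) => glue v p.1 p.2) ⁻¹' Set.univ.pi s
      = (Set.univ.pi fun i : v => s i) ×ˢ
        (Set.univ.pi (v.piecewise (fun _ => Set.univ) s)) := by
    ext p
    simp only [Set.mem_preimage, Set.mem_univ_pi, Set.mem_prod]
    constructor
    · intro h
      refine ⟨fun i => by simpa [glue] using h i, fun i => ?_⟩
      by_cases hi : i ∈ v
      · simp [hi]
      · simpa [glue, hi] using h i
    · rintro ⟨h, h'⟩ i
      by_cases hi : i ∈ v
      · simpa [glue, hi] using h ⟨i, hi⟩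
      · simpa [glue, hi] using h' i
  rw [hpre, Measure.prod_prod, Measure.pi_pi, Measure.pi_pi,
    Finset.prod_coe_sort v fun i => (volume.restrict (Set.Icc (0 : ℝ) 1)) (s i),
    ← Finset.prod_mul_prod_compl v fun i => (volume.restrict (Set.Icc (0 : ℝ) 1)) (s i)]
  congr 1
  rw [← Finset.prod_mul_prod_compl v]
  rw [Finset.prod_eq_one (s := v) (fun i hi => by
    simp only [hi, Finset.piecewise_eq_of_mem, measure_univ]), one_mul]
  refine Finset.prod_congr rfl fun i hi => ?_
  rw [Finset.piecewise_eq_of_notMem _ _ _ (Finset.mem_compl.1 hi)]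

theorem measurePreserving_restrict [DecidableEq ι] (v : Finset ι) :
    MeasurePreserving (fun (x : ι → ℝ) (i : v) => x i) (cubeMeasure ι) (cubeMeasure v) := by
  have hm : Measurable fun (x : ι → ℝ) (i : v) => x i :=
    measurable_pi_iff.2 fun i => measurable_pi_apply _
  refine ⟨hm, ?_⟩
  symm
  refine Measure.pi_eq fun s hs => ?_
  rw [Measure.map_apply hm (MeasurableSet.univ_pi hs)]
  have hpre : (fun (x : ι → ℝ) (i : v) => x i) ⁻¹' Set.univ.pi s
      = Set.univ.pi fun i => if h : i ∈ v then s ⟨i, h⟩ else Set.univ := by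
    ext x
    simp only [Set.mem_preimage, Set.mem_univ_pi]
    constructor
    · intro h i
      by_cases hi : i ∈ v
      · simpa [hi] using h ⟨i, hi⟩
      · simp [hi]
    · rintro h ⟨i, hi⟩
      simpa [hi] using h i
  rw [hpre, Measure.pi_pi, ← Finset.prod_mul_prod_compl v, ← Finset.prod_coe_sort v]
  rw [Finset.prod_eq_one (s := vᶜ) (fun i hi => by
    simp only [Finset.mem_compl.1 hi, dif_neg, not_false_eq_true, measure_univ]), mul_one]
  refine Finset.prod_congr rfl fun i _ => ?_
  simp

/-- Fubini's theorem for one coordinate. -/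
theorem integral_cube_update [DecidableEq ι] (j : ι) {H : (ι → ℝ) → ℝ}
    (hH : Integrable H (cubeMeasure ι)) :
    ∫ x, H x ∂cubeMeasure ι
      = ∫ x, (∫ t in (0 : ℝ)..1, H (Function.update x j t)) ∂cubeMeasure ι := by
  have hp := measurePreserving_update j
  have h1 := integral_map hp.measurable.aemeasurable (f := H)
    (by rw [hp.map_eq]; exact hH.aestronglyMeasurable)
  rw [hp.map_eq] at h1
  have h2 : Integrable (fun p : (ι → ℝ) × ℝ => H (Function.update p.1 j p.2))
      ((cubeMeasure ι).prod (volume.restrict (Set.Icc (0 : ℝ) 1))) :=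
    hp.integrable_comp_of_integrable hH
  rw [h1, integral_prod _ h2]
  simp only [intervalIntegral.integral_of_le zero_le_one, integral_Icc_eq_integral_Ioc]

end Measure

/-! ### Mixed derivatives along coordinates and integration by parts -/

section Family

variable {ι : Type*} [LinearOrder ι]

theorem foldr_partialDeriv_congr (l : List ι) (g : (ι → ℝ) → ℝ) {a b : ι → ℕ}
    (h : ∀ i ∈ l, a i = b i) :
    l.foldr (fun j h => (partialDeriv j)^[a j] h) g
      = l.foldr (fun j h => (partialDeriv j)^[b j] h) g := by
  induction l with
  | nil => rfl
  | cons i l ih =>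
    rw [List.foldr_cons, List.foldr_cons, ih fun i' hi' => h i' (by simp [hi']), h i (by simp)]

theorem foldr_partialDeriv_succ (l : List ι) (hl : l.Pairwise (· < ·)) (g : (ι → ℝ) → ℝ)
    (a : ι → ℕ) (j : ι) (hj : j ∈ l) (ha : ∀ i < j, a i = 0) :
    l.foldr (fun i h => (partialDeriv i)^[(a + Pi.single j 1 : ι → ℕ) i] h) g
      = partialDeriv j (l.foldr (fun i h => (partialDeriv i)^[a i] h) g) := by
  induction l with
  | nil => simp at hj
  | cons i l ih =>
    obtain ⟨h1, h2⟩ := List.pairwise_cons.1 hl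
    rw [List.foldr_cons, List.foldr_cons]
    rcases List.mem_cons.1 hj with rfl | hj
    · rw [foldr_partialDeriv_congr l g (b := a) fun i hi => by
        simp [(h1 i hi).ne']]
      simp [Function.iterate_succ_apply']
    · have hij := h1 j hj
      rw [ih h2 hj]
      simp [ha i hij, hij.ne]

/-- `F` is a family of mixed derivatives of `g` of orders up to `α` in each coordinate: `F 0 = g` on
the cube, every `F a` is continuous on the cube, and `F (a + e_j)` is the derivative of `F a` in
coordinate `j` whenever `a` vanishes in the coordinates before `j`. -/
structure MixedFamily (α : ℕ) (g : (ι → ℝ) → ℝ) (F : (ι → ℕ) → (ι → ℝ) → ℝ) : Prop where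
  base : ∀ x ∈ cube ι, F 0 x = g x
  continuousOn : ∀ a : ι → ℕ, (∀ j, a j ≤ α) → ContinuousOn (F a) (cube ι)
  deriv : ∀ a : ι → ℕ, (∀ j, a j ≤ α) → ∀ j, a j < α → (∀ i < j, a i = 0) → ∀ x ∈ cube ι,
    HasDerivWithinAt (fun t => F a (Function.update x j t)) (F (a + Pi.single j 1) x)
      (Set.Icc 0 1) (x j)

variable [Fintype ι]

theorem mixedDeriv_add_single (g : (ι → ℝ) → ℝ) (a : ι → ℕ) (j : ι) (ha : ∀ i < j, a i = 0) :
    mixedDeriv (a + Pi.single j 1) g = partialDeriv j (mixedDeriv a g) :=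
  foldr_partialDeriv_succ _ (Finset.sortedLT_sort _).pairwise g a j
    ((Finset.mem_sort _).2 (Finset.mem_univ j)) ha

theorem mixedDeriv_zero (g : (ι → ℝ) → ℝ) : mixedDeriv 0 g = g := by
  rw [mixedDeriv]
  induction (Finset.univ.sort fun i j : ι => i ≤ j) with
  | nil => rfl
  | cons i l ih => simp

theorem MixedSmooth.mixedFamily {α : ℕ} {g : (ι → ℝ) → ℝ} (hg : MixedSmooth α g) :
    MixedFamily α g fun a => mixedDeriv a g where
  base x _ := by rw [mixedDeriv_zero]
  continuousOn a ha := (hg a ha).1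
  deriv a ha j hj h0 x hx := by
    rw [mixedDeriv_add_single g a j h0]
    exact ((hg a ha).2 j hj h0 x hx).hasDerivWithinAt

/-- Induction on multi-indices along the order in which `mixedDeriv` differentiates: the coordinate
raised is the first nonzero one of the new multi-index. -/
theorem multiIndex_induction {p : (ι → ℕ) → Prop} (h0 : p 0)
    (hs : ∀ a j, (∀ i < j, a i = 0) → p a → p (a + Pi.single j 1)) (a : ι → ℕ) : p a := by
  induction hn : ∑ i, a i generalizing a with
  | zero =>
    have : a = 0 := by
      funext i
      simpa using (Finset.sum_eq_zero_iff.1 hn) i (Finset.mem_univ i)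
    rwa [this]
  | succ n ih =>
    have hne : (Finset.univ.filter fun i => a i ≠ 0).Nonempty := by
      by_contra h
      rw [Finset.not_nonempty_iff_eq_empty, Finset.filter_eq_empty_iff] at h
      have : ∑ i, a i = 0 := Finset.sum_eq_zero fun i hi => by simpa using h hi
      omega
    set j := (Finset.univ.filter fun i => a i ≠ 0).min' hne with hj
    have hj0 : a j ≠ 0 := (Finset.mem_filter.1 (Finset.min'_mem _ hne)).2
    have hlt : ∀ i < j, a i = 0 := by
      intro i hi
      by_contra h
      exact absurd (Finset.min'_le _ i (by simp [h])) (not_le.2 hi)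
    have hle : Pi.single j 1 ≤ a := by
      intro i
      by_cases h : i = j
      · subst h; simpa using Nat.one_le_iff_ne_zero.2 hj0
      · simp [h]
    have hsum : ∑ i, (a - Pi.single j 1 : ι → ℕ) i = n := by
      have h1 : ∑ i, (a - Pi.single j 1 : ι → ℕ) i + ∑ i, (Pi.single j 1 : ι → ℕ) i = n + 1 := by
        rw [← Finset.sum_add_distrib, ← hn]
        exact Finset.sum_congr rfl fun i _ => Nat.sub_add_cancel (hle i)
      rw [Finset.sum_pi_single' j 1 Finset.univ] at h1
      simpa using h1
    have := hs (a - Pi.single j 1) j (fun i hi => by simp [hlt i hi]) (ih _ hsum)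
    rwa [tsub_add_cancel_of_le hle] at this

/-- A family of mixed derivatives consists of the mixed derivatives. -/
theorem MixedFamily.mixedDeriv_eq {α : ℕ} {g : (ι → ℝ) → ℝ} {F : (ι → ℕ) → (ι → ℝ) → ℝ}
    (hF : MixedFamily α g F) (a : ι → ℕ) (ha : ∀ j, a j ≤ α) :
    ∀ x ∈ cube ι, mixedDeriv a g x = F a x := by
  induction a using multiIndex_induction with
  | h0 => exact fun x hx => by rw [mixedDeriv_zero, hF.base x hx]
  | hs a j h0 ih =>
    have ha' : ∀ i, a i ≤ α := fun i => le_trans (by simp) (ha i)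
    have haj : a j < α := by simpa using ha j
    intro x hx
    rw [mixedDeriv_add_single g a j h0, partialDeriv]
    have hxj := mem_cube.1 hx j
    rw [derivWithin_congr (fun t ht => ih ha' _ (update_mem_cube hx j ht))
      (by rw [Function.update_eq_self]; exact ih ha' x hx)]
    exact (hF.deriv a ha' j haj h0 x hx).derivWithin (uniqueDiffOn_Icc zero_lt_one _ hxj)

theorem integral_partial_step {F F' : (ι → ℝ) → ℝ} (j : ι) (hF : ContinuousOn F (cube ι))
    (hF' : ContinuousOn F' (cube ι))
    (hd : ∀ x ∈ cube ι, HasDerivWithinAt (fun t => F (Function.update x j t)) (F' x)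
      (Set.Icc 0 1) (x j))
    {l : ℕ} {L : List ℕ} (hL : (l :: L).Pairwise (· < ·)) {R : Finset ℕ} (hR : ∀ i ∈ R, i < l)
    (χ : ι → ℝ → ℝ) (hχ : ∀ i, Measurable (χ i)) (hχ1 : ∀ i x, |χ i x| ≤ 1) :
    ∫ x, F x * ((wal (insert l R) (x j) * iterPrim L (x j))
        * ∏ i ∈ Finset.univ.erase j, χ i (x i)) ∂cubeMeasure ι
      = -∫ x, F' x * ((wal R (x j) * iterPrim (l :: L) (x j))
        * ∏ i ∈ Finset.univ.erase j, χ i (x i)) ∂cubeMeasure ι := by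
  have hrest : ∀ x : ι → ℝ, |∏ i ∈ Finset.univ.erase j, χ i (x i)| ≤ 1 := fun x => by
    rw [Finset.abs_prod]
    exact Finset.prod_le_one (fun _ _ => abs_nonneg _) fun i _ => hχ1 i _
  have hrestm : Measurable fun x : ι → ℝ => ∏ i ∈ Finset.univ.erase j, χ i (x i) :=
    Finset.measurable_fun_prod _ fun i _ => (hχ i).comp (measurable_pi_apply i)
  have hgen : ∀ (K : Finset ℕ) (M : List ℕ), M.Pairwise (· < ·) → ∀ G : (ι → ℝ) → ℝ,
      ContinuousOn G (cube ι) → Integrable (fun x => G x * ((wal K (x j) * iterPrim M (x j))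
        * ∏ i ∈ Finset.univ.erase j, χ i (x i))) (cubeMeasure ι) := by
    intro K M hM G hG
    refine integrable_mul_of_abs_le_one hG ?_ fun x => ?_
    · exact (((measurable_wal K).comp (measurable_pi_apply j)).mul
        ((continuous_iterPrim M).measurable.comp (measurable_pi_apply j))).mul hrestm
    · rw [abs_mul, abs_mul, abs_wal, one_mul]
      exact mul_le_one₀ (abs_iterPrim_le_one hM _) (abs_nonneg _) (hrest x)
  rw [integral_cube_update j (hgen _ _ (List.pairwise_cons.1 hL).2 F hF),
    integral_cube_update j (hgen _ _ hL F' hF'), ← integral_neg]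
  refine integral_congr_ae ?_
  filter_upwards [ae_mem_cube] with x hx
  have hprod : ∀ t, ∏ i ∈ Finset.univ.erase j, χ i (Function.update x j t i)
      = ∏ i ∈ Finset.univ.erase j, χ i (x i) := fun t =>
    Finset.prod_congr rfl fun i hi => by
      rw [Function.update_of_ne (Finset.ne_of_mem_erase hi)]
  simp only [hprod, Function.update_self, ← mul_assoc]
  rw [intervalIntegral.integral_mul_const, intervalIntegral.integral_mul_const, ← neg_mul]
  congr 1
  simp only [mul_assoc]
  have hup : ContinuousOn (fun t => Function.update x j t) (Set.Icc (0 : ℝ) 1) :=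
    (continuous_const.update j continuous_id :
      Continuous fun t : ℝ => Function.update x j t).continuousOn
  refine integral_mul_wal_rad_iterPrim hL hR (fun t ht => ?_)
    (hF'.comp hup fun t ht => update_mem_cube hx j ht)
  have := hd _ (update_mem_cube hx j ht)
  simpa using this

/-- Repeated integration by parts: the finest bits `L j` of the Walsh frequency in each coordinate
are traded for derivatives of the integrand and iterated primitives. -/
theorem MixedFamily.abs_integral_wal {α : ℕ} {g : (ι → ℝ) → ℝ} {F : (ι → ℕ) → (ι → ℝ) → ℝ}
    (hF : MixedFamily α g F) (a : ι → ℕ) (ha : ∀ j, a j ≤ α) (L : ι → List ℕ)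
    (hLa : ∀ j, (L j).length = a j) (hL : ∀ j, (L j).Pairwise (· < ·)) (R : ι → Finset ℕ)
    (hR : ∀ j, ∀ i ∈ R j, ∀ l ∈ L j, i < l) :
    |∫ x, g x * ∏ j, wal (R j ∪ (L j).toFinset) (x j) ∂cubeMeasure ι|
      = |∫ x, F a x * ∏ j, wal (R j) (x j) * iterPrim (L j) (x j) ∂cubeMeasure ι| := by
  induction a using multiIndex_induction generalizing L R with
  | h0 =>
    have hnil : ∀ j, L j = [] := fun j => List.length_eq_zero_iff.1 (hLa j)
    congr 1
    refine integral_congr_ae ?_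
    filter_upwards [ae_mem_cube] with x hx
    simp [hnil, hF.base x hx]
  | hs a j h0 ih =>
    have ha' : ∀ i, a i ≤ α := fun i => le_trans (by simp) (ha i)
    have haj : a j < α := by simpa using ha j
    obtain ⟨l, M, hM⟩ : ∃ l M, L j = l :: M := by
      have := hLa j
      cases hLj : L j with
      | nil => simp [hLj] at this
      | cons l M => exact ⟨l, M, rfl⟩
    have hLj := hL j
    rw [hM] at hLj
    have hRj : ∀ i ∈ R j, i < l := fun i hi => hR j i hi l (by simp [hM])
    have ih' := ih ha' (Function.update L j M) (fun i => by
        by_cases hi : i = j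
        · subst hi
          have := hLa i
          simp [hM] at this
          simpa using this
        · simpa [hi] using hLa i)
      (fun i => by
        by_cases hi : i = j
        · subst hi; simpa using (List.pairwise_cons.1 hLj).2
        · simpa [hi] using hL i)
      (Function.update R j (insert l (R j)))
      (fun i => by
        by_cases hi : i = j
        · subst hi
          simp only [Function.update_self, Finset.mem_insert]
          rintro i' (rfl | hi') l' hl'
          · exact (List.pairwise_cons.1 hLj).1 l' hl'
          · exact hR i i' hi' l' (by simp [hM, hl'])
        · simpa [hi] using hR i)
    have hset : ∀ i, Function.update R j (insert l (R j)) i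
        ∪ (Function.update L j M i).toFinset = R i ∪ (L i).toFinset := by
      intro i
      by_cases hi : i = j
      · subst hi
        simp [hM]
      · simp [hi]
    simp only [hset] at ih'
    rw [ih']
    refine (congrArg abs ?_).trans (abs_neg _)
    have key := integral_partial_step j (hF.continuousOn a ha')
      (hF.continuousOn _ ha) (hF.deriv a ha' j haj h0) hLj hRj
      (fun i y => wal (R i) y * iterPrim (L i) y)
      (fun i => (measurable_wal _).mul (continuous_iterPrim _).measurable)
      (fun i y => by
        rw [abs_mul, abs_wal, one_mul]
        exact abs_iterPrim_le_one (hL i) y)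
    refine Eq.trans ?_ (key.trans ?_)
    · refine integral_congr_ae (ae_of_all _ fun x => ?_)
      simp only
      rw [← Finset.mul_prod_erase _ _ (Finset.mem_univ j)]
      simp only [Function.update_self]
      congr 2
      refine Finset.prod_congr rfl fun i hi => ?_
      rw [Function.update_of_ne (Finset.ne_of_mem_erase hi),
        Function.update_of_ne (Finset.ne_of_mem_erase hi)]
    · congr 1
      refine integral_congr_ae (ae_of_all _ fun x => ?_)
      simp only
      rw [← Finset.mul_prod_erase _ _ (Finset.mem_univ j), hM]

end Family

/-! ### Smoothness and Walsh coefficients of ANOVA components -/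

section Anova

theorem continuous_piecewise_right {ι : Type*} [DecidableEq ι] (v : Finset ι) (x : ι → ℝ) :
    Continuous fun y : ι → ℝ => v.piecewise x y := by
  refine continuous_pi fun i => ?_
  by_cases h : i ∈ v
  · simpa [h] using continuous_const
  · simpa [h] using continuous_apply i

theorem continuous_piecewise_left {ι : Type*} [DecidableEq ι] (v : Finset ι) (y : ι → ℝ) :
    Continuous fun x : ι → ℝ => v.piecewise x y := by
  refine continuous_pi fun i => ?_
  by_cases h : i ∈ v
  · simpa [h] using continuous_apply i
  · simpa [h] using continuous_const

theorem piecewise_update_left {ι : Type*} [DecidableEq ι] (v : Finset ι) {j : ι} (hj : j ∈ v)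
    (x y : ι → ℝ) (t : ℝ) :
    v.piecewise (Function.update x j t) y = Function.update (v.piecewise x y) j t := by
  funext i
  by_cases hi : i = j
  · subst hi; simp [hj]
  · by_cases hv : i ∈ v <;> simp [hi, hv]

theorem piecewise_update_left_of_notMem {ι : Type*} [DecidableEq ι] (v : Finset ι) {j : ι}
    (hj : j ∉ v) (x y : ι → ℝ)
    (t : ℝ) : v.piecewise (Function.update x j t) y = v.piecewise x y := by
  funext i
  by_cases hv : i ∈ v
  · have : i ≠ j := fun h => hj (h ▸ hv)
    simp [this, hv]
  · simp [hv]

theorem zero_mem_cube {ι : Type*} : (0 : ι → ℝ) ∈ cube ι := by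
  rw [mem_cube]; intro i; simp

theorem exists_abs_le_of_continuousOn {ι : Type*} {G : (ι → ℝ) → ℝ} (hG : ContinuousOn G (cube ι)) :
    ∃ B, 0 ≤ B ∧ ∀ x ∈ cube ι, |G x| ≤ B := by
  obtain ⟨B, hB⟩ := isCompact_cube.exists_bound_of_continuousOn hG
  exact ⟨|B|, abs_nonneg B, fun x hx => (hB x hx).trans (le_abs_self B)⟩

theorem MixedFamily.sub {ι : Type*} [LinearOrder ι] {α : ℕ} {g h : (ι → ℝ) → ℝ}
    {F H : (ι → ℕ) → (ι → ℝ) → ℝ}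
    (hF : MixedFamily α g F) (hH : MixedFamily α h H) :
    MixedFamily α (fun x => g x - h x) fun a x => F a x - H a x where
  base x hx := by rw [hF.base x hx, hH.base x hx]
  continuousOn a ha := (hF.continuousOn a ha).sub (hH.continuousOn a ha)
  deriv a ha j hj h0 x hx := (hF.deriv a ha j hj h0 x hx).sub (hH.deriv a ha j hj h0 x hx)

theorem MixedFamily.sum {ι : Type*} [LinearOrder ι] {α : ℕ} {κ : Type*} (s : Finset κ)
    {g : κ → (ι → ℝ) → ℝ}
    {F : κ → (ι → ℕ) → (ι → ℝ) → ℝ} (hF : ∀ k ∈ s, MixedFamily α (g k) (F k)) :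
    MixedFamily α (fun x => ∑ k ∈ s, g k x) fun a x => ∑ k ∈ s, F k a x where
  base x hx := Finset.sum_congr rfl fun k hk => (hF k hk).base x hx
  continuousOn a ha := continuousOn_finsetSum s fun k hk => (hF k hk).continuousOn a ha
  deriv a ha j hj h0 x hx :=
    HasDerivWithinAt.fun_sum fun k hk => (hF k hk).deriv a ha j hj h0 x hx

variable {ι : Type*} [Fintype ι]

/-- The multivariate Walsh function. -/
noncomputable def walProd (K : ι → Finset ℕ) (x : ι → ℝ) : ℝ := ∏ j, wal (K j) (x j)

theorem measurable_walProd (K : ι → Finset ℕ) : Measurable (walProd K) :=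
  Finset.measurable_fun_prod _ fun i _ => (measurable_wal _).comp (measurable_pi_apply i)

theorem abs_walProd (K : ι → Finset ℕ) (x : ι → ℝ) : |walProd K x| = 1 := by
  simp [walProd, Finset.abs_prod, abs_wal]

theorem integrable_mul_walProd {g : (ι → ℝ) → ℝ} (hg : ContinuousOn g (cube ι))
    (K : ι → Finset ℕ) : Integrable (fun x => g x * walProd K x) (cubeMeasure ι) :=
  integrable_mul_of_abs_le_one hg (measurable_walProd K) fun x => (abs_walProd K x).le

variable [LinearOrder ι]

theorem integrable_piecewise {G : (ι → ℝ) → ℝ} (hG : ContinuousOn G (cube ι)) (v : Finset ι)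
    {x : ι → ℝ} (hx : x ∈ cube ι) :
    Integrable (fun y => G (v.piecewise x y)) (cubeMeasure ι) :=
  integrable_of_continuousOn (hG.comp (continuous_piecewise_right v x).continuousOn
    fun _ hy => piecewise_mem_cube v hx hy)

theorem continuousOn_integral_piecewise {G : (ι → ℝ) → ℝ} (hG : ContinuousOn G (cube ι))
    (v : Finset ι) :
    ContinuousOn (fun x => ∫ y, G (v.piecewise x y) ∂cubeMeasure ι) (cube ι) := by
  obtain ⟨B, -, hB⟩ := exists_abs_le_of_continuousOn hG
  refine continuousOn_of_dominated (bound := fun _ => B)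
    (fun x hx => (integrable_piecewise hG v hx).aestronglyMeasurable) (fun x hx => ?_)
    (integrable_const B) ?_
  · filter_upwards [ae_mem_cube] with y hy
    exact hB _ (piecewise_mem_cube v hx hy)
  · filter_upwards [ae_mem_cube] with y hy
    exact hG.comp (continuous_piecewise_left v y).continuousOn
      fun x hx => piecewise_mem_cube v hx hy

/-- Differentiation under a partial integral, one-sided at the faces of the cube. -/
theorem hasDerivWithinAt_integral_piecewise {G G' : (ι → ℝ) → ℝ} {j : ι}
    (hG : ContinuousOn G (cube ι)) (hG' : ContinuousOn G' (cube ι))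
    (hd : ∀ x ∈ cube ι, HasDerivWithinAt (fun t => G (Function.update x j t)) (G' x)
      (Set.Icc 0 1) (x j)) {v : Finset ι} (hj : j ∈ v) {x : ι → ℝ} (hx : x ∈ cube ι) :
    HasDerivWithinAt (fun t => ∫ y, G (v.piecewise (Function.update x j t) y) ∂cubeMeasure ι)
      (∫ y, G' (v.piecewise x y) ∂cubeMeasure ι) (Set.Icc 0 1) (x j) := by
  obtain ⟨B, hB0, hB⟩ := exists_abs_le_of_continuousOn hG'
  have hxj := mem_cube.1 hx j
  -- the slopes converge pointwise and are bounded by the mean value inequality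
  have hdt : ∀ z ∈ cube ι, ∀ t ∈ Set.Icc (0 : ℝ) 1, HasDerivWithinAt
      (fun t => G (Function.update z j t)) (G' (Function.update z j t)) (Set.Icc 0 1) t := by
    intro z hz t ht
    simpa using hd _ (update_mem_cube hz j ht)
  rw [hasDerivWithinAt_iff_tendsto_slope]
  have hev : ∀ᶠ t in 𝓝[Set.Icc 0 1 \ {x j}] (x j), t ∈ Set.Icc (0 : ℝ) 1 \ {x j} :=
    self_mem_nhdsWithin
  have hlim : Tendsto (fun t => ∫ y, slope (fun t => G (v.piecewise (Function.update x j t) y))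
      (x j) t ∂cubeMeasure ι) (𝓝[Set.Icc 0 1 \ {x j}] (x j))
      (𝓝 (∫ y, G' (v.piecewise x y) ∂cubeMeasure ι)) := by
    refine tendsto_integral_filter_of_dominated_convergence (fun _ => B) ?_ ?_
      (integrable_const B) ?_
    · filter_upwards [hev] with t ht
      simp only [slope, vsub_eq_sub, smul_eq_mul]
      exact (((integrable_piecewise hG v (update_mem_cube hx j ht.1)).sub
        (integrable_piecewise hG v (update_mem_cube hx j hxj))).const_mul _).aestronglyMeasurable
    · filter_upwards [hev] with t ht
      filter_upwards [ae_mem_cube] with y hy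
      have hz := piecewise_mem_cube v hx hy
      have hmv := (convex_Icc (0 : ℝ) 1).norm_image_sub_le_of_norm_hasDerivWithin_le
        (fun s hs => hdt _ hz s hs) (fun s hs => hB _ (update_mem_cube hz j hs)) hxj ht.1
      have hne : t - x j ≠ 0 := sub_ne_zero.2 ht.2
      simp only [piecewise_update_left v hj, slope, vsub_eq_sub, smul_eq_mul, norm_mul, norm_inv]
      rw [inv_mul_le_iff₀ (norm_pos_iff.2 hne), mul_comm]
      exact hmv
    · filter_upwards [ae_mem_cube] with y hy
      have hz := piecewise_mem_cube v hx hy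
      have := hasDerivWithinAt_iff_tendsto_slope.1 (hd _ hz)
      simp only [piecewise_update_left v hj]
      simpa [hj] using this
  refine hlim.congr' ?_
  filter_upwards [hev] with t ht
  simp only [slope, vsub_eq_sub, smul_eq_mul]
  rw [integral_const_mul, integral_sub (integrable_piecewise hG v (update_mem_cube hx j ht.1))
    (integrable_piecewise hG v (update_mem_cube hx j hxj))]

/-- Mixed derivatives of a partial integral over the coordinates off `v`: those in directions off
`v` vanish. -/
theorem MixedFamily.integral_piecewise {α : ℕ} {g : (ι → ℝ) → ℝ} {F : (ι → ℕ) → (ι → ℝ) → ℝ}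
    (hF : MixedFamily α g F) (v : Finset ι) :
    MixedFamily α (fun x => ∫ y, g (v.piecewise x y) ∂cubeMeasure ι) fun a x =>
      if ∀ j ∉ v, a j = 0 then ∫ y, F a (v.piecewise x y) ∂cubeMeasure ι else 0 where
  base x hx := by
    simp only [Pi.zero_apply, implies_true, if_true]
    refine integral_congr_ae ?_
    filter_upwards [ae_mem_cube] with y hy using hF.base _ (piecewise_mem_cube v hx hy)
  continuousOn a ha := by
    by_cases h : ∀ j ∉ v, a j = 0
    · simp only [if_pos h]
      exact continuousOn_integral_piecewise (hF.continuousOn a ha) v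
    · simp only [if_neg h]
      exact continuousOn_const
  deriv a ha j hj h0 x hx := by
    have ha' : ∀ i, (a + Pi.single j 1 : ι → ℕ) i ≤ α := by
      intro i
      by_cases hi : i = j
      · subst hi; simpa using hj
      · simpa [hi] using ha i
    by_cases hjv : j ∈ v
    · have hiff : (∀ i ∉ v, (a + Pi.single j 1 : ι → ℕ) i = 0) ↔ ∀ i ∉ v, a i = 0 := by
        refine forall_congr' fun i => imp_congr_right fun hi => ?_
        have : i ≠ j := fun h => hi (h ▸ hjv)
        simp [this]
      by_cases h : ∀ i ∉ v, a i = 0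
      · simp only [if_pos h, if_pos (hiff.2 h)]
        exact hasDerivWithinAt_integral_piecewise (hF.continuousOn a ha) (hF.continuousOn _ ha')
          (hF.deriv a ha j hj h0) hjv hx
      · simp only [if_neg h, if_neg (fun h' => h (hiff.1 h'))]
        exact hasDerivWithinAt_const _ _ _
    · have h : ¬ ∀ i ∉ v, (a + Pi.single j 1 : ι → ℕ) i = 0 := by
        intro h
        have := h j hjv
        simp at this
      simp only [if_neg h, piecewise_update_left_of_notMem v hjv]
      exact hasDerivWithinAt_const _ _ _

/-- Extension of a multi-index by zero. -/
def extendIndex {ι : Type*} [LinearOrder ι] (u : Finset ι) (a : u → ℕ) : ι → ℕ :=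
  fun j => if h : j ∈ u then a ⟨j, h⟩ else 0

theorem extendIndex_zero {ι : Type*} [LinearOrder ι] (u : Finset ι) : extendIndex u 0 = 0 := by
  funext j; simp [extendIndex]

/-- Restricting a function to the face where the coordinates off `u` vanish. -/
theorem MixedFamily.restrict {ι : Type*} [LinearOrder ι] {α : ℕ} {g : (ι → ℝ) → ℝ}
    {F : (ι → ℕ) → (ι → ℝ) → ℝ}
    (hF : MixedFamily α g F) (u : Finset ι) :
    MixedFamily α (fun y : u → ℝ => g (glue u y 0)) fun a y =>
      F (extendIndex u a) (glue u y 0) where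
  base y hy := by
    rw [extendIndex_zero]
    exact hF.base _ (glue_mem_cube hy zero_mem_cube)
  continuousOn a ha := by
    refine ContinuousOn.comp (hF.continuousOn _ fun j => ?_) ?_ fun y hy =>
      glue_mem_cube hy zero_mem_cube
    · rw [extendIndex]; split
      · exact ha _
      · exact Nat.zero_le _
    · refine (continuous_pi fun i => ?_ : Continuous fun y : u → ℝ => glue u y 0).continuousOn
      by_cases h : i ∈ u
      · simpa [glue, h] using continuous_apply (⟨i, h⟩ : u)
      · simpa [glue, h] using continuous_const
  deriv a ha j hj h0 y hy := by
    have hidx : ∀ _ : DecidableEq u, extendIndex u (a + Pi.single j 1)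
        = extendIndex u a + Pi.single (j : ι) 1 := by
      intro _
      funext i
      by_cases h : i ∈ u
      · by_cases hi : i = j
        · subst hi; simp [extendIndex]
        · have : (⟨i, h⟩ : u) ≠ j := fun e => hi (congrArg Subtype.val e)
          simp [extendIndex, h, hi, this]
      · have : i ≠ j := fun e => h (e ▸ j.2)
        simp [extendIndex, h, this]
    have hup : ∀ (_ : DecidableEq u) (t : ℝ), glue u (Function.update y j t) 0
        = Function.update (glue u y 0) (j : ι) t := by
      intro _ t
      funext i
      by_cases h : i ∈ u
      · by_cases hi : i = j
        · subst hi; simp [glue]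
        · have : (⟨i, h⟩ : u) ≠ j := fun e => hi (congrArg Subtype.val e)
          simp [glue, h, hi, this]
      · have : i ≠ j := fun e => h (e ▸ j.2)
        simp [glue, h, this]
    have hyj : y j = glue u y 0 j := by simp [glue]
    rw [hidx, hyj]
    simp only [hup]
    refine hF.deriv _ (fun i => ?_) j (by simpa [extendIndex] using hj) (fun i hi => ?_) _
      (glue_mem_cube hy zero_mem_cube)
    · rw [extendIndex]; split
      · exact ha _
      · exact Nat.zero_le _
    · rw [extendIndex]; split
      · exact h0 _ hi
      · rfl

theorem anova_eq_cubeMeasure (f : (ι → ℝ) → ℝ) (u : Finset ι) (x : ι → ℝ) :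
    anova f u x
      = (∫ y, f (u.piecewise x y) ∂cubeMeasure ι) - ∑ v ∈ u.ssubsets, anova f v x := by
  rw [anova_eq, volume_restrict_cube]

theorem exists_mixedFamily_anova {α : ℕ} {f : (ι → ℝ) → ℝ} (hf : MixedSmooth α f)
    (u : Finset ι) : ∃ F, MixedFamily α (anova f u) F := by
  induction u using Finset.strongInduction with
  | H u ih =>
    choose! F hF using ih
    rw [funext (anova_eq_cubeMeasure f u)]
    exact ⟨_, (hf.mixedFamily.integral_piecewise u).sub
      (MixedFamily.sum u.ssubsets fun v hv => hF v (Finset.mem_ssubsets.1 hv))⟩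

theorem exists_mixedFamily_anovaOn {α : ℕ} {f : (ι → ℝ) → ℝ} (hf : MixedSmooth α f)
    (u : Finset ι) : ∃ F, MixedFamily α (anovaOn f u) F := by
  obtain ⟨F, hF⟩ := exists_mixedFamily_anova hf u
  exact ⟨_, hF.restrict u⟩

theorem anova_congr (f : (ι → ℝ) → ℝ) (u : Finset ι) {x x' : ι → ℝ} (h : ∀ i ∈ u, x i = x' i) :
    anova f u x = anova f u x' := by
  induction u using Finset.strongInduction with
  | H u ih =>
    rw [anova_eq, anova_eq]
    congr 1
    · congr 1
      funext y
      rw [Finset.piecewise_congr u h fun _ _ => rfl]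
    · exact Finset.sum_congr rfl fun v hv => ih v (Finset.mem_ssubsets.1 hv)
        fun i hi => h i ((Finset.mem_ssubsets.1 hv).1 hi)

theorem integral_anova_mul_walProd_eq_zero {f : (ι → ℝ) → ℝ} {v : Finset ι}
    (hc : ContinuousOn (anova f v) (cube ι)) {K : ι → Finset ℕ} {j : ι} (hj : j ∉ v)
    (hK : (K j).Nonempty) : ∫ x, anova f v x * walProd K x ∂cubeMeasure ι = 0 := by
  rw [integral_cube_update j (integrable_mul_walProd hc K)]
  refine integral_eq_zero_of_ae (ae_of_all _ fun x => ?_)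
  have h1 : ∀ t, anova f v (Function.update x j t) = anova f v x := fun t =>
    anova_congr f v fun i hi =>
      Function.update_of_ne (show i ≠ j from fun h => hj (h ▸ hi)) _ _
  have h2 : ∀ t, walProd K (Function.update x j t)
      = wal (K j) t * ∏ i ∈ Finset.univ.erase j, wal (K i) (x i) := by
    intro t
    rw [walProd, ← Finset.mul_prod_erase _ _ (Finset.mem_univ j), Function.update_self]
    congr 1
    refine Finset.prod_congr rfl fun i hi => ?_
    rw [Function.update_of_ne (Finset.ne_of_mem_erase hi)]
  simp only [h1, h2]
  rw [intervalIntegral.integral_const_mul, intervalIntegral.integral_mul_const, integral_wal hK]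
  simp

/-- The Walsh coefficient of `f` at a frequency with support `u` is that of its ANOVA component
`f_u`. -/
theorem integral_mul_walProd_eq_anovaOn {α : ℕ} {f : (ι → ℝ) → ℝ} (hf : MixedSmooth α f)
    (u : Finset ι) (K : ι → Finset ℕ) (hK : ∀ j, j ∈ u ↔ (K j).Nonempty) :
    ∫ x, f x * walProd K x ∂cubeMeasure ι
      = ∫ y, anovaOn f u y * walProd (fun j : u => K j) y ∂cubeMeasure u := by
  have hfc : ContinuousOn f (cube ι) := by
    have := (hf 0 fun j => Nat.zero_le _).1
    rwa [mixedDeriv_zero] at this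
  have hac : ∀ v, ContinuousOn (anova f v) (cube ι) := fun v => by
    obtain ⟨F, hF⟩ := exists_mixedFamily_anova hf v
    exact (hF.continuousOn 0 fun j => Nat.zero_le _).congr fun x hx => (hF.base x hx).symm
  have hK0 : ∀ j, j ∉ u → K j = ∅ := fun j hj =>
    Finset.not_nonempty_iff_eq_empty.1 fun h => hj ((hK j).2 h)
  have hwp : ∀ x : ι → ℝ, walProd K x = walProd (fun j : u => K j) fun j : u => x j := by
    intro x
    rw [walProd, walProd, Finset.prod_coe_sort u fun j => wal (K j) (x j)]
    exact (Finset.prod_subset (Finset.subset_univ u) fun j _ hj => by simp [hK0 j hj]).symm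
  have h1 : ∫ x, f x * walProd K x ∂cubeMeasure ι
      = ∫ x, (∫ y, f (u.piecewise x y) ∂cubeMeasure ι) * walProd K x ∂cubeMeasure ι := by
    have hp := measurePreserving_piecewise u
    have hint := integrable_mul_walProd hfc K
    have e1 := integral_map hp.measurable.aemeasurable (f := fun x => f x * walProd K x)
      (by rw [hp.map_eq]; exact hint.aestronglyMeasurable)
    rw [hp.map_eq] at e1
    have e2 : Integrable (fun p : (ι → ℝ) × (ι → ℝ) =>
        f (u.piecewise p.1 p.2) * walProd K (u.piecewise p.1 p.2))
        ((cubeMeasure ι).prod (cubeMeasure ι)) := hp.integrable_comp_of_integrable hint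
    rw [e1, integral_prod _ e2]
    refine integral_congr_ae (ae_of_all _ fun x => ?_)
    simp only
    rw [← integral_mul_const]
    refine integral_congr_ae (ae_of_all _ fun y => ?_)
    simp only
    rw [hwp, hwp]
    congr 2
    funext j
    simp
  have h2 : ∫ x, anova f u x * walProd K x ∂cubeMeasure ι
      = ∫ x, f x * walProd K x ∂cubeMeasure ι := by
    rw [h1]
    simp only [anova_eq_cubeMeasure f u, sub_mul, Finset.sum_mul]
    rw [integral_sub (integrable_mul_walProd (continuousOn_integral_piecewise hfc u) K)
      (integrable_finsetSum _ fun v _ => integrable_mul_walProd (hac v) K),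
      integral_finsetSum _ fun v _ => integrable_mul_walProd (hac v) K, sub_eq_self]
    refine Finset.sum_eq_zero fun v hv => ?_
    obtain ⟨j, hju, hjv⟩ := Finset.exists_of_ssubset (Finset.mem_ssubsets.1 hv)
    exact integral_anova_mul_walProd_eq_zero (hac v) hjv ((hK j).1 hju)
  rw [← h2]
  have hp := measurePreserving_restrict u
  have hoc : ContinuousOn (anovaOn f u) (cube u) := by
    obtain ⟨F, hF⟩ := exists_mixedFamily_anovaOn hf u
    exact (hF.continuousOn 0 fun j => Nat.zero_le _).congr fun x hx => (hF.base x hx).symm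
  have e1 := integral_map hp.measurable.aemeasurable
    (f := fun y => anovaOn f u y * walProd (fun j : u => K j) y)
    (by rw [hp.map_eq]; exact (integrable_mul_walProd hoc _).aestronglyMeasurable)
  rw [hp.map_eq] at e1
  rw [e1]
  refine integral_congr_ae (ae_of_all _ fun x => ?_)
  simp only
  rw [hwp, anovaOn]
  congr 1
  exact anova_congr f u fun i hi => by simp [hi]

end Anova

/-! ### Dyadic decomposition of the uniform law -/

section Decomposition

/-- The uniform law on `(0, h)` with total mass `h`, where `h = 2^(-(l+1))`. -/
noncomputable abbrev cellMeasure (l : ℕ) : Measure ℝ :=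
  volume.restrict (Set.Ioo (0 : ℝ) (1 / 2 ^ (l + 1)))

theorem restrict_Ico_add_restrict_Ico {a b c : ℝ} (hab : a ≤ b) (hbc : b ≤ c) :
    (volume : Measure ℝ).restrict (Set.Ico a c)
      = volume.restrict (Set.Ico a b) + volume.restrict (Set.Ico b c) := by
  rw [← Set.Ico_union_Ico_eq_Ico hab hbc, Measure.restrict_union _ measurableSet_Ico]
  exact Set.disjoint_left.2 fun x hx hx' => absurd hx.2 (not_lt.2 hx'.1)

/-- The uniform law on `[0,1]` is cut into the dyadic intervals of length `2^(-l)`, and each of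
these into its two halves. -/
theorem restrict_Icc_eq_sum (l : ℕ) :
    (volume : Measure ℝ).restrict (Set.Icc 0 1) = ∑ i ∈ Finset.range (2 ^ l),
      (volume.restrict (Set.Ico ((i : ℝ) / 2 ^ l) (i / 2 ^ l + 1 / 2 ^ (l + 1)))
        + volume.restrict (Set.Ico ((i : ℝ) / 2 ^ l + 1 / 2 ^ (l + 1))
            (i / 2 ^ l + 1 / 2 ^ (l + 1) + 1 / 2 ^ (l + 1)))) := by
  have key : ∀ N : ℕ, (volume : Measure ℝ).restrict (Set.Ico 0 ((N : ℝ) / 2 ^ l))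
      = ∑ i ∈ Finset.range N,
      (volume.restrict (Set.Ico ((i : ℝ) / 2 ^ l) (i / 2 ^ l + 1 / 2 ^ (l + 1)))
        + volume.restrict (Set.Ico ((i : ℝ) / 2 ^ l + 1 / 2 ^ (l + 1))
            (i / 2 ^ l + 1 / 2 ^ (l + 1) + 1 / 2 ^ (l + 1)))) := by
    intro N
    induction N with
    | zero => simp
    | succ N ih =>
      have hh : (0 : ℝ) ≤ 1 / 2 ^ (l + 1) := by positivity
      have e : ((N + 1 : ℕ) : ℝ) / 2 ^ l = N / 2 ^ l + 1 / 2 ^ (l + 1) + 1 / 2 ^ (l + 1) := by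
        push_cast; rw [pow_succ]; field_simp; ring
      rw [Finset.sum_range_succ, ← ih, e, ← restrict_Ico_add_restrict_Ico (by linarith)
        (by linarith), ← restrict_Ico_add_restrict_Ico (by positivity) (by linarith)]
  have := key (2 ^ l)
  rw [← this]
  push_cast
  rw [div_self (by positivity)]
  exact (Measure.restrict_congr_set Ico_ae_eq_Icc).symm

theorem measurePreserving_add_cell (c : ℝ) (l : ℕ) :
    MeasurePreserving (fun x => c + x) (cellMeasure l)
      (volume.restrict (Set.Ico c (c + 1 / 2 ^ (l + 1)))) := by
  have h := (measurePreserving_add_left (volume : Measure ℝ) c).restrict_preimage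
    (measurableSet_Ioo (a := c) (b := c + 1 / 2 ^ (l + 1)))
  rw [Measure.restrict_congr_set (Ioo_ae_eq_Ico (μ := volume) (a := c))] at h
  simpa [cellMeasure] using h

variable {ι : Type*} [Fintype ι] [DecidableEq ι]

theorem pi_sum_add {κ : Type*} (A : ι → Finset κ) (lam : ι → Measure ℝ)
    (a b : ι → κ → Measure ℝ) [∀ j, IsFiniteMeasure (lam j)] [∀ j k, IsFiniteMeasure (a j k)]
    [∀ j k, IsFiniteMeasure (b j k)] (h : ∀ j, lam j = ∑ k ∈ A j, (a j k + b j k)) :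
    Measure.pi lam = ∑ i ∈ Fintype.piFinset A, ∑ v : Finset ι,
      Measure.pi fun j => if j ∈ v then a j (i j) else b j (i j) := by
  have hfin : ∀ (v : Finset ι) (i : ι → κ) (j : ι),
      IsFiniteMeasure (if j ∈ v then a j (i j) else b j (i j)) := by
    intro v i j; split <;> infer_instance
  refine Measure.pi_eq fun s hs => ?_
  simp only [Measure.finsetSum_apply, Measure.pi_pi, h, Measure.add_apply]
  rw [Finset.prod_univ_sum]
  refine Finset.sum_congr rfl fun i _ => ?_
  rw [Fintype.prod_add]
  refine Finset.sum_congr rfl fun v _ => ?_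
  rw [← Finset.prod_mul_prod_compl v]
  congr 1
  · exact Finset.prod_congr rfl fun j hj => by rw [if_pos hj]
  · exact Finset.prod_congr rfl fun j hj => by rw [if_neg (Finset.mem_compl.1 hj)]

/-- The lower corner of the dyadic box with index `i` at the scales `l`. -/
noncomputable def dyadicCorner (l i : ι → ℕ) : ι → ℝ := fun j => (i j : ℝ) / 2 ^ l j

/-- The vector of half the side lengths of the dyadic boxes at the scales `l`. -/
noncomputable def halfSide (l : ι → ℕ) : ι → ℝ := fun j => 1 / 2 ^ (l j + 1)

/-- The index set of the dyadic boxes at the scales `l`. -/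
def dyadicIndex (l : ι → ℕ) : Finset (ι → ℕ) := Fintype.piFinset fun j => Finset.range (2 ^ l j)

/-- Fubini's theorem along the dyadic boxes, each divided into its `2^n` congruent subboxes. -/
theorem integral_cube_eq_sum (l : ι → ℕ) {Φ : (ι → ℝ) → ℝ} (hΦ : Integrable Φ (cubeMeasure ι)) :
    (∀ i ∈ dyadicIndex l, ∀ v : Finset ι, Integrable (fun x => Φ (v.piecewise
      (dyadicCorner l i + x) (dyadicCorner l i + halfSide l + x)))
        (Measure.pi fun j => cellMeasure (l j))) ∧
    ∫ x, Φ x ∂cubeMeasure ι = ∑ i ∈ dyadicIndex l, ∑ v : Finset ι,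
      ∫ x, Φ (v.piecewise (dyadicCorner l i + x) (dyadicCorner l i + halfSide l + x))
        ∂Measure.pi fun j => cellMeasure (l j) := by
  have hdec := pi_sum_add (fun j : ι => Finset.range (2 ^ l j))
    (fun _ => volume.restrict (Set.Icc (0 : ℝ) 1))
    (fun j i => volume.restrict (Set.Ico ((i : ℝ) / 2 ^ l j) (i / 2 ^ l j + 1 / 2 ^ (l j + 1))))
    (fun j i => volume.restrict (Set.Ico ((i : ℝ) / 2 ^ l j + 1 / 2 ^ (l j + 1))
            (i / 2 ^ l j + 1 / 2 ^ (l j + 1) + 1 / 2 ^ (l j + 1))))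
    (fun j => restrict_Icc_eq_sum (l j))
  have hmp : ∀ (i : ι → ℕ) (v : Finset ι), MeasurePreserving (fun x : ι → ℝ => v.piecewise
      (dyadicCorner l i + x) (dyadicCorner l i + halfSide l + x))
      (Measure.pi fun j => cellMeasure (l j))
      (Measure.pi fun j => if j ∈ v then
        volume.restrict (Set.Ico ((i j : ℝ) / 2 ^ l j) (i j / 2 ^ l j + 1 / 2 ^ (l j + 1)))
        else volume.restrict (Set.Ico ((i j : ℝ) / 2 ^ l j + 1 / 2 ^ (l j + 1))
            (i j / 2 ^ l j + 1 / 2 ^ (l j + 1) + 1 / 2 ^ (l j + 1)))) := by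
    intro i v
    have hfin : ∀ j : ι, IsFiniteMeasure (if j ∈ v then
        volume.restrict (Set.Ico ((i j : ℝ) / 2 ^ l j) (i j / 2 ^ l j + 1 / 2 ^ (l j + 1)))
        else (volume : Measure ℝ).restrict (Set.Ico ((i j : ℝ) / 2 ^ l j + 1 / 2 ^ (l j + 1))
            (i j / 2 ^ l j + 1 / 2 ^ (l j + 1) + 1 / 2 ^ (l j + 1)))) := by
      intro j; split <;> infer_instance
    have := measurePreserving_pi (fun j => cellMeasure (l j))
      (f := fun j x => v.piecewise (dyadicCorner l i) (dyadicCorner l i + halfSide l) j + x)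
      (ν := fun j => if j ∈ v then
        volume.restrict (Set.Ico ((i j : ℝ) / 2 ^ l j) (i j / 2 ^ l j + 1 / 2 ^ (l j + 1)))
        else volume.restrict (Set.Ico ((i j : ℝ) / 2 ^ l j + 1 / 2 ^ (l j + 1))
            (i j / 2 ^ l j + 1 / 2 ^ (l j + 1) + 1 / 2 ^ (l j + 1)))) (fun j => by
        by_cases hj : j ∈ v
        · simp only [hj, if_true, Finset.piecewise_eq_of_mem]
          exact measurePreserving_add_cell _ _
        · simp only [hj, if_false, not_false_eq_true, Finset.piecewise_eq_of_notMem]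
          exact measurePreserving_add_cell _ _)
    convert this using 1
    funext x j
    by_cases hj : j ∈ v <;> simp [hj]
  have hint : ∀ i ∈ dyadicIndex l, ∀ v : Finset ι, Integrable Φ (Measure.pi fun j => if j ∈ v then
        volume.restrict (Set.Ico ((i j : ℝ) / 2 ^ l j) (i j / 2 ^ l j + 1 / 2 ^ (l j + 1)))
        else volume.restrict (Set.Ico ((i j : ℝ) / 2 ^ l j + 1 / 2 ^ (l j + 1))
            (i j / 2 ^ l j + 1 / 2 ^ (l j + 1) + 1 / 2 ^ (l j + 1)))) := by
    intro i hi v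
    rw [cubeMeasure, hdec, integrable_finsetSum_measure] at hΦ
    have := hΦ i hi
    rw [integrable_finsetSum_measure] at this
    exact this v (Finset.mem_univ v)
  refine ⟨fun i hi v => (hmp i v).integrable_comp_of_integrable (hint i hi v), ?_⟩
  rw [cubeMeasure, hdec, integral_finsetSum_measure]
  · refine Finset.sum_congr rfl fun i hi => ?_
    rw [integral_finsetSum_measure fun v _ => hint i hi v]
    refine Finset.sum_congr rfl fun v _ => ?_
    have hm := hmp i v
    rw [← hm.map_eq]
    exact integral_map hm.measurable.aemeasurable
      (by rw [hm.map_eq]; exact (hint i hi v).aestronglyMeasurable)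
  · intro i hi
    exact integrable_finsetSum_measure.2 fun v _ => hint i hi v

end Decomposition

/-! ### Parseval's identity on the dyadic grid -/

section Parseval

theorem floor_eq_of_rad_eq {x y : ℝ} (hx : x ∈ Set.Ico (0 : ℝ) 1) (hy : y ∈ Set.Ico (0 : ℝ) 1)
    {N : ℕ} (h : ∀ l < N, rad l x = rad l y) : ⌊2 ^ N * x⌋ = ⌊2 ^ N * y⌋ := by
  classical
  have hδ : ∀ l, (if rad l x = 1 then 0 else 1 : ℕ) = 0 ∨ (if rad l x = 1 then 0 else 1 : ℕ) = 1 :=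
    fun l => by split <;> simp
  have hrad : ∀ l, rad l x = (-1) ^ (if rad l x = 1 then 0 else 1 : ℕ) := by
    intro l
    rcases rad_eq_or l x with h | h <;> rw [h] <;> norm_num
  have h1 := floor_eq_sum_digits hδ hx.1 hx.2 N fun l _ => hrad l
  have h2 := floor_eq_sum_digits hδ hy.1 hy.2 N fun l hl => by rw [← h l hl]; exact hrad l
  exact_mod_cast h1.trans h2.symm

variable {ι : Type*} [Fintype ι] [DecidableEq ι]

/-- The frequencies whose bits in coordinate `j` lie below `l j`. -/
def freqBelow (l : ι → ℕ) : Finset (ι → Finset ℕ) :=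
  Fintype.piFinset fun j => (Finset.range (l j)).powerset

theorem sum_walProd_mul_walProd (l : ι → ℕ) (x y : ι → ℝ) :
    ∑ R ∈ freqBelow l, walProd R x * walProd R y
      = ∏ j, ∏ i ∈ Finset.range (l j), (1 + rad i (x j) * rad i (y j)) := by
  simp only [Finset.prod_one_add]
  rw [Finset.prod_univ_sum]
  refine Finset.sum_congr rfl fun R _ => ?_
  simp only [walProd, wal, ← Finset.prod_mul_distrib]

theorem corner_mem {l i : ι → ℕ} (hi : i ∈ dyadicIndex l) (j : ι) :
    dyadicCorner l i j ∈ Set.Ico (0 : ℝ) 1 := by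
  have := Finset.mem_range.1 (Fintype.mem_piFinset.1 hi j)
  refine ⟨by rw [dyadicCorner]; positivity, ?_⟩
  rw [dyadicCorner, div_lt_one (by positivity)]
  exact_mod_cast this

theorem sum_walProd_corner (l : ι → ℕ) {i i' : ι → ℕ} (hi : i ∈ dyadicIndex l)
    (hi' : i' ∈ dyadicIndex l) :
    ∑ R ∈ freqBelow l, walProd R (dyadicCorner l i) * walProd R (dyadicCorner l i')
      = if i = i' then ∏ j, (2 : ℝ) ^ l j else 0 := by
  rw [sum_walProd_mul_walProd]
  split_ifs with h
  · subst h
    simp only [rad_mul_self]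
    norm_num
  · obtain ⟨j, hj⟩ := Function.ne_iff.1 h
    refine Finset.prod_eq_zero (Finset.mem_univ j) ?_
    by_contra hne
    refine hj ?_
    have hfl := floor_eq_of_rad_eq (corner_mem hi j) (corner_mem hi' j) (N := l j) fun q hq => by
      by_contra hq'
      refine hne (Finset.prod_eq_zero (Finset.mem_range.2 hq) ?_)
      rcases rad_eq_or q (dyadicCorner l i j) with h1 | h1 <;>
        rcases rad_eq_or q (dyadicCorner l i' j) with h2 | h2 <;>
        first
        | exact absurd (h1.trans h2.symm) hq'
        | (rw [h1, h2]; norm_num)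
    have e : ∀ n : ι → ℕ, ⌊2 ^ l j * dyadicCorner l n j⌋ = (n j : ℤ) := by
      intro n
      rw [dyadicCorner, mul_div_cancel₀ _ (by positivity)]
      exact Int.floor_natCast _
    rw [e, e] at hfl
    exact_mod_cast hfl

theorem sum_sq_sum_walProd (l : ι → ℕ) (b : (ι → ℕ) → ℝ) :
    ∑ R ∈ freqBelow l, (∑ i ∈ dyadicIndex l, walProd R (dyadicCorner l i) * b i) ^ 2
      = (∏ j, (2 : ℝ) ^ l j) * ∑ i ∈ dyadicIndex l, b i ^ 2 := by
  have h1 : ∀ R, (∑ i ∈ dyadicIndex l, walProd R (dyadicCorner l i) * b i) ^ 2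
      = ∑ i ∈ dyadicIndex l, ∑ i' ∈ dyadicIndex l,
        walProd R (dyadicCorner l i) * walProd R (dyadicCorner l i') * (b i * b i') := by
    intro R
    rw [sq, Finset.sum_mul_sum]
    exact Finset.sum_congr rfl fun i _ => Finset.sum_congr rfl fun i' _ => by ring
  simp only [h1]
  rw [Finset.sum_comm, Finset.mul_sum]
  refine Finset.sum_congr rfl fun i hi => ?_
  rw [Finset.sum_comm]
  simp only [← Finset.sum_mul]
  rw [Finset.sum_congr rfl fun i' hi' => by rw [sum_walProd_corner l hi hi']]
  simp [hi, sq]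

end Parseval

/-! ### Shifted dyadic grids and the fractional Vitali variation -/

section Grid

variable {ι : Type*} [Fintype ι] [LinearOrder ι]

/-- A box partition formed by the products of the intervals between consecutive grid points. -/
noncomputable def gridPartition (N : ι → ℕ) (t : ι → ℕ → ℝ) :
    Finset ((ι → ℝ) × (ι → ℝ)) := by
  classical
  exact (Fintype.piFinset fun j => Finset.range (N j)).image fun n =>
    (fun j => t j (n j), fun j => t j (n j + 1))

theorem mem_gridPartition {N : ι → ℕ} {t : ι → ℕ → ℝ} {J : (ι → ℝ) × (ι → ℝ)} :
    J ∈ gridPartition N t ↔ ∃ n : ι → ℕ, (∀ j, n j < N j) ∧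
      (fun j => t j (n j), fun j => t j (n j + 1)) = J := by
  classical
  simp [gridPartition, Fintype.mem_piFinset]

theorem isBoxPartition_gridPartition {N : ι → ℕ} {t : ι → ℕ → ℝ} (hmono : ∀ j, Monotone (t j))
    (hlt : ∀ j, ∀ n < N j, t j n < t j (n + 1)) (h0 : ∀ j, t j 0 = 0) (h1 : ∀ j, t j (N j) = 1) :
    IsBoxPartition (gridPartition N t) where
  nondegenerate J hJ j := by
    obtain ⟨n, hn, rfl⟩ := mem_gridPartition.1 hJ
    exact hlt j _ (hn j)
  disjoint J hJ J' hJ' hne := by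
    obtain ⟨n, hn, rfl⟩ := mem_gridPartition.1 hJ
    obtain ⟨n', hn', rfl⟩ := mem_gridPartition.1 hJ'
    obtain ⟨j, hj⟩ : ∃ j, n j ≠ n' j := by
      by_contra! h
      exact hne (by simp [h])
    refine Set.disjoint_left.2 fun x hx hx' => ?_
    have hd := (hmono j).pairwise_disjoint_on_Ico_succ hj
    exact Set.disjoint_left.1 hd (hx j trivial) (hx' j trivial)
  cover := by
    ext x
    simp only [Set.mem_iUnion, exists_prop, Set.mem_univ_pi, box]
    constructor
    · rintro ⟨J, hJ, hx⟩ j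
      obtain ⟨n, hn, rfl⟩ := mem_gridPartition.1 hJ
      refine ⟨?_, ?_⟩
      · rw [← h0 j]
        exact (hmono j (Nat.zero_le _)).trans (hx j).1
      · rw [← h1 j]
        exact (hx j).2.trans_le (hmono j (hn j))
    · intro hx
      have hex : ∀ j, ∃ n < N j, x j ∈ Set.Ico (t j n) (t j (n + 1)) := by
        intro j
        have key : ∀ M, x j < t j M → ∃ n < M, x j ∈ Set.Ico (t j n) (t j (n + 1)) := by
          intro M
          induction M with
          | zero => intro h; rw [h0] at h; exact absurd (hx j).1 (not_le.2 h)
          | succ M ih =>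
            intro h
            rcases lt_or_ge (x j) (t j M) with h' | h'
            · obtain ⟨n, hn, hxn⟩ := ih h'
              exact ⟨n, by omega, hxn⟩
            · exact ⟨M, by omega, h', h⟩
        exact key (N j) (by rw [h1]; exact (hx j).2)
      choose n hn hxn using hex
      exact ⟨_, mem_gridPartition.2 ⟨n, hn, rfl⟩, hxn⟩

theorem vitali_sq {lam : ℝ} {g : (ι → ℝ) → ℝ} : vitali lam g ^ 2 =
    ⨆ (Q : Finset ((ι → ℝ) × (ι → ℝ))) (_ : IsBoxPartition Q),
      ∑ J ∈ Q, ENNReal.ofReal (boxVol J * |altSum g J / boxVol J ^ lam| ^ 2) := by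
  rw [vitali, ← ENNReal.rpow_natCast, ← ENNReal.rpow_mul]
  norm_num

theorem sum_le_vitali_sq {lam : ℝ} {g : (ι → ℝ) → ℝ} (hV : vitali lam g ≠ ⊤)
    {Q : Finset ((ι → ℝ) × (ι → ℝ))} (hQ : IsBoxPartition Q) :
    ∑ J ∈ Q, boxVol J * |altSum g J / boxVol J ^ lam| ^ 2 ≤ (vitali lam g).toReal ^ 2 := by
  have hnn : ∀ J ∈ Q, 0 ≤ boxVol J * |altSum g J / boxVol J ^ lam| ^ 2 := fun J hJ =>
    mul_nonneg (Finset.prod_nonneg fun j _ => sub_nonneg.2 (hQ.nondegenerate J hJ j).le)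
      (by positivity)
  have h1 : ENNReal.ofReal (∑ J ∈ Q, boxVol J * |altSum g J / boxVol J ^ lam| ^ 2)
      ≤ vitali lam g ^ 2 := by
    rw [vitali_sq, ENNReal.ofReal_sum_of_nonneg hnn]
    exact le_iSup₂_of_le Q hQ le_rfl
  rw [← ENNReal.toReal_pow]
  exact (ENNReal.ofReal_le_iff_le_toReal (by finiteness)).1 h1

/-- The boxes with lower corners in a shifted dyadic grid belong to a box partition, whence a bound
for the squares of the alternating sums over them. -/
theorem sum_sq_altSum_le {lam : ℝ} {g : (ι → ℝ) → ℝ} (hV : vitali lam g ≠ ⊤) (l : ι → ℕ)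
    {x : ι → ℝ} (hx : ∀ j, x j ∈ Set.Ioo (0 : ℝ) (1 / 2 ^ (l j + 1))) :
    ∑ i ∈ dyadicIndex l, altSum g (dyadicCorner l i + x, dyadicCorner l i + halfSide l + x) ^ 2
      ≤ ((∏ j, halfSide l j) ^ lam) ^ 2 / (∏ j, halfSide l j) * (vitali lam g).toReal ^ 2 := by
  classical
  -- the grid points are `0`, the points `x_j + n h`, and `1`
  set t : ι → ℕ → ℝ := fun j n => min 1 (max 0 (x j + ((n : ℝ) - 1) * (1 / 2 ^ (l j + 1)))) with ht
  set N : ι → ℕ := fun j => 2 ^ (l j + 1) + 1 with hN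
  have hh : ∀ j, (0 : ℝ) < 1 / 2 ^ (l j + 1) := fun j => by positivity
  have hmid : ∀ j (n : ℕ), 1 ≤ n → n ≤ 2 ^ (l j + 1) →
      t j n = x j + ((n : ℝ) - 1) * (1 / 2 ^ (l j + 1)) := by
    intro j n hn hn'
    have h1 : (1 : ℝ) ≤ n := by exact_mod_cast hn
    have h2 : (n : ℝ) ≤ 2 ^ (l j + 1) := by exact_mod_cast hn'
    have h3 : 0 ≤ x j + ((n : ℝ) - 1) * (1 / 2 ^ (l j + 1)) := by
      have := (hx j).1
      have := mul_nonneg (sub_nonneg.2 h1) (hh j).le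
      linarith
    have h4 : (n : ℝ) * (1 / 2 ^ (l j + 1)) ≤ 1 := by
      rw [mul_one_div, div_le_one (by positivity)]; exact h2
    have h5 := (hx j).2
    simp only [ht]
    rw [max_eq_right h3, min_eq_right (by linarith)]
  have ht0 : ∀ j, t j 0 = 0 := by
    intro j
    have := (hx j).2
    simp only [ht, Nat.cast_zero]
    rw [max_eq_left (by linarith), min_eq_right zero_le_one]
  have htN : ∀ j, t j (N j) = 1 := by
    intro j
    have := (hx j).1
    simp only [ht, hN]
    push_cast
    rw [add_sub_cancel_right, mul_one_div_cancel (by positivity), max_eq_right (by linarith),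
      min_eq_left (by linarith)]
  have hmono : ∀ j, Monotone (t j) := by
    intro j a b hab
    have h1 : (a : ℝ) ≤ b := by exact_mod_cast hab
    have h2 := (hh j).le
    simp only [ht]
    gcongr
  have hlt : ∀ j, ∀ n < N j, t j n < t j (n + 1) := by
    intro j n hn
    have hn : n ≤ 2 ^ (l j + 1) := Nat.lt_succ_iff.1 hn
    rcases Nat.eq_zero_or_pos n with rfl | hpos
    · rw [ht0, hmid j 1 le_rfl Nat.one_le_two_pow]
      simpa using (hx j).1
    · rw [hmid j n hpos hn]
      rcases Nat.lt_or_ge n (2 ^ (l j + 1)) with h | h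
      · rw [hmid j (n + 1) (by omega) h]
        push_cast
        have := hh j
        linarith
      · have : n = 2 ^ (l j + 1) := le_antisymm hn h
        subst this
        rw [show (2 ^ (l j + 1) + 1) = N j from rfl, htN]
        push_cast
        rw [sub_mul, mul_one_div_cancel (by positivity)]
        linarith [(hx j).2]
  have hQ := isBoxPartition_gridPartition hmono hlt ht0 htN
  have hJ : ∀ i ∈ dyadicIndex l,
      (dyadicCorner l i + x, dyadicCorner l i + halfSide l + x) ∈ gridPartition N t := by
    intro i hi
    have hi' : ∀ j, 2 * i j + 2 ≤ 2 ^ (l j + 1) := fun j => by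
      have := Finset.mem_range.1 (Fintype.mem_piFinset.1 hi j)
      rw [pow_succ]; omega
    refine mem_gridPartition.2 ⟨fun j => 2 * i j + 1, fun j => ?_, Prod.ext ?_ ?_⟩
    · have := hi' j
      simp only [hN]; omega
    · funext j
      have := hi' j
      simp only
      rw [hmid j _ (by omega) (by omega)]
      simp only [Pi.add_apply, dyadicCorner]
      push_cast
      rw [pow_succ]; field_simp; ring
    · funext j
      have := hi' j
      simp only
      rw [hmid j _ (by omega) (by omega)]
      simp only [Pi.add_apply, dyadicCorner, halfSide]
      push_cast
      rw [pow_succ]; field_simp; ring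
  have hvol : ∀ i : ι → ℕ, boxVol (dyadicCorner l i + x, dyadicCorner l i + halfSide l + x)
      = ∏ j, halfSide l j := by
    intro i
    refine Finset.prod_congr rfl fun j _ => ?_
    simp only [Pi.add_apply]; ring
  set H := ∏ j, halfSide l j with hH
  have hHpos : 0 < H := Finset.prod_pos fun j _ => hh j
  have hinj : Set.InjOn (fun i : ι → ℕ =>
      ((dyadicCorner l i + x, dyadicCorner l i + halfSide l + x) : (ι → ℝ) × (ι → ℝ)))
      (dyadicIndex l) := by
    intro i _ i' _ h
    funext j
    have h1 := congrFun (congrArg Prod.fst h) j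
    simp only [Pi.add_apply, dyadicCorner, add_left_inj] at h1
    have := (div_left_inj' (by positivity)).1 h1
    exact_mod_cast this
  have hsum : ∑ i ∈ dyadicIndex l, H * (altSum g
      (dyadicCorner l i + x, dyadicCorner l i + halfSide l + x) ^ 2 / (H ^ lam) ^ 2)
      ≤ (vitali lam g).toReal ^ 2 := by
    refine le_trans (le_of_eq ?_) ((Finset.sum_le_sum_of_subset_of_nonneg
      (s := (dyadicIndex l).image fun i =>
        (dyadicCorner l i + x, dyadicCorner l i + halfSide l + x))
      (Finset.image_subset_iff.2 hJ) fun J hJ _ => ?_).trans (sum_le_vitali_sq hV hQ))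
    · rw [Finset.sum_image hinj]
      refine Finset.sum_congr rfl fun i _ => ?_
      rw [hvol, sq_abs, div_pow]
    · exact mul_nonneg (Finset.prod_nonneg fun j _ => sub_nonneg.2 (hQ.nondegenerate J hJ j).le)
        (by positivity)
  rw [← Finset.mul_sum, ← Finset.sum_div] at hsum
  have hp : 0 < (H ^ lam) ^ 2 := by positivity
  rw [div_mul_eq_mul_div, le_div_iff₀ hHpos]
  rw [mul_div_assoc', div_le_iff₀ hp] at hsum
  linarith

end Grid

/-! ### Weighted Bessel inequality for Walsh coefficients -/

theorem sq_integral_mul_le {Ω : Type*} [MeasurableSpace Ω] {μ : Measure Ω} {φ w : Ω → ℝ}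
    (hw : ∀ x, 0 ≤ w x) (hw1 : Integrable w μ) (h1 : Integrable (fun x => φ x * w x) μ)
    (h2 : Integrable (fun x => φ x ^ 2 * w x) μ) (hpos : 0 < ∫ x, w x ∂μ) :
    (∫ x, φ x * w x ∂μ) ^ 2 ≤ (∫ x, w x ∂μ) * ∫ x, φ x ^ 2 * w x ∂μ := by
  set I0 := ∫ x, w x ∂μ
  set I1 := ∫ x, φ x * w x ∂μ
  set I2 := ∫ x, φ x ^ 2 * w x ∂μ
  -- expand `∫ (I0 φ - I1)² w ≥ 0`
  have h : 0 ≤ ∫ x, (I0 ^ 2 * (φ x ^ 2 * w x) - 2 * I0 * I1 * (φ x * w x) + I1 ^ 2 * w x) ∂μ := by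
    refine integral_nonneg fun x => ?_
    have : 0 ≤ (I0 * φ x - I1) ^ 2 * w x := mul_nonneg (sq_nonneg _) (hw x)
    simp only [Pi.zero_apply]
    nlinarith
  have hA : Integrable (fun x => I0 ^ 2 * (φ x ^ 2 * w x) - 2 * I0 * I1 * (φ x * w x)) μ :=
    (h2.const_mul _).sub (h1.const_mul _)
  rw [integral_add hA (hw1.const_mul _), integral_sub (h2.const_mul _) (h1.const_mul _),
    integral_const_mul, integral_const_mul, integral_const_mul] at h
  have h' : 0 ≤ I0 * (I0 * I2 - I1 ^ 2) := by
    have : I0 * (I0 * I2 - I1 ^ 2) = I0 ^ 2 * I2 - 2 * I0 * I1 * I1 + I1 ^ 2 * I0 := by ring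
    rw [this]; exact h
  have := nonneg_of_mul_nonneg_right h' hpos
  linarith

section Bessel

variable {ι : Type*} [Fintype ι] [LinearOrder ι]

theorem pi_cellMeasure {ι : Type*} [Fintype ι] (l : ι → ℕ) : (Measure.pi fun j => cellMeasure (l j))
    = volume.restrict (Set.univ.pi fun j => Set.Ioo (0 : ℝ) (1 / 2 ^ (l j + 1))) := by
  rw [volume_pi, Measure.restrict_pi_pi]

theorem measurableSet_cell (l : ι → ℕ) :
    MeasurableSet (Set.univ.pi fun j => Set.Ioo (0 : ℝ) (1 / 2 ^ (l j + 1))) :=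
  MeasurableSet.univ_pi fun _ => measurableSet_Ioo

theorem subbox_mem_cube {l i : ι → ℕ} (hi : i ∈ dyadicIndex l) (v : Finset ι) {x : ι → ℝ}
    (hx : x ∈ Set.univ.pi fun j => Set.Ioo (0 : ℝ) (1 / 2 ^ (l j + 1))) :
    v.piecewise (dyadicCorner l i + x) (dyadicCorner l i + halfSide l + x) ∈ cube ι := by
  rw [mem_cube]
  intro j
  have h1 := hx j trivial
  have h2 := (corner_mem hi j).1
  have h3 : dyadicCorner l i j + 1 / 2 ^ (l j + 1) + 1 / 2 ^ (l j + 1) ≤ 1 := by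
    have : (i j : ℝ) + 1 ≤ 2 ^ l j := by
      exact_mod_cast Finset.mem_range.1 (Fintype.mem_piFinset.1 hi j)
    have e : dyadicCorner l i j + 1 / 2 ^ (l j + 1) + 1 / 2 ^ (l j + 1)
        = ((i j : ℝ) + 1) / 2 ^ l j := by
      rw [dyadicCorner, pow_succ]; field_simp; ring
    rw [e, div_le_one (by positivity)]
    exact this
  have h4 : (0 : ℝ) < 1 / 2 ^ (l j + 1) := by positivity
  by_cases hj : j ∈ v
  · simp only [hj, Finset.piecewise_eq_of_mem, Pi.add_apply]
    exact ⟨by linarith [h1.1], by linarith [h1.2]⟩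
  · simp only [hj, not_false_eq_true, Finset.piecewise_eq_of_notMem, Pi.add_apply, halfSide]
    exact ⟨by linarith [h1.1], by linarith [h1.2]⟩

theorem prod_wal_insert_subbox {l : ι → ℕ} (i : ι → ℕ) (v : Finset ι)
    {x : ι → ℝ} (hx : x ∈ Set.univ.pi fun j => Set.Ioo (0 : ℝ) (1 / 2 ^ (l j + 1)))
    {L : ι → List ℕ} (hL : ∀ j, (L j).Pairwise (· < ·)) (hlL : ∀ j, ∀ q ∈ L j, l j < q)
    {R : ι → Finset ℕ} (hR : R ∈ freqBelow l) :
    ∏ j, (wal (insert (l j) (R j)) (v.piecewise (dyadicCorner l i + x)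
        (dyadicCorner l i + halfSide l + x) j) * iterPrim (L j) (v.piecewise
        (dyadicCorner l i + x) (dyadicCorner l i + halfSide l + x) j))
      = (-1) ^ (Fintype.card ι - v.card) * (walProd R (dyadicCorner l i)
        * ∏ j, iterPrim (L j) (x j)) := by
  have hsign : ((-1 : ℝ)) ^ (Fintype.card ι - v.card) = ∏ j, if j ∈ v then 1 else -1 := by
    rw [← Finset.prod_mul_prod_compl v, Finset.prod_congr rfl (fun j hj => if_pos hj),
      Finset.prod_congr (s₁ := vᶜ) rfl (fun j hj => if_neg (Finset.mem_compl.1 hj)),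
      Finset.prod_const_one, one_mul, Finset.prod_const, Finset.card_compl]
  rw [hsign, walProd, ← Finset.prod_mul_distrib, ← Finset.prod_mul_distrib]
  refine Finset.prod_congr rfl fun j _ => ?_
  have hRj : ∀ q ∈ R j, q < l j := fun q hq =>
    Finset.mem_range.1 (Finset.mem_powerset.1 (Fintype.mem_piFinset.1 hR j) hq)
  have hlR : l j ∉ R j := fun h => (hRj _ h).false
  have hxj := hx j trivial
  have hc : dyadicCorner l i j = (i j : ℝ) * (1 / 2 ^ l j) := by rw [dyadicCorner]; ring
  have hW := iterPrim_periodic (hL j) (n := l j + 1) fun q hq => hlL j q hq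
  have hfl : ∀ y : ℝ, 0 ≤ y → y < 1 / 2 ^ l j →
      wal (R j) (dyadicCorner l i j + y) = wal (R j) (dyadicCorner l i j) := by
    intro y hy0 hy1
    refine wal_eq_of_floor_eq hRj ?_
    have e1 : (2 : ℝ) ^ l j * dyadicCorner l i j = (i j : ℤ) := by
      rw [hc]; push_cast; field_simp
    rw [mul_add, e1, Int.floor_intCast, Int.floor_eq_iff]
    rw [lt_div_iff₀ (by positivity)] at hy1
    exact ⟨by have : 0 ≤ 2 ^ l j * y := by positivity
              linarith, by linarith⟩
  have hh : (0 : ℝ) < 1 / 2 ^ (l j + 1) := by positivity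
  have h2 : (1 : ℝ) / 2 ^ l j = 1 / 2 ^ (l j + 1) + 1 / 2 ^ (l j + 1) := by
    rw [pow_succ]; field_simp; ring
  have hr : ∀ y, rad (l j) (dyadicCorner l i j + y) = rad (l j) y := by
    intro y
    rw [add_comm, hc]
    exact (rad_periodic le_rfl).nat_mul _ y
  have hp : ∀ y, iterPrim (L j) (dyadicCorner l i j + y) = iterPrim (L j) y := by
    intro y
    have e : dyadicCorner l i j = ((2 * i j : ℕ) : ℝ) * (1 / 2 ^ (l j + 1)) := by
      rw [hc, h2]; push_cast; ring
    rw [add_comm, e]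
    exact hW.nat_mul _ y
  by_cases hj : j ∈ v
  · simp only [hj, Finset.piecewise_eq_of_mem, Pi.add_apply, if_true, one_mul]
    rw [wal_mul_rad hlR, hfl _ hxj.1.le (by linarith [hxj.2]), hr,
      rad_eq_one hxj.1.le hxj.2, hp, mul_one]
  · simp only [hj, not_false_eq_true, Finset.piecewise_eq_of_notMem, Pi.add_apply, if_false,
      halfSide]
    rw [wal_mul_rad hlR, add_assoc, hfl _ (by linarith [hxj.1]) (by linarith [hxj.2]), hr, hp,
      add_comm (1 / 2 ^ (l j + 1)) (x j), rad_antiperiodic, rad_eq_one hxj.1.le hxj.2, hW]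
    ring

/-- The sum of the squares of the integrals of `G` against products of a Walsh function with
prescribed largest bits `l j` and iterated primitives of finer bits is bounded by the fractional
Vitali variation of `G`: Parseval's identity turns the sum into one over dyadic boxes, on which
the largest bit acts as a difference operator. -/
theorem sum_sq_integral_le_vitali {lam : ℝ} {G : (ι → ℝ) → ℝ} (hG : ContinuousOn G (cube ι))
    (hV : vitali lam G ≠ ⊤) (l : ι → ℕ) {L : ι → List ℕ} (hL : ∀ j, (L j).Pairwise (· < ·))
    (hlL : ∀ j, ∀ q ∈ L j, l j < q) :
    ∑ R ∈ freqBelow l, (∫ x, G x * ∏ j, (wal (insert (l j) (R j)) (x j) * iterPrim (L j) (x j))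
        ∂cubeMeasure ι) ^ 2
      ≤ (∏ j, primMean (L j) ^ 2) * ((∏ j, halfSide l j) ^ lam) ^ 2
        * (vitali lam G).toReal ^ 2 := by
  set B := Measure.pi fun j => cellMeasure (l j) with hB
  set E : Set (ι → ℝ) := Set.univ.pi fun j => Set.Ioo (0 : ℝ) (1 / 2 ^ (l j + 1)) with hE
  have hBE : B = volume.restrict E := pi_cellMeasure l
  have hEm : MeasurableSet E := measurableSet_cell l
  have haeE : ∀ᵐ x ∂B, x ∈ E := by rw [hBE]; exact ae_restrict_mem hEm
  set w : (ι → ℝ) → ℝ := fun x => ∏ j, iterPrim (L j) (x j) with hw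
  set D : (ι → ℕ) → (ι → ℝ) → ℝ := fun i x =>
    altSum G (dyadicCorner l i + x, dyadicCorner l i + halfSide l + x) with hD
  have hwc : Continuous w := continuous_finsetProd _ fun j _ =>
    (continuous_iterPrim (L j)).comp (continuous_apply j)
  have hw0 : ∀ x, 0 ≤ w x := fun x => Finset.prod_nonneg fun j _ => iterPrim_nonneg (hL j) _
  have hw1 : ∀ x, |w x| ≤ 1 := fun x => by
    rw [hw, Finset.abs_prod]
    exact Finset.prod_le_one (fun _ _ => abs_nonneg _) fun j _ => abs_iterPrim_le_one (hL j) _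
  obtain ⟨M, hM0, hM⟩ := exists_abs_le_of_continuousOn hG
  have hterm : ∀ i ∈ dyadicIndex l, ∀ v : Finset ι, ContinuousOn (fun x => G (v.piecewise
      (dyadicCorner l i + x) (dyadicCorner l i + halfSide l + x))) E := by
    intro i hi v
    refine hG.comp (Continuous.continuousOn ?_) fun x hx => subbox_mem_cube hi v hx
    refine continuous_pi fun j => ?_
    by_cases hj : j ∈ v
    · simp only [hj, Finset.piecewise_eq_of_mem, Pi.add_apply]; fun_prop
    · simp only [hj, not_false_eq_true, Finset.piecewise_eq_of_notMem, Pi.add_apply]; fun_prop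
  have hDc : ∀ i ∈ dyadicIndex l, ContinuousOn (D i) E := fun i hi =>
    continuousOn_finsetSum _ fun v _ => (hterm i hi v).const_smul ((-1 : ℝ) ^ _)
  have hDb : ∀ i ∈ dyadicIndex l, ∀ x ∈ E, |D i x| ≤ Fintype.card (Finset ι) * M := by
    intro i hi x hx
    refine (Finset.abs_sum_le_sum_abs _ _).trans ((Finset.sum_le_card_nsmul _ _ M
      fun v _ => ?_).trans_eq (by simp))
    rw [abs_mul, abs_pow, abs_neg, abs_one, one_pow, one_mul]
    exact hM _ (subbox_mem_cube hi v hx)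
  have hint : ∀ φ : (ι → ℝ) → ℝ, ContinuousOn φ E → (∃ b, ∀ x ∈ E, |φ x| ≤ b) →
      Integrable φ B := by
    rintro φ hφ ⟨b, hb⟩
    refine Integrable.of_bound (C := b) ?_ ?_
    · rw [hBE]; exact hφ.aestronglyMeasurable hEm
    · filter_upwards [haeE] with x hx using hb x hx
  have hDw : ∀ i ∈ dyadicIndex l, Integrable (fun x => D i x * w x) B := fun i hi =>
    hint _ ((hDc i hi).mul hwc.continuousOn) ⟨Fintype.card (Finset ι) * M, fun x hx => by
      rw [abs_mul]
      exact (mul_le_of_le_one_right (abs_nonneg _) (hw1 x)).trans (hDb i hi x hx)⟩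
  have hD2w : ∀ i ∈ dyadicIndex l, Integrable (fun x => D i x ^ 2 * w x) B := fun i hi =>
    hint _ (((hDc i hi).pow 2).mul hwc.continuousOn) ⟨(Fintype.card (Finset ι) * M) ^ 2,
      fun x hx => by
        rw [abs_mul, abs_pow]
        exact (mul_le_of_le_one_right (by positivity) (hw1 x)).trans
          (pow_le_pow_left₀ (abs_nonneg _) (hDb i hi x hx) 2)⟩
  have hwint : Integrable w B := hint _ hwc.continuousOn ⟨1, fun x _ => hw1 x⟩
  -- on each dyadic box the Walsh functions are constant up to the signs of the difference operator
  set b : (ι → ℕ) → ℝ := fun i => ∫ x, D i x * w x ∂B with hb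
  have hcoef : ∀ R ∈ freqBelow l, ∫ x, G x * ∏ j, (wal (insert (l j) (R j)) (x j)
      * iterPrim (L j) (x j)) ∂cubeMeasure ι
      = ∑ i ∈ dyadicIndex l, walProd R (dyadicCorner l i) * b i := by
    intro R hR
    have hΦ : Integrable (fun x => G x * ∏ j, (wal (insert (l j) (R j)) (x j)
      * iterPrim (L j) (x j))) (cubeMeasure ι) := by
      refine integrable_mul_of_abs_le_one hG ?_ fun x => ?_
      · exact Finset.measurable_fun_prod _ fun j _ =>
          ((measurable_wal _).comp (measurable_pi_apply j)).mul
            ((continuous_iterPrim _).measurable.comp (measurable_pi_apply j))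
      · rw [Finset.abs_prod]
        refine Finset.prod_le_one (fun _ _ => abs_nonneg _) fun j _ => ?_
        rw [abs_mul, abs_wal, one_mul]
        exact abs_iterPrim_le_one (hL j) _
    obtain ⟨hi1, hi2⟩ := integral_cube_eq_sum l hΦ
    rw [hi2]
    refine Finset.sum_congr rfl fun i hi => ?_
    rw [← integral_finsetSum _ fun v _ => hi1 i hi v, hb, ← integral_const_mul]
    refine integral_congr_ae ?_
    filter_upwards [haeE] with x hx
    simp only [hD, altSum]
    rw [Finset.sum_mul, Finset.mul_sum]
    refine Finset.sum_congr rfl fun v _ => ?_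
    rw [prod_wal_insert_subbox i v hx hL hlL hR]
    ring
  rw [Finset.sum_congr rfl fun R hR => by rw [hcoef R hR], sum_sq_sum_walProd]
  have hI0 : ∫ x, w x ∂B = ∏ j, (halfSide l j * primMean (L j)) := by
    rw [hB, hw, integral_fintype_prod_eq_prod]
    refine Finset.prod_congr rfl fun j _ => ?_
    rw [halfSide, ← integral_iterPrim (hL j) (n := l j + 1) fun q hq => hlL j q hq,
      intervalIntegral.integral_of_le (by positivity), integral_Ioc_eq_integral_Ioo]
  have hI0pos : 0 < ∫ x, w x ∂B := by
    rw [hI0]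
    refine Finset.prod_pos fun j _ => mul_pos ?_ (primMean_pos _)
    rw [halfSide]; positivity
  set H := ∏ j, halfSide l j with hH
  have hHpos : 0 < H := Finset.prod_pos fun j _ => by rw [halfSide]; positivity
  set V := (vitali lam G).toReal with hVr
  -- Cauchy-Schwarz with the weight `w`, and then the variation bound for every fixed shift `x`
  have hb2 : ∑ i ∈ dyadicIndex l, b i ^ 2
      ≤ (∫ x, w x ∂B) * ((H ^ lam) ^ 2 / H * V ^ 2 * ∫ x, w x ∂B) := by
    calc ∑ i ∈ dyadicIndex l, b i ^ 2
        ≤ ∑ i ∈ dyadicIndex l, (∫ x, w x ∂B) * ∫ x, D i x ^ 2 * w x ∂B :=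
          Finset.sum_le_sum fun i hi => sq_integral_mul_le hw0 hwint (hDw i hi) (hD2w i hi) hI0pos
      _ = (∫ x, w x ∂B) * ∫ x, (∑ i ∈ dyadicIndex l, D i x ^ 2) * w x ∂B := by
          rw [← Finset.mul_sum, ← integral_finsetSum _ hD2w]
          simp only [Finset.sum_mul]
      _ ≤ (∫ x, w x ∂B) * ∫ x, ((H ^ lam) ^ 2 / H * V ^ 2) * w x ∂B := by
          refine mul_le_mul_of_nonneg_left ?_ hI0pos.le
          refine integral_mono_ae ?_ (hwint.const_mul _) ?_
          · simp only [Finset.sum_mul]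
            exact integrable_finsetSum _ hD2w
          · filter_upwards [haeE] with x hx
            exact mul_le_mul_of_nonneg_right
              (sum_sq_altSum_le hV l fun j => hx j trivial) (hw0 x)
      _ = _ := by rw [integral_const_mul]
  have h2l : (∏ j, (2 : ℝ) ^ l j) * H ≤ 1 := by
    rw [hH, ← Finset.prod_mul_distrib]
    refine Finset.prod_le_one (fun j _ => by rw [halfSide]; positivity) fun j _ => ?_
    rw [halfSide, pow_succ, mul_one_div, div_le_one (by positivity)]
    have : (0 : ℝ) < 2 ^ l j := by positivity
    linarith
  have hP : ∫ x, w x ∂B = H * ∏ j, primMean (L j) := by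
    rw [hI0, Finset.prod_mul_distrib]
  rw [Finset.prod_pow]
  set P := ∏ j, primMean (L j) with hPd
  calc (∏ j, (2 : ℝ) ^ l j) * ∑ i ∈ dyadicIndex l, b i ^ 2
      ≤ (∏ j, (2 : ℝ) ^ l j) * ((∫ x, w x ∂B) * ((H ^ lam) ^ 2 / H * V ^ 2 * ∫ x, w x ∂B)) :=
        mul_le_mul_of_nonneg_left hb2 (by positivity)
    _ = ((∏ j, (2 : ℝ) ^ l j) * H) * (P ^ 2 * (H ^ lam) ^ 2 * V ^ 2) := by
        rw [hP]; field_simp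
    _ ≤ 1 * (P ^ 2 * (H ^ lam) ^ 2 * V ^ 2) :=
        mul_le_mul_of_nonneg_right h2l (by positivity)
    _ = _ := one_mul _

end Bessel

/-! ### Walsh coefficients with prescribed leading bits -/

section Leading

/-- The smallest element of a nonempty set of bit positions. -/
noncomputable def lowBit (T : Finset ℕ) : ℕ := sInf (T : Set ℕ)

theorem lowBit_mem {T : Finset ℕ} (h : T.Nonempty) : lowBit T ∈ T := by
  have := Nat.sInf_mem (s := (T : Set ℕ)) h
  exact_mod_cast this

theorem lowBit_le {T : Finset ℕ} {l : ℕ} (h : l ∈ T) : lowBit T ≤ l := Nat.sInf_le h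

/-- The number of free low bits below the leading bits `T`: if `T` has more than `α` elements, all
positions below `T` are free, and otherwise none is. -/
noncomputable def freeBits (α : ℕ) (T : Finset ℕ) : ℕ := if α < T.card then lowBit T else 0

/-- The increasing list of the leading bits that are integrated by parts. -/
noncomputable def partsList (α : ℕ) (T : Finset ℕ) : List ℕ :=
  if α < T.card then (T.erase (lowBit T)).sort (· ≤ ·) else T.sort (· ≤ ·)

/-- The factor that the leading bits `T` of one coordinate contribute to the bound for the sum of
the squared Walsh coefficients. -/
noncomputable def leadFactor (α : ℕ) (lam : ℝ) (T : Finset ℕ) : ℝ :=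
  if α < T.card then
    primMean (partsList α T) ^ 2 * (((1 : ℝ) / 2 ^ (lowBit T + 1)) ^ lam) ^ 2
  else (2 * primMean (partsList α T)) ^ 2

theorem pairwise_partsList (α : ℕ) (T : Finset ℕ) : (partsList α T).Pairwise (· < ·) := by
  rw [partsList]; split <;> exact (Finset.sortedLT_sort _).pairwise

theorem iterPrim_le' {L : List ℕ} (hL : L.Pairwise (· < ·)) (x : ℝ) :
    iterPrim L x ≤ 2 * primMean L := by
  cases L with
  | nil => simp
  | cons l L => exact iterPrim_le hL (by simp) x

variable {ι : Type*} [Fintype ι] [LinearOrder ι]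

theorem integral_glue (v : Finset ι) {Φ : (ι → ℝ) → ℝ} (hΦ : Integrable Φ (cubeMeasure ι)) :
    ∫ x, Φ x ∂cubeMeasure ι = ∫ y, (∫ x, Φ (glue v y x) ∂cubeMeasure ι) ∂cubeMeasure v := by
  have hp := measurePreserving_glue v
  have h1 := integral_map hp.measurable.aemeasurable (f := Φ)
    (by rw [hp.map_eq]; exact hΦ.aestronglyMeasurable)
  rw [hp.map_eq] at h1
  rw [h1]
  exact integral_prod _ (hp.integrable_comp_of_integrable hΦ)

theorem partialIntegral_eq (v : Finset ι) (g : (ι → ℝ) → ℝ) (y : v → ℝ) :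
    partialIntegral v g y = ∫ x, g (glue v y x) ∂cubeMeasure ι := by
  rw [partialIntegral, volume_restrict_cube]; rfl

theorem continuousOn_partialIntegral {g : (ι → ℝ) → ℝ} (hg : ContinuousOn g (cube ι))
    (v : Finset ι) : ContinuousOn (partialIntegral v g) (cube v) := by
  obtain ⟨B, -, hB⟩ := exists_abs_le_of_continuousOn hg
  rw [funext (partialIntegral_eq v g)]
  refine continuousOn_of_dominated (bound := fun _ => B) (fun y hy => ?_) (fun y hy => ?_)
    (integrable_const B) ?_
  · refine (integrable_of_continuousOn (hg.comp (Continuous.continuousOn ?_)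
      fun _ hx => glue_mem_cube hy hx)).aestronglyMeasurable
    refine continuous_pi fun i => ?_
    by_cases h : i ∈ v
    · simpa [glue, h] using continuous_const
    · simpa [glue, h] using continuous_apply i
  · filter_upwards [ae_mem_cube] with x hx
    exact hB _ (glue_mem_cube hy hx)
  · filter_upwards [ae_mem_cube] with x hx
    refine hg.comp (Continuous.continuousOn ?_) fun y hy => glue_mem_cube hy hx
    refine continuous_pi fun i => ?_
    by_cases h : i ∈ v
    · simpa [glue, h] using continuous_apply (⟨i, h⟩ : v)
    · simpa [glue, h] using continuous_const

/-- The squared Walsh coefficients of all frequencies with given leading bits `T`: coordinates in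
which `T` has more than `α` bits are integrated by parts `α` times and contribute to the fractional
variation, and all the other coordinates are integrated by parts completely and contribute
weights. -/
theorem sum_sq_walsh_leading_le {α : ℕ} {lam : ℝ} {g : (ι → ℝ) → ℝ}
    {F : (ι → ℕ) → (ι → ℝ) → ℝ} (hF : MixedFamily α g F) {V : ℝ≥0∞} (hV : V ≠ ⊤)
    (hgV : ∀ (v : Finset ι) (a : ι → ℕ), (∀ j, a j ≤ α) → (∀ j ∈ v, a j = α) →
      (∀ j ∉ v, 0 < a j) → partialVitali lam v (mixedDeriv a g) ≤ V)
    (T : ι → Finset ℕ) (hT : ∀ j, (T j).Nonempty) (hTc : ∀ j, (T j).card ≤ α + 1) :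
    ∑ R ∈ freqBelow fun j => freeBits α (T j),
        (∫ x, g x * walProd (fun j => T j ∪ R j) x ∂cubeMeasure ι) ^ 2
      ≤ (∏ j, leadFactor α lam (T j)) * V.toReal ^ 2 := by
  classical
  set v : Finset ι := Finset.univ.filter fun j => α < (T j).card with hv
  have hmemv : ∀ j, j ∈ v ↔ α < (T j).card := fun j => by simp [hv]
  set L : ι → List ℕ := fun j => partsList α (T j) with hLdef
  have hL : ∀ j, (L j).Pairwise (· < ·) := fun j => pairwise_partsList _ _
  set a : ι → ℕ := fun j => (L j).length with ha
  have hav : ∀ j ∈ v, a j = α := by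
    intro j hj
    have h1 := (hmemv j).1 hj
    have h2 := hTc j
    simp only [ha, hLdef, partsList, if_pos h1, Finset.length_sort,
      Finset.card_erase_of_mem (lowBit_mem (hT j))]
    omega
  have hav' : ∀ j ∉ v, a j = (T j).card := by
    intro j hj
    have h1 := mt (hmemv j).2 hj
    simp only [ha, hLdef, partsList, if_neg h1, Finset.length_sort]
  have haα : ∀ j, a j ≤ α := by
    intro j
    by_cases hj : j ∈ v
    · exact (hav j hj).le
    · rw [hav' j hj]; exact not_lt.1 (mt (hmemv j).2 hj)
  have hapos : ∀ j ∉ v, 0 < a j := fun j hj => by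
    rw [hav' j hj]; exact Finset.card_pos.2 (hT j)
  set h := mixedDeriv a g with hh
  have hFa : ∀ x ∈ cube ι, h x = F a x := hF.mixedDeriv_eq a haα
  have hhc : ContinuousOn h (cube ι) := (hF.continuousOn a haα).congr hFa
  -- the weights are the normalized iterated primitives
  set ρ : (ι → ℝ) → ℝ := fun x => ∏ j ∈ vᶜ, iterPrim (L j) (x j) / (2 * primMean (L j)) with hρ
  have hρmem : ρ ∈ weightClass v := by
    refine ⟨fun j t => iterPrim (L j) t / (2 * primMean (L j)), fun j => ⟨?_, fun t _ => ?_⟩, rfl⟩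
    · exact ((continuous_iterPrim _).div_const _).continuousOn
    · have hp := primMean_pos (L j)
      exact ⟨div_nonneg (iterPrim_nonneg (hL j) t) (by positivity),
        (div_le_one (by positivity)).2 (iterPrim_le' (hL j) t)⟩
  have hρc : Continuous ρ := continuous_finsetProd _ fun j _ =>
    ((continuous_iterPrim (L j)).comp (continuous_apply j)).div_const _
  set G : (v → ℝ) → ℝ := partialIntegral v (fun x => h x * ρ x) with hG
  have hGc : ContinuousOn G (cube v) :=
    continuousOn_partialIntegral (hhc.mul hρc.continuousOn) v
  have hGV : vitali lam G ≤ V :=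
    (le_iSup₂ (f := fun ρ (_ : ρ ∈ weightClass v) =>
      vitali lam (partialIntegral v fun x => h x * ρ x)) ρ hρmem).trans
      (hgV v a haα hav hapos)
  have hGtop : vitali lam G ≠ ⊤ := ne_top_of_le_ne_top hV hGV
  set c : ℝ := ∏ j ∈ vᶜ, (2 * primMean (L j)) with hc
  have hlowL : ∀ j ∈ v, ∀ q ∈ L j, lowBit (T j) < q := by
    intro j hj q hq
    have h1 := (hmemv j).1 hj
    simp only [hLdef, partsList, if_pos h1, Finset.mem_sort, Finset.mem_erase] at hq
    exact lt_of_le_of_ne (lowBit_le hq.2) (Ne.symm hq.1)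
  have hcoef : ∀ R ∈ freqBelow fun j => freeBits α (T j),
      (∫ x, g x * walProd (fun j => T j ∪ R j) x ∂cubeMeasure ι) ^ 2
      = c ^ 2 * (∫ y, G y * ∏ j : v, (wal (insert (lowBit (T j)) (R j)) (y j)
          * iterPrim (L j) (y j)) ∂cubeMeasure v) ^ 2 := by
    intro R hR
    have hRj : ∀ j, ∀ q ∈ R j, q < freeBits α (T j) := fun j q hq =>
      Finset.mem_range.1 (Finset.mem_powerset.1 (Fintype.mem_piFinset.1 hR j) hq)
    have hR0 : ∀ j ∉ v, R j = ∅ := by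
      intro j hj
      refine Finset.eq_empty_of_forall_notMem fun q hq => ?_
      have := hRj j q hq
      rw [freeBits, if_neg (mt (hmemv j).2 hj)] at this
      omega
    -- the bits that remain after the integrations by parts
    set R' : ι → Finset ℕ := fun j => if j ∈ v then insert (lowBit (T j)) (R j) else ∅ with hR'
    have hunion : ∀ j, T j ∪ R j = R' j ∪ (L j).toFinset := by
      intro j
      by_cases hj : j ∈ v
      · have h1 := (hmemv j).1 hj
        simp only [hR', if_pos hj, hLdef, partsList, if_pos h1, Finset.sort_toFinset]
        rw [Finset.insert_union, Finset.union_comm (R j), ← Finset.insert_union,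
          Finset.insert_erase (lowBit_mem (hT j))]
      · have h1 := mt (hmemv j).2 hj
        simp only [hR', if_neg hj, hLdef, partsList, if_neg h1, Finset.sort_toFinset, hR0 j hj,
          Finset.union_empty, Finset.empty_union]
    have hparts := hF.abs_integral_wal a haα L (fun j => rfl) hL R' (by
      intro j i hi q hq
      by_cases hj : j ∈ v
      · simp only [hR', if_pos hj, Finset.mem_insert] at hi
        rcases hi with rfl | hi
        · exact hlowL j hj q hq
        · have := hRj j i hi
          rw [freeBits, if_pos ((hmemv j).1 hj)] at this
          exact this.trans (hlowL j hj q hq)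
      · simp [hR', hj] at hi)
    have hΦ : Integrable (fun x => h x * ∏ j, wal (R' j) (x j) * iterPrim (L j) (x j))
        (cubeMeasure ι) := by
      refine integrable_mul_of_abs_le_one hhc ?_ fun x => ?_
      · exact Finset.measurable_fun_prod _ fun j _ =>
          ((measurable_wal _).comp (measurable_pi_apply j)).mul
            ((continuous_iterPrim _).measurable.comp (measurable_pi_apply j))
      · rw [Finset.abs_prod]
        refine Finset.prod_le_one (fun _ _ => abs_nonneg _) fun j _ => ?_
        rw [abs_mul, abs_wal, one_mul]
        exact abs_iterPrim_le_one (hL j) _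
    have hmain : ∫ x, F a x * ∏ j, wal (R' j) (x j) * iterPrim (L j) (x j) ∂cubeMeasure ι
        = c * ∫ y, G y * ∏ j : v, (wal (insert (lowBit (T j)) (R j)) (y j)
          * iterPrim (L j) (y j)) ∂cubeMeasure v := by
      have e1 : ∫ x, F a x * ∏ j, wal (R' j) (x j) * iterPrim (L j) (x j) ∂cubeMeasure ι
          = ∫ x, h x * ∏ j, wal (R' j) (x j) * iterPrim (L j) (x j) ∂cubeMeasure ι := by
        refine integral_congr_ae ?_
        filter_upwards [ae_mem_cube] with x hx
        rw [hFa x hx]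
      rw [e1, integral_glue v hΦ, ← integral_const_mul]
      refine integral_congr_ae (ae_of_all _ fun y => ?_)
      simp only [hG]
      rw [partialIntegral_eq, mul_comm (∫ x, _ ∂cubeMeasure ι), ← mul_assoc,
        ← integral_const_mul]
      refine integral_congr_ae (ae_of_all _ fun x => ?_)
      simp only [hρ, hc]
      have p1 : ∏ j ∈ v, wal (R' j) (glue v y x j) * iterPrim (L j) (glue v y x j)
          = ∏ j : v, (wal (insert (lowBit (T j)) (R j)) (y j) * iterPrim (L j) (y j)) := by
        rw [← Finset.prod_coe_sort]
        refine Finset.prod_congr rfl fun j _ => ?_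
        simp [hR', glue]
      have p2 : ∏ j ∈ vᶜ, wal (R' j) (glue v y x j) * iterPrim (L j) (glue v y x j)
          = (∏ j ∈ vᶜ, (2 * primMean (L j)))
            * ∏ j ∈ vᶜ, iterPrim (L j) (glue v y x j) / (2 * primMean (L j)) := by
        rw [← Finset.prod_mul_distrib]
        refine Finset.prod_congr rfl fun j hj => ?_
        have hp := primMean_pos (L j)
        simp only [hR', if_neg (Finset.mem_compl.1 hj), wal_empty, one_mul]
        field_simp
      rw [← Finset.prod_mul_prod_compl v, p1, p2]
      ring
    rw [← sq_abs]
    simp only [walProd, hunion]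
    rw [hparts, hmain, sq_abs, mul_pow]
  rw [Finset.sum_congr rfl hcoef, ← Finset.mul_sum]
  set l : v → ℕ := fun j => lowBit (T j) with hl
  have hbess := sum_sq_integral_le_vitali hGc hGtop l (L := fun j : v => L j) (fun j => hL j)
    (fun j => hlowL j j.2)
  -- off `v` there are no free bits, so that restriction to `v` is injective on the frequencies
  have hsum : ∑ R ∈ freqBelow fun j => freeBits α (T j),
      (∫ y, G y * ∏ j : v, (wal (insert (lowBit (T j)) (R j)) (y j)
          * iterPrim (L j) (y j)) ∂cubeMeasure v) ^ 2
      ≤ ∑ R ∈ freqBelow l, (∫ y, G y * ∏ j : v, (wal (insert (l j) (R j)) (y j)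
          * iterPrim (L j) (y j)) ∂cubeMeasure v) ^ 2 := by
    have hinj : Set.InjOn (fun (R : ι → Finset ℕ) (j : v) => R j)
        (freqBelow fun j => freeBits α (T j)) := by
      intro R hR R₁ hR₁ he
      funext j
      by_cases hj : j ∈ v
      · exact congrFun he ⟨j, hj⟩
      · have h0 : ∀ R ∈ freqBelow fun j => freeBits α (T j), R j = ∅ := by
          intro R hR
          have := Fintype.mem_piFinset.1 hR j
          simpa only [freeBits, if_neg (mt (hmemv j).2 hj), Finset.range_zero,
            Finset.powerset_empty, Finset.mem_singleton] using this
        rw [h0 R hR, h0 R₁ hR₁]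
    refine le_trans (le_of_eq ?_) (Finset.sum_le_sum_of_subset_of_nonneg
      (s := (freqBelow fun j => freeBits α (T j)).image fun R (j : v) => R j) ?_
      fun _ _ _ => sq_nonneg _)
    · rw [Finset.sum_image hinj]
    · rw [Finset.image_subset_iff]
      intro R hR
      refine Fintype.mem_piFinset.2 fun j => ?_
      have := Fintype.mem_piFinset.1 hR j
      simpa only [freeBits, if_pos ((hmemv j).1 j.2)] using this
  have hVle : (vitali lam G).toReal ^ 2 ≤ V.toReal ^ 2 :=
    pow_le_pow_left₀ ENNReal.toReal_nonneg (ENNReal.toReal_mono hV hGV) 2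
  have hprod : ∏ j, leadFactor α lam (T j) = c ^ 2 * ((∏ j : v, primMean (L j) ^ 2)
      * ((∏ j : v, halfSide l j) ^ lam) ^ 2) := by
    have q1 : ∏ j ∈ vᶜ, leadFactor α lam (T j) = c ^ 2 := by
      rw [hc, ← Finset.prod_pow]
      refine Finset.prod_congr rfl fun j hj => ?_
      rw [leadFactor, if_neg (mt (hmemv j).2 (Finset.mem_compl.1 hj))]
    have q2 : ∏ j ∈ v, leadFactor α lam (T j) = (∏ j : v, primMean (L j) ^ 2)
      * ((∏ j : v, halfSide l j) ^ lam) ^ 2 := by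
      rw [← Real.finsetProd_rpow _ _ fun j _ => by rw [halfSide]; positivity, ← Finset.prod_pow,
        ← Finset.prod_mul_distrib, ← Finset.prod_coe_sort]
      refine Finset.prod_congr rfl fun j _ => ?_
      rw [leadFactor, if_pos ((hmemv j).1 j.2)]
      rfl
    rw [← Finset.prod_mul_prod_compl v, q1, q2, mul_comm]
  rw [hprod]
  calc _ ≤ c ^ 2 * ((∏ j : v, primMean (L j) ^ 2) * ((∏ j : v, halfSide l j) ^ lam) ^ 2
        * (vitali lam G).toReal ^ 2) :=
        mul_le_mul_of_nonneg_left (hsum.trans hbess) (sq_nonneg _)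
    _ ≤ c ^ 2 * ((∏ j : v, primMean (L j) ^ 2) * ((∏ j : v, halfSide l j) ^ lam) ^ 2
        * V.toReal ^ 2) := by
        refine mul_le_mul_of_nonneg_left (mul_le_mul_of_nonneg_left hVle ?_) (sq_nonneg _)
        exact mul_nonneg (Finset.prod_nonneg fun _ _ => sq_nonneg _) (sq_nonneg _)
    _ = _ := by ring

end Leading

/-! ### Leading bits and digit weights -/

section Digits

theorem exists_top {K : Finset ℕ} {n : ℕ} (hn : n ≤ K.card) :
    ∃ T ⊆ K, T.card = n ∧ ∀ x ∈ K \ T, ∀ y ∈ T, x < y := by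
  induction n with
  | zero => exact ⟨∅, by simp, rfl, by simp⟩
  | succ n ih =>
    obtain ⟨T, hTK, hTc, hT⟩ := ih (by omega)
    have hne : (K \ T).Nonempty := by
      rw [← Finset.card_pos, Finset.card_sdiff_of_subset hTK]; omega
    have hmem := Finset.max'_mem _ hne
    have hmem' := Finset.mem_sdiff.1 hmem
    refine ⟨insert ((K \ T).max' hne) T, Finset.insert_subset hmem'.1 hTK,
      by rw [Finset.card_insert_of_notMem hmem'.2, hTc], fun x hx y hy => ?_⟩
    simp only [Finset.mem_sdiff, Finset.mem_insert, not_or] at hx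
    have hx' : x ∈ K \ T := Finset.mem_sdiff.2 ⟨hx.1, hx.2.2⟩
    rcases Finset.mem_insert.1 hy with rfl | hy
    · exact lt_of_le_of_ne (Finset.le_max' _ x hx') hx.2.1
    · exact hT x hx' y hy

/-- Every nonempty set of bits consists of at most `α + 1` leading bits and of free low bits. -/
theorem exists_leading (α : ℕ) {K : Finset ℕ} (hK : K.Nonempty) :
    ∃ T R : Finset ℕ, T ∪ R = K ∧ T.Nonempty ∧ T.card ≤ α + 1 ∧
      R ⊆ Finset.range (freeBits α T) := by
  rcases Nat.lt_or_ge α K.card with h | h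
  · obtain ⟨T, hTK, hTc, hT⟩ := exists_top (Nat.succ_le_of_lt h)
    have hne : T.Nonempty := Finset.card_pos.1 (by omega)
    refine ⟨T, K \ T, Finset.union_sdiff_of_subset hTK, hne, hTc.le, fun x hx => ?_⟩
    rw [freeBits, if_pos (by omega), Finset.mem_range]
    exact hT x hx _ (lowBit_mem hne)
  · exact ⟨K, ∅, by simp, hK, by omega, by simp⟩

/-- The weight of the leading bits `T`: the sum of the `α` largest positions, plus `lam` times the
next one if there is one. -/
noncomputable def leadWeight (α : ℕ) (lam : ℝ) (T : Finset ℕ) : ℝ :=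
  if α < T.card then ∑ l ∈ T.erase (lowBit T), ((l : ℝ) + 1) + lam * ((lowBit T : ℝ) + 1)
  else ∑ l ∈ T, ((l : ℝ) + 1)

theorem card_largest_le (d : ℕ) (κ : Finset ℕ) : (largest d κ).card ≤ d := by
  by_contra! h
  have hne : (largest d κ).Nonempty := Finset.card_pos.1 (by omega)
  have hmem := Finset.min'_mem _ hne
  have h1 := (Finset.mem_filter.1 hmem).2
  have h2 : (largest d κ).erase ((largest d κ).min' hne)
      ⊆ κ.filter ((largest d κ).min' hne < ·) := by
    intro x hx
    obtain ⟨hx1, hx2⟩ := Finset.mem_erase.1 hx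
    exact Finset.mem_filter.2 ⟨(Finset.mem_filter.1 hx2).1,
      lt_of_le_of_ne (Finset.min'_le _ x hx2) (Ne.symm hx1)⟩
  have h3 := Finset.card_le_card h2
  rw [Finset.card_erase_of_mem hmem] at h3
  omega

theorem exists_orderWeight_eq (d : ℕ) (κ : Finset ℕ) :
    ∃ M ⊆ κ, M.card ≤ d ∧ orderWeight d κ = ∑ l ∈ M, l := by
  rw [orderWeight]
  split_ifs with h
  · exact ⟨κ, subset_rfl, h, rfl⟩
  · exact ⟨largest d κ, Finset.filter_subset _ _, card_largest_le d κ, rfl⟩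

/-- The mean of the `d` largest positions is at most the mean of the `α + lam` largest ones. -/
theorem mul_orderWeight_le {α d : ℕ} {lam : ℝ} (hlam : 0 < lam) (hd : (α : ℝ) + lam ≤ d)
    {T R : Finset ℕ} (hT : T.Nonempty) (hTc : T.card ≤ α + 1)
    (hR : R ⊆ Finset.range (freeBits α T)) :
    ((α : ℝ) + lam) * orderWeight d ((T ∪ R).image (· + 1)) ≤ d * leadWeight α lam T := by
  obtain ⟨M, hM, hMd, hMw⟩ := exists_orderWeight_eq d ((T ∪ R).image (· + 1))
  rw [hMw]
  push_cast
  have hα0 : (0 : ℝ) ≤ α := Nat.cast_nonneg α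
  rw [leadWeight]
  split_ifs with h
  · set x : ℝ := (lowBit T : ℝ) + 1 with hx
    set T' := T.erase (lowBit T) with hT'
    have hx0 : 0 ≤ x := by positivity
    have hT'c : T'.card = α := by
      rw [hT', Finset.card_erase_of_mem (lowBit_mem hT)]; omega
    -- positions are compared with the lowest leading one, `x`
    have hge : ∀ l ∈ T', 0 ≤ ((l : ℝ) + 1) - x := fun l hl => by
      have : (lowBit T : ℝ) ≤ l := by exact_mod_cast lowBit_le (Finset.mem_of_mem_erase hl)
      rw [hx]; linarith
    have hle : ∀ y ∈ M, y ∉ T'.image (· + 1) → (y : ℝ) - x ≤ 0 := by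
      intro y hy hy'
      obtain ⟨l, hl, rfl⟩ := Finset.mem_image.1 (hM hy)
      have hlT : l ∉ T' := fun h' => hy' (Finset.mem_image_of_mem _ h')
      have : l ≤ lowBit T := by
        rcases Finset.mem_union.1 hl with hl | hl
        · by_contra hne
          exact hlT (Finset.mem_erase.2 ⟨by omega, hl⟩)
        · have := Finset.mem_range.1 (hR hl)
          rw [freeBits, if_pos h] at this
          exact this.le
      have : (l : ℝ) ≤ lowBit T := by exact_mod_cast this
      push_cast
      rw [hx]; linarith
    set S' := ∑ l ∈ T', ((l : ℝ) + 1) with hS'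
    have h1 : ∑ y ∈ M, ((y : ℝ) - x) ≤ ∑ l ∈ T', (((l : ℝ) + 1) - x) := by
      calc ∑ y ∈ M, ((y : ℝ) - x)
          ≤ ∑ y ∈ M.filter (· ∈ T'.image (· + 1)), ((y : ℝ) - x) := by
            rw [← Finset.sum_filter_add_sum_filter_not M (· ∈ T'.image (· + 1))]
            refine add_le_of_nonpos_right (Finset.sum_nonpos fun y hy => ?_)
            exact hle y (Finset.mem_filter.1 hy).1 (Finset.mem_filter.1 hy).2
        _ ≤ ∑ y ∈ T'.image (fun n : ℕ => n + 1), (((y : ℕ) : ℝ) - x) := by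
            refine Finset.sum_le_sum_of_subset_of_nonneg
              (fun y hy => (Finset.mem_filter.1 hy).2) fun y hy _ => ?_
            obtain ⟨l, hl, rfl⟩ := Finset.mem_image.1 hy
            push_cast
            exact hge l hl
        _ = _ := by
            rw [Finset.sum_image (fun a _ b _ hab => Nat.succ_injective hab)]
            push_cast; rfl
    rw [Finset.sum_sub_distrib, Finset.sum_sub_distrib, Finset.sum_const, Finset.sum_const,
      hT'c, nsmul_eq_mul, nsmul_eq_mul] at h1
    have h2 : (M.card : ℝ) ≤ d := by exact_mod_cast hMd
    have h3 : (α : ℝ) * x ≤ S' := by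
      have := Finset.sum_nonneg hge
      rw [Finset.sum_sub_distrib, Finset.sum_const, hT'c, nsmul_eq_mul] at this
      linarith
    have h4 : ∑ y ∈ M, (y : ℝ) ≤ S' + (d - α) * x := by
      have := mul_le_mul_of_nonneg_right h2 hx0
      linarith
    have h5 := mul_le_mul_of_nonneg_left h4 (by positivity : (0 : ℝ) ≤ α + lam)
    have h6 := mul_le_mul_of_nonneg_left h3 (sub_nonneg.2 hd)
    nlinarith
  · have hR0 : R = ∅ := by
      rw [freeBits, if_neg h] at hR
      simpa using hR
    have h1 : ∑ y ∈ M, (y : ℝ) ≤ ∑ l ∈ T, ((l : ℝ) + 1) := by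
      have : ∑ l ∈ T, ((l : ℝ) + 1) = ∑ y ∈ T.image (fun n : ℕ => n + 1), ((y : ℕ) : ℝ) := by
        rw [Finset.sum_image (fun a _ b _ hab => Nat.succ_injective hab)]
        push_cast; rfl
      rw [this]
      rw [hR0, Finset.union_empty] at hM
      exact Finset.sum_le_sum_of_subset_of_nonneg hM fun _ _ _ => Nat.cast_nonneg _
    exact mul_le_mul hd h1 (Finset.sum_nonneg fun _ _ => Nat.cast_nonneg _) (Nat.cast_nonneg _)

end Digits

/-! ### Summation over the leading bits -/

section Sums

/-- The elementary symmetric polynomial of degree `q` is at most `p₁ ^ q / q!`. -/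
theorem sum_powersetCard_prod_le {x : ℕ → ℝ} (hx : ∀ l, 0 ≤ x l) (S : Finset ℕ) (q : ℕ) :
    ∑ T ∈ S.powersetCard q, ∏ l ∈ T, x l ≤ (∑ l ∈ S, x l) ^ q / q.factorial := by
  induction S using Finset.induction_on generalizing q with
  | empty =>
    cases q with
    | zero => simp
    | succ q => rw [Finset.powersetCard_eq_empty.2 (by simp)]; simp
  | insert a S ha ih =>
    cases q with
    | zero => simp
    | succ q =>
      have hP : 0 ≤ ∑ l ∈ S, x l := Finset.sum_nonneg fun l _ => hx l
      rw [Finset.powersetCard_succ_insert ha, Finset.sum_union, Finset.sum_insert ha]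
      · have e : ∑ T ∈ (S.powersetCard q).image (insert a), ∏ l ∈ T, x l
            = x a * ∑ T ∈ S.powersetCard q, ∏ l ∈ T, x l := by
          have hmem : ∀ T ∈ S.powersetCard q, a ∉ T := fun T hT h =>
            ha ((Finset.mem_powersetCard.1 hT).1 h)
          rw [Finset.sum_image, Finset.mul_sum]
          · exact Finset.sum_congr rfl fun T hT => Finset.prod_insert (hmem T hT)
          · intro T hT T' hT' h
            rw [← Finset.erase_insert (hmem T hT), h, Finset.erase_insert (hmem T' hT')]
        rw [e]
        refine (add_le_add (ih (q + 1)) (mul_le_mul_of_nonneg_left (ih q) (hx a))).trans ?_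
        set p := ∑ l ∈ S, x l
        have hb : p ^ (q + 1) + (q + 1) * (x a * p ^ q) ≤ (x a + p) ^ (q + 1) := by
          have := pow_add_mul_le_add_pow (b := x a) hP (by linarith [hx a]) (q + 1)
          rw [add_comm p] at this
          push_cast at this
          linarith
        rw [Nat.factorial_succ]
        push_cast
        have hf : (0 : ℝ) < q.factorial := by exact_mod_cast q.factorial_pos
        rw [le_div_iff₀ (by positivity)]
        refine le_trans (le_of_eq ?_) hb
        field_simp
      · rw [Finset.disjoint_left]
        intro T hT hT'
        obtain ⟨T', _, rfl⟩ := Finset.mem_image.1 hT'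
        exact ha ((Finset.mem_powersetCard.1 hT).1 (Finset.mem_insert_self a T'))

theorem sum_geometric_le {y : ℝ} (h0 : 0 < y) (h1 : y < 1) (N : ℕ) :
    ∑ n ∈ Finset.range N, y ^ (n + 1) ≤ 1 / (1 / y - 1) := by
  have e : (1 : ℝ) / (1 / y - 1) = y * (1 - y)⁻¹ := by
    have : (1 : ℝ) - y ≠ 0 := by linarith
    rw [← div_eq_mul_inv, div_sub_one h0.ne', one_div_div]
  rw [e, ← tsum_geometric_of_lt_one h0.le h1]
  have := Summable.sum_le_tsum (Finset.range N) (fun n _ => by positivity)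
    (summable_geometric_of_lt_one h0.le h1)
  calc ∑ n ∈ Finset.range N, y ^ (n + 1) = y * ∑ n ∈ Finset.range N, y ^ n := by
        rw [Finset.mul_sum]; exact Finset.sum_congr rfl fun n _ => by ring
    _ ≤ _ := mul_le_mul_of_nonneg_left this h0.le

theorem primMean_sort (S : Finset ℕ) :
    primMean (S.sort (· ≤ ·)) = ∏ l ∈ S, (1 : ℝ) / 2 ^ (l + 2) := by
  rw [primMean]
  conv_rhs => rw [← Finset.sort_toFinset (r := (· ≤ ·)) S]
  exact (List.prod_toFinset _ (Finset.sort_nodup _ _)).symm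

/-- With `z = 4 ^ (-(1 - θ))`, the squared mean of an iterated primitive times the exponential of
the weight of its bits is a product of powers of `z`, up to a power of `1 / 4`. -/
theorem sq_prod_mul_rpow (θ : ℝ) (S : Finset ℕ) :
    (∏ l ∈ S, (1 : ℝ) / 2 ^ (l + 2)) ^ 2 * (4 : ℝ) ^ (θ * ∑ l ∈ S, ((l : ℝ) + 1))
      = (1 / 4) ^ S.card * ∏ l ∈ S, ((4 : ℝ) ^ (-(1 - θ))) ^ (l + 1) := by
  rw [Finset.mul_sum, Real.rpow_sum_of_pos (by norm_num), ← Finset.prod_pow,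
    ← Finset.prod_mul_distrib, ← Finset.prod_const, ← Finset.prod_mul_distrib]
  refine Finset.prod_congr rfl fun l _ => ?_
  have h4 : (2 : ℝ) ^ 2 = 4 := by norm_num
  rw [← Real.rpow_natCast ((4 : ℝ) ^ (-(1 - θ))), ← Real.rpow_mul (by norm_num)]
  have e1 : ((1 : ℝ) / 2 ^ (l + 2)) ^ 2 = 1 / 4 * (4 : ℝ) ^ (-((l : ℝ) + 1)) := by
    rw [Real.rpow_neg (by norm_num), show (l : ℝ) + 1 = ((l + 1 : ℕ) : ℝ) by push_cast; ring,
      Real.rpow_natCast, div_pow, ← pow_mul, mul_comm (l + 2) 2, pow_mul, h4]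
    field_simp
    ring
  rw [e1, mul_assoc, ← Real.rpow_add (by norm_num)]
  congr 2
  push_cast
  ring

/-- The sets of leading bits of frequencies below `2 ^ N`. -/
noncomputable def leadSets (α N : ℕ) : Finset (Finset ℕ) := by
  classical
  exact (Finset.range N).powerset.filter fun T => T.Nonempty ∧ T.card ≤ α + 1

theorem mem_leadSets {α N : ℕ} {T : Finset ℕ} :
    T ∈ leadSets α N ↔ T ⊆ Finset.range N ∧ T.Nonempty ∧ T.card ≤ α + 1 := by
  classical
  simp [leadSets]

theorem leadFactor_nonneg (α : ℕ) (lam : ℝ) (T : Finset ℕ) : 0 ≤ leadFactor α lam T := by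
  rw [leadFactor]; split <;> positivity

/-- The sum over all sets of leading bits in one coordinate is at most `constC`. -/
theorem sum_leadFactor_le {α : ℕ} {lam θ : ℝ} (hlam : 0 < lam) (hθ : θ < 1) (N : ℕ) :
    ∑ T ∈ leadSets α N, leadFactor α lam T * (4 : ℝ) ^ (θ * leadWeight α lam T)
      ≤ constC α lam θ := by
  classical
  set z : ℝ := (4 : ℝ) ^ (-(1 - θ)) with hz
  have hz0 : 0 < z := by positivity
  have hz1 : z < 1 := Real.rpow_lt_one_of_one_lt_of_neg (by norm_num) (by linarith)
  have hzinv : 1 / z = (4 : ℝ) ^ (1 - θ) := by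
    rw [hz, Real.rpow_neg (by norm_num), one_div, inv_inv]
  set g : ℝ := (4 : ℝ) ^ (1 - θ) - 1 with hg
  have hgpos : 0 < g := by
    have : (1 : ℝ) < 4 ^ (1 - θ) := Real.one_lt_rpow (by norm_num) (by linarith)
    rw [hg]; linarith
  rw [← Finset.sum_filter_add_sum_filter_not (leadSets α N) fun T => α < T.card, constC]
  refine add_le_add ?_ ?_
  · -- sets with `α + 1` elements, parametrized by the lowest element and the rest
    set y : ℝ := z ^ ((α : ℝ) + lam) with hy
    have hαl : 0 < (α : ℝ) + lam := by positivity
    have hy0 : 0 < y := by positivity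
    have hy1 : y < 1 := Real.rpow_lt_one hz0.le hz1 hαl
    have hyinv : 1 / y = (4 : ℝ) ^ (((α : ℝ) + lam) * (1 - θ)) := by
      rw [hy, hz, ← Real.rpow_mul (by norm_num), one_div, ← Real.rpow_neg (by norm_num)]
      congr 1; ring
    have hterm : ∀ T ∈ (leadSets α N).filter fun T => α < T.card,
        leadFactor α lam T * (4 : ℝ) ^ (θ * leadWeight α lam T)
        = (1 / 4) ^ α * (y ^ (lowBit T + 1)
          * ∏ l ∈ T.erase (lowBit T), z ^ (l - lowBit T)) := by
      intro T hT
      obtain ⟨hT1, hT2⟩ := Finset.mem_filter.1 hT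
      obtain ⟨-, hne, hc⟩ := mem_leadSets.1 hT1
      have hcard : (T.erase (lowBit T)).card = α := by
        rw [Finset.card_erase_of_mem (lowBit_mem hne)]; omega
      rw [leadFactor, leadWeight, partsList, if_pos hT2, if_pos hT2, if_pos hT2, primMean_sort,
        mul_add, Real.rpow_add (by norm_num)]
      have e1 := sq_prod_mul_rpow θ (T.erase (lowBit T))
      rw [← hz, hcard] at e1
      have e2 : (((1 : ℝ) / 2 ^ (lowBit T + 1)) ^ lam) ^ 2
          * (4 : ℝ) ^ (θ * (lam * ((lowBit T : ℝ) + 1))) = (z ^ lam) ^ (lowBit T + 1) := by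
        have h4 : (4 : ℝ) = 2 ^ (2 : ℝ) := by norm_num
        rw [← Real.rpow_natCast (((1 : ℝ) / 2 ^ (lowBit T + 1)) ^ lam) 2,
          ← Real.rpow_natCast (z ^ lam), hz, h4, one_div, ← Real.rpow_natCast 2 (lowBit T + 1),
          ← Real.rpow_neg (by norm_num)]
        simp only [← Real.rpow_mul (show (0 : ℝ) ≤ 2 by norm_num)]
        rw [← Real.rpow_add (by norm_num)]
        congr 1
        push_cast
        ring
      have e3 : ∏ l ∈ T.erase (lowBit T), z ^ (l + 1)
          = (z ^ α) ^ (lowBit T + 1) * ∏ l ∈ T.erase (lowBit T), z ^ (l - lowBit T) := by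
        rw [← pow_mul, mul_comm α, pow_mul, ← hcard, ← Finset.prod_const,
          ← Finset.prod_mul_distrib]
        refine Finset.prod_congr rfl fun l hl => ?_
        rw [← pow_add]
        congr 1
        have := lowBit_le (Finset.mem_of_mem_erase hl)
        omega
      have e4 : y ^ (lowBit T + 1) = (z ^ α) ^ (lowBit T + 1) * (z ^ lam) ^ (lowBit T + 1) := by
        rw [← mul_pow, hy, Real.rpow_add hz0, Real.rpow_natCast]
      calc _ = ((∏ l ∈ T.erase (lowBit T), (1 : ℝ) / 2 ^ (l + 2)) ^ 2
              * (4 : ℝ) ^ (θ * ∑ l ∈ T.erase (lowBit T), ((l : ℝ) + 1)))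
            * ((((1 : ℝ) / 2 ^ (lowBit T + 1)) ^ lam) ^ 2
              * (4 : ℝ) ^ (θ * (lam * ((lowBit T : ℝ) + 1)))) := by ring
        _ = _ := by rw [e1, e2, e3, e4]; ring
    rw [Finset.sum_congr rfl hterm, ← Finset.mul_sum]
    have hinj : Set.InjOn (fun T : Finset ℕ => (⟨lowBit T, T.erase (lowBit T)⟩ : Σ _ : ℕ, Finset ℕ))
        ((leadSets α N).filter fun T => α < T.card) := by
      intro T hT T' hT' h
      have hne := (mem_leadSets.1 (Finset.mem_filter.1 hT).1).2.1
      have hne' := (mem_leadSets.1 (Finset.mem_filter.1 hT').1).2.1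
      simp only [Sigma.mk.injEq, heq_eq_eq] at h
      rw [← Finset.insert_erase (lowBit_mem hne), h.2, h.1, Finset.insert_erase (lowBit_mem hne')]
    have hsum : ∑ T ∈ (leadSets α N).filter fun T => α < T.card,
        y ^ (lowBit T + 1) * ∏ l ∈ T.erase (lowBit T), z ^ (l - lowBit T)
        ≤ ∑ q ∈ Finset.range N, ∑ T' ∈ (Finset.Ico (q + 1) N).powersetCard α,
          y ^ (q + 1) * ∏ l ∈ T', z ^ (l - q) := by
      rw [Finset.sum_sigma']
      refine le_trans (le_of_eq ?_) (Finset.sum_le_sum_of_subset_of_nonneg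
        (s := ((leadSets α N).filter fun T => α < T.card).image
          fun T => (⟨lowBit T, T.erase (lowBit T)⟩ : Σ _ : ℕ, Finset ℕ)) ?_
        fun p _ _ => by positivity)
      · rw [Finset.sum_image hinj]
      · rw [Finset.image_subset_iff]
        intro T hT
        obtain ⟨hT1, hT2⟩ := Finset.mem_filter.1 hT
        obtain ⟨hs, hne, hc⟩ := mem_leadSets.1 hT1
        simp only [Finset.mem_sigma, Finset.mem_powersetCard]
        refine ⟨hs (lowBit_mem hne), fun l hl => ?_, ?_⟩
        · obtain ⟨h1, h2⟩ := Finset.mem_erase.1 hl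
          have h3 := lowBit_le h2
          have h4 := Finset.mem_range.1 (hs h2)
          rw [Finset.mem_Ico]; omega
        · rw [Finset.card_erase_of_mem (lowBit_mem hne)]; omega
    have hinner : ∀ q, ∑ T' ∈ (Finset.Ico (q + 1) N).powersetCard α, ∏ l ∈ T', z ^ (l - q)
        ≤ (1 / g) ^ α / α.factorial := by
      intro q
      refine (sum_powersetCard_prod_le (x := fun l => z ^ (l - q)) (fun l => by positivity)
        _ α).trans ?_
      have : ∑ l ∈ Finset.Ico (q + 1) N, z ^ (l - q) ≤ 1 / g := by
        rw [Finset.sum_Ico_eq_sum_range, hg, ← hzinv]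
        refine le_trans (le_of_eq ?_) (sum_geometric_le hz0 hz1 (N - (q + 1)))
        refine Finset.sum_congr rfl fun n _ => ?_
        congr 1; omega
      gcongr
    have hfin : ∑ q ∈ Finset.range N, ∑ T' ∈ (Finset.Ico (q + 1) N).powersetCard α,
          y ^ (q + 1) * ∏ l ∈ T', z ^ (l - q)
        ≤ (1 / ((4 : ℝ) ^ (((α : ℝ) + lam) * (1 - θ)) - 1)) * ((1 / g) ^ α / α.factorial) := by
      rw [← hyinv]
      refine le_trans (Finset.sum_le_sum (g := fun q => y ^ (q + 1)
        * ((1 / g) ^ α / α.factorial)) fun q _ => ?_) ?_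
      · rw [← Finset.mul_sum]
        exact mul_le_mul_of_nonneg_left (hinner q) (by positivity)
      · rw [← Finset.sum_mul]
        exact mul_le_mul_of_nonneg_right (sum_geometric_le hy0 hy1 N) (by positivity)
    refine (mul_le_mul_of_nonneg_left (hsum.trans hfin) (by positivity)).trans (le_of_eq ?_)
    rw [zpow_neg, zpow_natCast, one_div_pow, one_div_pow]
    have hY : (4 : ℝ) ^ (((α : ℝ) + lam) * (1 - θ)) - 1 ≠ 0 := by
      rw [← hyinv]
      have : 1 < 1 / y := by rw [lt_div_iff₀ hy0]; linarith
      linarith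
    rw [← hg]
    field_simp
  · -- sets with at most `α` elements, sorted by their number of elements
    have hterm : ∀ T ∈ (leadSets α N).filter fun T => ¬ α < T.card,
        leadFactor α lam T * (4 : ℝ) ^ (θ * leadWeight α lam T)
        = 4 * ((1 / 4) ^ T.card * ∏ l ∈ T, z ^ (l + 1)) := by
      intro T hT
      have hT2 := (Finset.mem_filter.1 hT).2
      rw [leadFactor, leadWeight, partsList, if_neg hT2, if_neg hT2, if_neg hT2, primMean_sort,
        ← sq_prod_mul_rpow]
      ring
    rw [Finset.sum_congr rfl hterm]
    have hmaps : ∀ T ∈ (leadSets α N).filter fun T => ¬ α < T.card,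
        T.card ∈ Finset.range (α + 1) := fun T hT =>
      Finset.mem_range.2 (by have := (Finset.mem_filter.1 hT).2; omega)
    rw [← Finset.sum_fiberwise_of_maps_to hmaps]
    refine Finset.sum_le_sum fun q _ => ?_
    have h1 : ∑ T ∈ ((leadSets α N).filter fun T => ¬ α < T.card).filter fun T => T.card = q,
        4 * ((1 / 4) ^ T.card * ∏ l ∈ T, z ^ (l + 1))
        ≤ ∑ T ∈ (Finset.range N).powersetCard q, 4 * ((1 / 4) ^ q * ∏ l ∈ T, z ^ (l + 1)) := by
      rw [Finset.sum_congr rfl fun T hT => by rw [(Finset.mem_filter.1 hT).2]]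
      refine Finset.sum_le_sum_of_subset_of_nonneg (fun T hT => ?_) fun _ _ _ => by positivity
      obtain ⟨h1, h2⟩ := Finset.mem_filter.1 hT
      exact Finset.mem_powersetCard.2
        ⟨(mem_leadSets.1 (Finset.mem_filter.1 h1).1).1, h2⟩
    refine h1.trans ?_
    rw [← Finset.mul_sum, ← Finset.mul_sum]
    have h2 : ∑ T ∈ (Finset.range N).powersetCard q, ∏ l ∈ T, z ^ (l + 1)
        ≤ (1 / g) ^ q / q.factorial := by
      refine (sum_powersetCard_prod_le (x := fun l => z ^ (l + 1)) (fun l => by positivity)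
        _ q).trans ?_
      have := sum_geometric_le hz0 hz1 N
      rw [hzinv] at this
      gcongr
    refine (mul_le_mul_of_nonneg_left (mul_le_mul_of_nonneg_left h2 (by positivity))
      (by norm_num)).trans (le_of_eq ?_)
    rw [zpow_add₀ (by norm_num), zpow_neg, zpow_natCast, zpow_one, one_div_pow, one_div_pow, ← hg]
    field_simp

end Sums

/-! ### Weighted sums of squared Walsh coefficients -/

section Weighted

variable {ι : Type*} [Fintype ι] [LinearOrder ι]

/-- The frequencies with bits below `N` and full support. -/
noncomputable def fullFreq (ι : Type*) [Fintype ι] [DecidableEq ι] (N : ℕ) :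
    Finset (ι → Finset ℕ) :=
  Fintype.piFinset fun _ => (Finset.range N).powerset.filter fun K => K ≠ ∅

theorem mem_fullFreq {N : ℕ} {K : ι → Finset ℕ} :
    K ∈ fullFreq ι N ↔ ∀ j, K j ⊆ Finset.range N ∧ (K j).Nonempty := by
  simp [fullFreq, Fintype.mem_piFinset, Finset.nonempty_iff_ne_empty]

/-- The squared Walsh coefficients, weighted by the exponential of their digit weights, are
summable with a bound in terms of the variation. -/
theorem sum_sq_walsh_mul_weight_le {α d : ℕ} {lam θ : ℝ} (hlam : 0 < lam) (hθ0 : 0 < θ)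
    (hθ1 : θ < 1) (hd : (α : ℝ) + lam ≤ d) {g : (ι → ℝ) → ℝ} {F : (ι → ℕ) → (ι → ℝ) → ℝ}
    (hF : MixedFamily α g F) {V : ℝ≥0∞} (hV : V ≠ ⊤)
    (hgV : ∀ (v : Finset ι) (a : ι → ℕ), (∀ j, a j ≤ α) → (∀ j ∈ v, a j = α) →
      (∀ j ∉ v, 0 < a j) → partialVitali lam v (mixedDeriv a g) ≤ V) (N : ℕ) :
    ∑ K ∈ fullFreq ι N, (∫ x, g x * walProd K x ∂cubeMeasure ι) ^ 2
        * ∏ j, (4 : ℝ) ^ (θ * (((α : ℝ) + lam) * orderWeight d ((K j).image (· + 1)) / d))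
      ≤ constC α lam θ ^ Fintype.card ι * V.toReal ^ 2 := by
  classical
  have hα0 : (0 : ℝ) ≤ α := Nat.cast_nonneg α
  have hd0 : (0 : ℝ) < d := by linarith
  have hex := fun K : Finset ℕ => fun hK : K.Nonempty => exists_leading α hK
  -- the frequency `K` is encoded by its leading bits and its free bits
  choose! Tc Rc hTR hTne hTcard hR using hex
  set c : (ι → Finset ℕ) → ℝ := fun K => (∫ x, g x * walProd K x ∂cubeMeasure ι) ^ 2 with hc
  set W : (ι → Finset ℕ) → ℝ := fun T => ∏ j, (4 : ℝ) ^ (θ * leadWeight α lam (T j)) with hW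
  set A : Finset (ι → Finset ℕ) := Fintype.piFinset fun _ => leadSets α N with hA
  set E : Finset (Σ _ : ι → Finset ℕ, ι → Finset ℕ) :=
    A.sigma fun T => freqBelow fun j => freeBits α (T j) with hE
  set ψ : (Σ _ : ι → Finset ℕ, ι → Finset ℕ) → ℝ := fun p =>
    c (fun j => p.1 j ∪ p.2 j) * W p.1 with hψ
  set code : (ι → Finset ℕ) → Σ _ : ι → Finset ℕ, ι → Finset ℕ := fun K =>
    ⟨fun j => Tc (K j), fun j => Rc (K j)⟩ with hcode
  have hψ0 : ∀ p, 0 ≤ ψ p := fun p =>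
    mul_nonneg (sq_nonneg _) (Finset.prod_nonneg fun _ _ => by positivity)
  have hinj : Set.InjOn code (fullFreq ι N) := by
    intro K hK K' hK' h
    simp only [hcode, Sigma.mk.injEq, heq_eq_eq] at h
    funext j
    rw [← hTR (K j) (mem_fullFreq.1 hK j).2, ← hTR (K' j) (mem_fullFreq.1 hK' j).2,
      congrFun h.1 j, congrFun h.2 j]
  have h1 : ∀ K ∈ fullFreq ι N, c K
        * ∏ j, (4 : ℝ) ^ (θ * (((α : ℝ) + lam) * orderWeight d ((K j).image (· + 1)) / d))
      ≤ ψ (code K) := by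
    intro K hK
    have hKj := mem_fullFreq.1 hK
    have hKe : (fun j => Tc (K j) ∪ Rc (K j)) = K := funext fun j => hTR (K j) (hKj j).2
    simp only [hψ, hcode, hKe]
    refine mul_le_mul_of_nonneg_left ?_ (sq_nonneg _)
    refine Finset.prod_le_prod (fun j _ => by positivity) fun j _ => ?_
    refine Real.rpow_le_rpow_of_exponent_le (by norm_num) ?_
    refine mul_le_mul_of_nonneg_left ?_ hθ0.le
    have := mul_orderWeight_le hlam hd (hTne _ (hKj j).2) (hTcard _ (hKj j).2) (hR _ (hKj j).2)
    rw [hTR (K j) (hKj j).2] at this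
    rw [div_le_iff₀ hd0]
    linarith
  have h2 : ∑ K ∈ fullFreq ι N, ψ (code K) ≤ ∑ p ∈ E, ψ p := by
    rw [← Finset.sum_image hinj]
    refine Finset.sum_le_sum_of_subset_of_nonneg (Finset.image_subset_iff.2 fun K hK => ?_)
      fun p _ _ => hψ0 p
    have hKj := mem_fullFreq.1 hK
    refine Finset.mem_sigma.2 ⟨Fintype.mem_piFinset.2 fun j => mem_leadSets.2 ⟨?_, ?_, ?_⟩,
      Fintype.mem_piFinset.2 fun j => Finset.mem_powerset.2 (hR _ (hKj j).2)⟩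
    · refine Finset.Subset.trans ?_ (hKj j).1
      conv_rhs => rw [← hTR (K j) (hKj j).2]
      exact Finset.subset_union_left
    · exact hTne _ (hKj j).2
    · exact hTcard _ (hKj j).2
  have hC : ∑ T ∈ leadSets α N, leadFactor α lam T * (4 : ℝ) ^ (θ * leadWeight α lam T)
      ≤ constC α lam θ := sum_leadFactor_le hlam hθ1 N
  calc _ ≤ ∑ K ∈ fullFreq ι N, ψ (code K) := Finset.sum_le_sum h1
    _ ≤ ∑ p ∈ E, ψ p := h2
    _ = ∑ T ∈ A, (∑ R ∈ freqBelow fun j => freeBits α (T j), c fun j => T j ∪ R j) * W T := by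
        rw [hE, Finset.sum_sigma]
        simp only [hψ, Finset.sum_mul]
    _ ≤ ∑ T ∈ A, ((∏ j, leadFactor α lam (T j)) * V.toReal ^ 2) * W T := by
        refine Finset.sum_le_sum fun T hT => mul_le_mul_of_nonneg_right ?_
          (Finset.prod_nonneg fun _ _ => by positivity)
        have hTj := fun j => mem_leadSets.1 (Fintype.mem_piFinset.1 hT j)
        exact sum_sq_walsh_leading_le hF hV hgV T (fun j => (hTj j).2.1) fun j => (hTj j).2.2
    _ = (∑ T ∈ A, ∏ j, leadFactor α lam (T j) * (4 : ℝ) ^ (θ * leadWeight α lam (T j)))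
          * V.toReal ^ 2 := by
        rw [Finset.sum_mul]
        refine Finset.sum_congr rfl fun T _ => ?_
        rw [Finset.prod_mul_distrib]
        ring
    _ = (∑ T ∈ leadSets α N, leadFactor α lam T * (4 : ℝ) ^ (θ * leadWeight α lam T))
          ^ Fintype.card ι * V.toReal ^ 2 := by
        rw [hA, ← Finset.prod_univ_sum (fun _ : ι => leadSets α N)
          (fun _ T => leadFactor α lam T * (4 : ℝ) ^ (θ * leadWeight α lam T)),
          Finset.prod_const, Finset.card_univ]
    _ ≤ _ := by
        refine mul_le_mul_of_nonneg_right (pow_le_pow_left₀ ?_ hC _) (sq_nonneg _)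
        exact Finset.sum_nonneg fun T _ => mul_nonneg (leadFactor_nonneg _ _ _) (by positivity)

end Weighted

/-! ### Walsh functions of digit sequences -/

section DigitWalsh

/-- The nontrivial character of `ℤ/2` with values `±1`. -/
noncomputable def sgn (b : ZMod 2) : ℝ := if b = 0 then 1 else -1

theorem zmod_two_cases (b : ZMod 2) : b = 0 ∨ b = 1 := by revert b; decide

@[simp] theorem sgn_zero : sgn 0 = 1 := by simp [sgn]

@[simp] theorem sgn_one : sgn 1 = -1 := by simp [sgn]

theorem sgn_add (a b : ZMod 2) : sgn (a + b) = sgn a * sgn b := by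
  have h : (1 : ZMod 2) + 1 = 0 := by decide
  rcases zmod_two_cases a with rfl | rfl <;> rcases zmod_two_cases b with rfl | rfl <;>
    simp [h]

theorem sgn_sum {κ : Type*} (S : Finset κ) (b : κ → ZMod 2) :
    sgn (∑ k ∈ S, b k) = ∏ k ∈ S, sgn (b k) := by
  classical
  induction S using Finset.induction_on with
  | empty => simp
  | insert a S ha ih => rw [Finset.sum_insert ha, Finset.prod_insert ha, sgn_add, ih]

theorem sgn_eq_or (b : ZMod 2) : sgn b = 1 ∨ sgn b = -1 := by
  rcases zmod_two_cases b with rfl | rfl <;> simp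

theorem sgn_mul_self (b : ZMod 2) : sgn b * sgn b = 1 := by
  rcases sgn_eq_or b with h | h <;> rw [h] <;> norm_num

theorem measurable_sgn : Measurable sgn := measurable_from_top

theorem sgn_eq_neg_one_pow (b : ZMod 2) : sgn b = (-1) ^ b.val := by
  rcases zmod_two_cases b with rfl | rfl
  · simp
  · rw [sgn_one, ZMod.val_one]; norm_num

variable {s m : ℕ}

/-- The Walsh function of frequency `K` as a function of the binary digits of its argument. -/
noncomputable def digitWal (K : Fin s → Finset ℕ) (δ : Shifts s) : ℝ :=
  ∏ j, ∏ l ∈ K j, sgn (δ j l)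

theorem abs_digitWal (K : Fin s → Finset ℕ) (δ : Shifts s) : |digitWal K δ| = 1 := by
  rw [digitWal, Finset.abs_prod]
  refine Finset.prod_eq_one fun j _ => ?_
  rw [Finset.abs_prod]
  refine Finset.prod_eq_one fun l _ => ?_
  rcases sgn_eq_or (δ j l) with h | h <;> rw [h] <;> norm_num

theorem measurable_digitWal (K : Fin s → Finset ℕ) : Measurable (digitWal K) := by
  refine Finset.measurable_fun_prod _ fun j _ => Finset.measurable_fun_prod _ fun l _ => ?_
  exact measurable_sgn.comp ((measurable_pi_apply l).comp (measurable_pi_apply j))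

/-- The point of the unit cube with the binary digits `δ`. -/
noncomputable def digitPoint (δ : Shifts s) : Fin s → ℝ :=
  fun j => ∑' l : ℕ, ((δ j l).val : ℝ) / 2 ^ (l + 1)

theorem digit_sum_bounds (b : ℕ → ZMod 2) (N : ℕ) :
    ∑ l ∈ Finset.range N, ((b l).val : ℝ) / 2 ^ (l + 1)
      ≤ ∑' l : ℕ, ((b l).val : ℝ) / 2 ^ (l + 1) ∧
    ∑' l : ℕ, ((b l).val : ℝ) / 2 ^ (l + 1)
      ≤ ∑ l ∈ Finset.range N, ((b l).val : ℝ) / 2 ^ (l + 1) + 1 / 2 ^ N := by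
  have hval : ∀ b : ZMod 2, ((b.val : ℕ) : ℝ) ≤ 1 := fun b => by
    have := ZMod.val_lt b
    exact_mod_cast Nat.lt_succ_iff.1 this
  have hle : ∀ l, ((b l).val : ℝ) / 2 ^ (l + 1) ≤ 1 / 2 / 2 ^ l := fun l => by
    rw [pow_succ', ← div_div]
    gcongr
    exact hval _
  have hsum : Summable fun l : ℕ => ((b l).val : ℝ) / 2 ^ (l + 1) :=
    Summable.of_nonneg_of_le (fun l => by positivity) hle (summable_geometric_two' 1)
  refine ⟨hsum.sum_le_tsum _ fun l _ => by positivity, ?_⟩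
  rw [← hsum.sum_add_tsum_nat_add N]
  refine add_le_add le_rfl ?_
  rw [← tsum_geometric_two' ((1 : ℝ) / 2 ^ N)]
  refine Summable.tsum_le_tsum (fun l => ?_) ((summable_nat_add_iff N).2 hsum)
    (summable_geometric_two' _)
  refine (hle (l + N)).trans (le_of_eq ?_)
  rw [pow_add]
  field_simp

theorem digitPoint_mem_cube (δ : Shifts s) : digitPoint δ ∈ cube (Fin s) := by
  rw [mem_cube]
  intro j
  have := digit_sum_bounds (δ j) 0
  simpa [digitPoint] using this

/-- The partial Walsh expansion of `f` over the frequencies with bits below `N`. -/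
noncomputable def walshPartialSum (f : (Fin s → ℝ) → ℝ) (N : ℕ) (δ : Shifts s) : ℝ :=
  ∑ K ∈ freqBelow (fun _ : Fin s => N),
    (∫ x, f x * walProd K x ∂cubeMeasure (Fin s)) * digitWal K δ

/-- The Dirichlet kernel of the partial Walsh expansions. -/
noncomputable def walshKernel (N : ℕ) (δ : Shifts s) (y : Fin s → ℝ) : ℝ :=
  ∏ j, ∏ l ∈ Finset.range N, (1 + rad l (y j) * sgn (δ j l))

theorem walshKernel_eq_sum (N : ℕ) (δ : Shifts s) (y : Fin s → ℝ) :
    walshKernel N δ y = ∑ K ∈ freqBelow (fun _ : Fin s => N), walProd K y * digitWal K δ := by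
  simp only [walshKernel, Finset.prod_one_add]
  rw [Finset.prod_univ_sum]
  refine Finset.sum_congr rfl fun K _ => ?_
  simp only [walProd, wal, digitWal, ← Finset.prod_mul_distrib]

theorem walshKernel_nonneg (N : ℕ) (δ : Shifts s) (y : Fin s → ℝ) : 0 ≤ walshKernel N δ y := by
  refine Finset.prod_nonneg fun j _ => Finset.prod_nonneg fun l _ => ?_
  rcases rad_eq_or l (y j) with h | h <;> rcases sgn_eq_or (δ j l) with h' | h' <;>
    rw [h, h'] <;> norm_num

theorem integral_walProd {K : Fin s → Finset ℕ} (hK : ∃ j, (K j).Nonempty) :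
    ∫ y, walProd K y ∂cubeMeasure (Fin s) = 0 := by
  obtain ⟨j, hj⟩ := hK
  simp only [walProd]
  rw [integral_fintype_prod_eq_prod (fun j x => wal (K j) x)]
  refine Finset.prod_eq_zero (Finset.mem_univ j) ?_
  rw [integral_Icc_eq_integral_Ioc, ← intervalIntegral.integral_of_le zero_le_one,
    integral_wal hj]

theorem integrable_walProd (K : Fin s → Finset ℕ) :
    Integrable (walProd K) (cubeMeasure (Fin s)) := by
  simpa using integrable_mul_walProd (g := fun _ => 1) continuousOn_const K

theorem integrable_walshKernel (N : ℕ) (δ : Shifts s) :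
    Integrable (walshKernel N δ) (cubeMeasure (Fin s)) := by
  rw [funext (walshKernel_eq_sum N δ)]
  exact integrable_finsetSum _ fun K _ => (integrable_walProd K).mul_const _

theorem integral_walshKernel (N : ℕ) (δ : Shifts s) :
    ∫ y, walshKernel N δ y ∂cubeMeasure (Fin s) = 1 := by
  simp only [walshKernel_eq_sum]
  rw [integral_finsetSum _ fun K _ => (integrable_walProd K).mul_const _]
  rw [Finset.sum_eq_single (fun _ => ∅)]
  · simp [walProd, digitWal]
  · intro K _ hK
    rw [integral_mul_const, integral_walProd, zero_mul]
    by_contra! h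
    exact hK (funext h)
  · intro h
    exact absurd (Fintype.mem_piFinset.2 fun j => by simp) h

theorem dist_digitPoint_le {N : ℕ} {δ : Shifts s} {y : Fin s → ℝ}
    (hy : ∀ j, y j ∈ Set.Ico (0 : ℝ) 1) (hk : walshKernel N δ y ≠ 0) :
    dist y (digitPoint δ) ≤ 1 / 2 ^ N := by
  refine (dist_pi_le_iff (by positivity)).2 fun j => ?_
  have hrad : ∀ l < N, rad l (y j) = (-1) ^ (δ j l).val := by
    intro l hl
    have h1 := Finset.prod_ne_zero_iff.1 (Finset.prod_ne_zero_iff.1 hk j (Finset.mem_univ j)) l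
      (Finset.mem_range.2 hl)
    rw [← sgn_eq_neg_one_pow]
    rcases rad_eq_or l (y j) with h | h <;> rcases sgn_eq_or (δ j l) with h' | h' <;>
      rw [h, h'] at h1 ⊢ <;> norm_num at h1
  have hfl := floor_eq_sum_digits (δ := fun l => (δ j l).val) (fun l => by
    rcases zmod_two_cases (δ j l) with h | h <;> simp [h, ZMod.val_one]) (hy j).1 (hy j).2 N hrad
  obtain ⟨h1, h2⟩ := digit_sum_bounds (δ j) N
  have h3 := Int.floor_le ((2 : ℝ) ^ N * y j)
  have h4 := Int.lt_floor_add_one ((2 : ℝ) ^ N * y j)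
  rw [hfl] at h3 h4
  have hp : (0 : ℝ) < 2 ^ N := by positivity
  have h5 := le_of_mul_le_mul_left h3 hp
  have h6 : y j < ∑ l ∈ Finset.range N, ((δ j l).val : ℝ) / 2 ^ (l + 1) + 1 / 2 ^ N := by
    refine lt_of_mul_lt_mul_left (h4.trans_eq ?_) hp.le
    rw [mul_add, mul_one_div_cancel hp.ne']
  rw [Real.dist_eq, abs_le]
  simp only [digitPoint]
  exact ⟨by linarith, by linarith⟩

theorem ae_mem_Ico : ∀ᵐ y ∂cubeMeasure (Fin s), ∀ j, y j ∈ Set.Ico (0 : ℝ) 1 := by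
  have h : ∀ j : Fin s, ∀ᵐ y ∂cubeMeasure (Fin s), y j ∈ Set.Ico (0 : ℝ) 1 := by
    intro j
    have h1 : ∀ᵐ t ∂(volume.restrict (Set.Icc (0 : ℝ) 1)), t ∈ Set.Ico (0 : ℝ) 1 := by
      rw [← Measure.restrict_congr_set Ico_ae_eq_Icc]
      exact ae_restrict_mem measurableSet_Ico
    exact (measurePreserving_eval (fun _ : Fin s => volume.restrict (Set.Icc (0 : ℝ) 1))
      j).quasiMeasurePreserving.ae h1
  exact ae_all_iff.2 h

/-- The partial Walsh expansions of a continuous function converge uniformly. -/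
theorem exists_abs_walshPartialSum_sub_le {f : (Fin s → ℝ) → ℝ}
    (hf : ContinuousOn f (cube (Fin s))) {ε : ℝ} (hε : 0 < ε) :
    ∃ N₀, ∀ N ≥ N₀, ∀ δ : Shifts s, |walshPartialSum f N δ - f (digitPoint δ)| ≤ ε := by
  obtain ⟨η, hη, hfη⟩ := Metric.uniformContinuousOn_iff.1
    (isCompact_cube.uniformContinuousOn_of_continuous hf) ε hε
  obtain ⟨N₀, hN₀⟩ := exists_pow_lt_of_lt_one hη (by norm_num : (1 / 2 : ℝ) < 1)
  refine ⟨N₀, fun N hN δ => ?_⟩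
  have hint : Integrable (fun y => f y * walshKernel N δ y) (cubeMeasure (Fin s)) := by
    simp only [walshKernel_eq_sum, Finset.mul_sum, ← mul_assoc]
    exact integrable_finsetSum _ fun K _ => (integrable_mul_walProd hf K).mul_const _
  have h1 : walshPartialSum f N δ = ∫ y, f y * walshKernel N δ y ∂cubeMeasure (Fin s) := by
    simp only [walshKernel_eq_sum, Finset.mul_sum, ← mul_assoc, walshPartialSum]
    rw [integral_finsetSum _ fun K _ => (integrable_mul_walProd hf K).mul_const _]
    simp only [integral_mul_const]
  have hk := integrable_walshKernel N δ
  have h2 : walshPartialSum f N δ - f (digitPoint δ)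
      = ∫ y, (f y * walshKernel N δ y - f (digitPoint δ) * walshKernel N δ y)
        ∂cubeMeasure (Fin s) := by
    rw [integral_sub hint (hk.const_mul _), integral_const_mul, integral_walshKernel, mul_one, h1]
  rw [h2]
  have h3 : ε = ∫ y, ε * walshKernel N δ y ∂cubeMeasure (Fin s) := by
    rw [integral_const_mul, integral_walshKernel, mul_one]
  rw [h3, ← Real.norm_eq_abs]
  refine norm_integral_le_of_norm_le (hk.const_mul ε) ?_
  filter_upwards [ae_mem_Ico, ae_mem_cube] with y hy hyc
  rw [← sub_mul, norm_mul, Real.norm_of_nonneg (walshKernel_nonneg N δ y)]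
  by_cases hk0 : walshKernel N δ y = 0
  · simp [hk0]
  · refine mul_le_mul_of_nonneg_right ?_ (walshKernel_nonneg N δ y)
    refine (hfη y hyc _ (digitPoint_mem_cube δ) (lt_of_le_of_lt (dist_digitPoint_le hy hk0) ?_)).le
    refine lt_of_le_of_lt ?_ hN₀
    rw [← one_div_pow]
    exact pow_le_pow_of_le_one (by norm_num) (by norm_num) hN

/-! ### Walsh sums over a digital net -/

theorem sum_prod_testBit (m : ℕ) (c : ℕ → ℝ) :
    ∑ i ∈ Finset.range (2 ^ m), ∏ k ∈ Finset.range m, (if i.testBit k then c k else 1)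
      = ∏ k ∈ Finset.range m, (1 + c k) := by
  induction m with
  | zero => simp
  | succ m ih =>
    have e1 : ∀ i ∈ Finset.range (2 ^ m), ∏ k ∈ Finset.range (m + 1),
        (if i.testBit k then c k else 1)
        = ∏ k ∈ Finset.range m, (if i.testBit k then c k else 1) := by
      intro i hi
      rw [Finset.prod_range_succ, Nat.testBit_lt_two_pow (Finset.mem_range.1 hi)]
      simp
    have e2 : ∀ i ∈ Finset.range (2 ^ m), ∏ k ∈ Finset.range (m + 1),
        (if (2 ^ m + i).testBit k then c k else 1)
        = (∏ k ∈ Finset.range m, (if i.testBit k then c k else 1)) * c m := by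
      intro i hi
      rw [Finset.prod_range_succ, Nat.testBit_two_pow_add_eq,
        Nat.testBit_lt_two_pow (Finset.mem_range.1 hi)]
      congr 1
      refine Finset.prod_congr rfl fun k hk => ?_
      rw [Nat.testBit_two_pow_add_gt (Finset.mem_range.1 hk)]
    rw [pow_succ, mul_two, Finset.sum_range_add, Finset.sum_congr rfl e1, Finset.sum_congr rfl e2,
      ← Finset.sum_mul, ih, Finset.prod_range_succ]
    ring

/-- The matrices for which the frequency `K` is not resolved by the net. -/
def freqCollision (K : Fin s → Finset ℕ) : Set (GenMatrices s m) :=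
  {C | ∀ c : Fin m, ∑ j : Fin s, ∑ l ∈ K j, C j l c = 0}

theorem measurableSet_freqCollision (K : Fin s → Finset ℕ) :
    MeasurableSet (freqCollision K : Set (GenMatrices s m)) := by
  have : (freqCollision K : Set (GenMatrices s m))
      = ⋂ c : Fin m, (fun C : GenMatrices s m => ∑ j : Fin s, ∑ l ∈ K j, C j l c) ⁻¹' {0} := by
    ext C; simp [freqCollision]
  rw [this]
  refine MeasurableSet.iInter fun c => ?_
  have hm : Measurable fun C : GenMatrices s m => ∑ j : Fin s, ∑ l ∈ K j, C j l c := by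
    refine Finset.measurable_fun_sum _ fun j _ => Finset.measurable_fun_sum _ fun l _ => ?_
    exact (measurable_pi_apply c).comp ((measurable_pi_apply l).comp (measurable_pi_apply j))
  exact hm (measurableSet_singleton 0)

open Classical in
/-- A Walsh function sums over the net to a multiple of its value at the shift if its frequency is
not resolved, and to zero otherwise. -/
theorem sum_digitWal_pointDigit (K : Fin s → Finset ℕ) (C : GenMatrices s m) (D : Shifts s) :
    ∑ i ∈ Finset.range (2 ^ m), digitWal K (pointDigit C D i)
      = 2 ^ m * (if C ∈ freqCollision K then 1 else 0) * digitWal K D := by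
  set e : ℕ → ZMod 2 := fun k =>
    if h : k < m then ∑ j : Fin s, ∑ l ∈ K j, C j l ⟨k, h⟩ else 0 with he
  have h1 : ∀ i, digitWal K (pointDigit C D i)
      = (∏ k ∈ Finset.range m, (if i.testBit k then sgn (e k) else 1)) * digitWal K D := by
    intro i
    simp only [digitWal, pointDigit, sgn_add, Finset.prod_mul_distrib, ← sgn_sum]
    congr 1
    rw [← Fin.prod_univ_eq_prod_range (fun k => if i.testBit k then sgn (e k) else 1) m]
    have h2 : ∑ j : Fin s, ∑ l ∈ K j, ∑ c : Fin m, C j l c * (if i.testBit c then 1 else 0)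
        = ∑ c : Fin m, if i.testBit c then e c else 0 := by
      simp only [he, Fin.is_lt, dite_true, Fin.eta]
      rw [Finset.sum_congr rfl fun j _ => Finset.sum_comm, Finset.sum_comm]
      refine Finset.sum_congr rfl fun c _ => ?_
      split_ifs <;> simp
    rw [h2, sgn_sum]
    refine Finset.prod_congr rfl fun c _ => ?_
    split_ifs <;> simp
  simp only [h1]
  rw [← Finset.sum_mul, sum_prod_testBit]
  congr 1
  split_ifs with hC
  · rw [mul_one]
    have : ∀ k ∈ Finset.range m, 1 + sgn (e k) = 2 := by
      intro k hk
      simp only [he, dif_pos (Finset.mem_range.1 hk), hC ⟨k, Finset.mem_range.1 hk⟩]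
      norm_num
    rw [Finset.prod_congr rfl this]
    simp
  · rw [mul_zero]
    simp only [freqCollision, Set.mem_ofPred_eq, not_forall] at hC
    obtain ⟨c, hc⟩ := hC
    refine Finset.prod_eq_zero (Finset.mem_range.2 c.2) ?_
    have : e c ≠ 0 := by simpa [he] using hc
    rcases zmod_two_cases (e c) with h | h
    · exact absurd h this
    · rw [h]; norm_num

/-- The estimator applied to the partial Walsh expansion. -/
noncomputable def truncatedEstimator (f : (Fin s → ℝ) → ℝ) (N : ℕ) (C : GenMatrices s m)
    (D : Shifts s) : ℝ :=
  (∑ i ∈ Finset.range (2 ^ m), walshPartialSum f N (pointDigit C D i)) / 2 ^ m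

open Classical in
theorem truncatedEstimator_eq (f : (Fin s → ℝ) → ℝ) (N : ℕ) (C : GenMatrices s m)
    (D : Shifts s) : truncatedEstimator f N C D = ∑ K ∈ freqBelow (fun _ : Fin s => N),
      (∫ x, f x * walProd K x ∂cubeMeasure (Fin s))
        * ((if C ∈ freqCollision K then 1 else 0) * digitWal K D) := by
  simp only [truncatedEstimator, walshPartialSum]
  rw [Finset.sum_comm, Finset.sum_div]
  refine Finset.sum_congr rfl fun K _ => ?_
  rw [← Finset.mul_sum, sum_digitWal_pointDigit]
  field_simp

theorem exists_abs_truncatedEstimator_sub_le {f : (Fin s → ℝ) → ℝ}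
    (hf : ContinuousOn f (cube (Fin s))) {ε : ℝ} (hε : 0 < ε) :
    ∃ N₀, ∀ N ≥ N₀, ∀ (C : GenMatrices s m) (D : Shifts s),
      |truncatedEstimator f N C D - estimator f C D| ≤ ε := by
  obtain ⟨N₀, hN₀⟩ := exists_abs_walshPartialSum_sub_le hf hε
  refine ⟨N₀, fun N hN C D => ?_⟩
  have hp : (0 : ℝ) < 2 ^ m := by positivity
  rw [truncatedEstimator, estimator, ← sub_div, ← Finset.sum_sub_distrib, abs_div,
    abs_of_pos hp, div_le_iff₀ hp]
  refine (Finset.abs_sum_le_sum_abs _ _).trans ((Finset.sum_le_card_nsmul _ _ ε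
    fun i _ => hN₀ N hN _).trans_eq ?_)
  rw [Finset.card_range, nsmul_eq_mul]
  push_cast
  ring

end DigitWalsh

/-! ### The mean squared error of one replicate -/

section SecondMoment

variable {s m : ℕ}

theorem digitWal_mul (K L : Fin s → Finset ℕ) (δ : Shifts s) :
    digitWal K δ * digitWal L δ = digitWal (fun j => (K j \ L j) ∪ (L j \ K j)) δ := by
  simp only [digitWal, ← Finset.prod_mul_distrib]
  refine Finset.prod_congr rfl fun j _ => ?_
  rw [Finset.prod_union (Finset.disjoint_left.2 fun l hl hl' =>
      (Finset.mem_sdiff.1 hl').2 (Finset.mem_sdiff.1 hl).1),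
    ← Finset.prod_inter_mul_prod_sdiff (K j) (L j), ← Finset.prod_inter_mul_prod_sdiff (L j) (K j),
    Finset.inter_comm (L j) (K j)]
  have h : (∏ l ∈ K j ∩ L j, sgn (δ j l)) * ∏ l ∈ K j ∩ L j, sgn (δ j l) = 1 := by
    rw [← Finset.prod_mul_distrib]
    exact Finset.prod_eq_one fun l _ => sgn_mul_self _
  rw [mul_mul_mul_comm, h, one_mul]

theorem digitWal_mul_self (K : Fin s → Finset ℕ) (δ : Shifts s) :
    digitWal K δ * digitWal K δ = 1 := by
  rw [← abs_mul_abs_self, abs_digitWal, one_mul]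

variable {Ω : Type*} [MeasurableSpace Ω] {P : Measure Ω}
  {ν : Measure (GenMatrices s m)} {C : Ω → GenMatrices s m} {D : Ω → Shifts s}

theorem IsRandomizedNet.measurable_digit (h : IsRandomizedNet P ν C D) (j : Fin s) (l : ℕ) :
    Measurable fun ω => D ω j l :=
  (measurable_pi_apply l).comp ((measurable_pi_apply j).comp h.measurable_shifts)

theorem IsRandomizedNet.integral_sgn [IsProbabilityMeasure P] (h : IsRandomizedNet P ν C D)
    (j : Fin s) (l : ℕ) :
    ∫ ω, sgn (D ω j l) ∂P = 0 := by
  have hb : ∀ b : ZMod 2, P.real {ω | D ω j l = b} = 1 / 2 := fun b => by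
    simp [measureReal_def, h.bernoulli_digits]
  have hm : ∀ b : ZMod 2, MeasurableSet {ω | D ω j l = b} := fun b =>
    h.measurable_digit j l (measurableSet_singleton b)
  have e : (fun ω => sgn (D ω j l)) = fun ω =>
      {ω | D ω j l = 0}.indicator (fun _ => (1 : ℝ)) ω
        - {ω | D ω j l = 1}.indicator (fun _ => (1 : ℝ)) ω := by
    funext ω
    rcases zmod_two_cases (D ω j l) with h | h <;> simp [h]
  rw [e, integral_sub ((integrable_const _).indicator (hm _))
    ((integrable_const _).indicator (hm _)), integral_indicator_const _ (hm _),
    integral_indicator_const _ (hm _), hb, hb, sub_self]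

/-- A nontrivial Walsh function of the random shift has mean zero. -/
theorem IsRandomizedNet.integral_digitWal [IsProbabilityMeasure P] (h : IsRandomizedNet P ν C D)
    {K : Fin s → Finset ℕ} (hK : ∃ j, (K j).Nonempty) : ∫ ω, digitWal K (D ω) ∂P = 0 := by
  obtain ⟨j₀, l₀, hl₀⟩ := hK
  set A : Finset (Fin s × ℕ) :=
    (Finset.univ ×ˢ Finset.univ.biUnion K).filter fun p => p.2 ∈ K p.1 with hA
  have hmem : ∀ p : Fin s × ℕ, p ∈ A ↔ p.1 ∈ Finset.univ ∧ p.2 ∈ K p.1 := fun p => by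
    simp only [hA, Finset.mem_filter, Finset.mem_product, Finset.mem_univ, true_and,
      Finset.mem_biUnion, and_iff_right_iff_imp]
    exact fun hp => ⟨_, hp⟩
  have e : ∀ ω, digitWal K (D ω)
      = (∏ p ∈ A.erase (j₀, l₀), fun ω => sgn (D ω p.1 p.2)) ω * sgn (D ω j₀ l₀) := fun ω => by
    rw [digitWal, ← Finset.prod_finset_product' A Finset.univ K hmem, Finset.prod_apply,
      Finset.prod_erase_mul A (fun p => sgn (D ω p.1 p.2)) ((hmem (j₀, l₀)).2 ⟨by simp, hl₀⟩)]
  have hmeas : ∀ p : Fin s × ℕ, Measurable fun ω => sgn (D ω p.1 p.2) := fun p =>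
    measurable_sgn.comp (h.measurable_digit p.1 p.2)
  have hind := (h.indep_digits.comp (fun _ => sgn)
    fun _ => measurable_sgn).indepFun_finsetProd_of_notMem hmeas (s := A.erase (j₀, l₀))
    (i := (j₀, l₀)) (by simp)
  have hprod : Measurable (∏ p ∈ A.erase (j₀, l₀), fun ω => sgn (D ω p.1 p.2)) := by
    rw [Finset.prod_fn]
    exact Finset.measurable_fun_prod _ fun p _ => hmeas p
  simp only [e]
  refine (IndepFun.integral_fun_mul_eq_mul_integral hind hprod.aestronglyMeasurable
    (hmeas (j₀, l₀)).aestronglyMeasurable).trans ?_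
  exact mul_eq_zero_of_right _ (h.integral_sgn j₀ l₀)

/-- The indicator function of the matrices that do not resolve the frequency `K`. -/
noncomputable def collisionInd (K : Fin s → Finset ℕ) (C : GenMatrices s m) : ℝ :=
  (freqCollision K).indicator 1 C

theorem measurable_collisionInd (K : Fin s → Finset ℕ) :
    Measurable (collisionInd K : GenMatrices s m → ℝ) :=
  measurable_one.indicator (measurableSet_freqCollision K)

theorem collisionInd_eq_or (K : Fin s → Finset ℕ) (C : GenMatrices s m) :
    collisionInd K C = 0 ∨ collisionInd K C = 1 := by
  by_cases h : C ∈ freqCollision K <;> simp [collisionInd, h]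

theorem IsRandomizedNet.integral_collisionInd (h : IsRandomizedNet P ν C D)
    (K : Fin s → Finset ℕ) : ∫ ω, collisionInd K (C ω) ∂P = ν.real (freqCollision K) := by
  rw [← h.law_matrices, map_measureReal_apply h.measurable_matrices
    (measurableSet_freqCollision K),
    ← integral_indicator_one (h.measurable_matrices (measurableSet_freqCollision K))]
  rfl

/-- Distinct Walsh frequencies are uncorrelated under the randomization, so that the variance of a
Walsh polynomial is a sum over the frequencies that are not resolved. -/
theorem IsRandomizedNet.integral_sq_sum [IsProbabilityMeasure P] (h : IsRandomizedNet P ν C D)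
    (S : Finset (Fin s → Finset ℕ)) (a : (Fin s → Finset ℕ) → ℝ) :
    ∫ ω, (∑ K ∈ S, a K * (collisionInd K (C ω) * digitWal K (D ω))) ^ 2 ∂P
      = ∑ K ∈ S, a K ^ 2 * ν.real (freqCollision K) := by
  have hC : ∀ K L : Fin s → Finset ℕ, Measurable fun X : GenMatrices s m =>
      collisionInd K X * collisionInd L X := fun K L =>
    (measurable_collisionInd K).mul (measurable_collisionInd L)
  have hD : ∀ K L : Fin s → Finset ℕ, Measurable fun δ : Shifts s =>
      digitWal K δ * digitWal L δ := fun K L =>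
    (measurable_digitWal K).mul (measurable_digitWal L)
  have key : ∀ K L : Fin s → Finset ℕ,
      ∫ ω, (collisionInd K (C ω) * collisionInd L (C ω))
        * (digitWal K (D ω) * digitWal L (D ω)) ∂P
      = if K = L then ν.real (freqCollision K) else 0 := by
    intro K L
    refine (IndepFun.integral_fun_mul_eq_mul_integral
      (h.indep_matrices_shifts.comp (hC K L) (hD K L))
      ((hC K L).comp h.measurable_matrices).aestronglyMeasurable
      ((hD K L).comp h.measurable_shifts).aestronglyMeasurable).trans ?_
    simp only [Function.comp_apply]
    split_ifs with hKL
    · subst hKL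
      have e : ∀ X : GenMatrices s m, collisionInd K X * collisionInd K X = collisionInd K X := by
        intro X
        rcases collisionInd_eq_or K X with h | h <;> simp [h]
      simp only [e, digitWal_mul_self, h.integral_collisionInd]
      simp
    · simp only [digitWal_mul]
      rw [h.integral_digitWal, mul_zero]
      by_contra! hne
      refine hKL (funext fun j => ?_)
      have := Finset.union_eq_empty.1 (hne j)
      exact (Finset.sdiff_eq_empty_iff_subset.1 this.1).antisymm
        (Finset.sdiff_eq_empty_iff_subset.1 this.2)
  have hint : ∀ K L : Fin s → Finset ℕ, Integrable (fun ω =>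
      (a K * a L) * ((collisionInd K (C ω) * collisionInd L (C ω))
        * (digitWal K (D ω) * digitWal L (D ω)))) P := by
    intro K L
    refine Integrable.const_mul ?_ _
    refine Integrable.of_bound (((hC K L).comp h.measurable_matrices).mul
      ((hD K L).comp h.measurable_shifts)).aestronglyMeasurable 1 (ae_of_all _ fun ω => ?_)
    simp only [Real.norm_eq_abs, abs_mul, abs_digitWal, mul_one]
    rcases collisionInd_eq_or K (C ω) with h | h <;>
      rcases collisionInd_eq_or L (C ω) with h' | h' <;> simp [h, h']
  have e : ∀ ω, (∑ K ∈ S, a K * (collisionInd K (C ω) * digitWal K (D ω))) ^ 2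
      = ∑ K ∈ S, ∑ L ∈ S, (a K * a L) * ((collisionInd K (C ω) * collisionInd L (C ω))
        * (digitWal K (D ω) * digitWal L (D ω))) := by
    intro ω
    rw [sq, Finset.sum_mul_sum]
    exact Finset.sum_congr rfl fun K _ => Finset.sum_congr rfl fun L _ => by ring
  simp only [e]
  rw [integral_finsetSum _ fun K _ => integrable_finsetSum _ fun L _ => hint K L]
  refine Finset.sum_congr rfl fun K hK => ?_
  rw [integral_finsetSum _ fun L _ => hint K L]
  simp only [integral_const_mul, key, mul_ite, mul_zero, Finset.sum_ite_eq, hK, if_true]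
  ring

/-- The nonzero Walsh frequencies with bits below `N`. -/
noncomputable def nonzeroFreq (s N : ℕ) : Finset (Fin s → Finset ℕ) :=
  (freqBelow (fun _ : Fin s => N)).erase fun _ => ∅

theorem truncatedEstimator_sub_integral (f : (Fin s → ℝ) → ℝ) (N : ℕ) (C : GenMatrices s m)
    (D : Shifts s) : truncatedEstimator f N C D - ∫ x in cube (Fin s), f x
      = ∑ K ∈ nonzeroFreq s N, (∫ x, f x * walProd K x ∂cubeMeasure (Fin s))
        * (collisionInd K C * digitWal K D) := by
  classical
  have h0 : (fun _ : Fin s => (∅ : Finset ℕ)) ∈ freqBelow (fun _ : Fin s => N) :=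
    Fintype.mem_piFinset.2 fun j => by simp
  rw [truncatedEstimator_eq, ← Finset.add_sum_erase _ _ h0, volume_restrict_cube, nonzeroFreq]
  have e : ∀ K : Fin s → Finset ℕ, collisionInd K C = if C ∈ freqCollision K then 1 else 0 :=
    fun K => by rw [collisionInd, Set.indicator_apply, Pi.one_apply]
  simp [e, freqCollision, walProd, digitWal]

theorem measurable_truncatedEstimator (f : (Fin s → ℝ) → ℝ) (N : ℕ) :
    Measurable fun p : GenMatrices s m × Shifts s => truncatedEstimator f N p.1 p.2 := by
  have e : (fun p : GenMatrices s m × Shifts s => truncatedEstimator f N p.1 p.2) = fun p =>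
      (∑ K ∈ nonzeroFreq s N, (∫ x, f x * walProd K x ∂cubeMeasure (Fin s))
        * (collisionInd K p.1 * digitWal K p.2)) + ∫ x in cube (Fin s), f x := by
    funext p
    rw [← truncatedEstimator_sub_integral, sub_add_cancel]
  rw [e]
  refine (Finset.measurable_fun_sum _ fun K _ => ?_).add_const _
  exact (((measurable_collisionInd K).comp measurable_fst).mul
    ((measurable_digitWal K).comp measurable_snd)).const_mul _

theorem tendsto_truncatedEstimator_atTop {f : (Fin s → ℝ) → ℝ}
    (hf : ContinuousOn f (cube (Fin s))) (C : GenMatrices s m) (D : Shifts s) :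
    Tendsto (fun N => truncatedEstimator f N C D) atTop (𝓝 (estimator f C D)) := by
  refine Metric.tendsto_atTop.2 fun ε hε => ?_
  obtain ⟨N₀, h⟩ := exists_abs_truncatedEstimator_sub_le (m := m) hf (half_pos hε)
  exact ⟨N₀, fun N hN => (h N hN C D).trans_lt (half_lt_self hε)⟩

theorem measurable_estimator {f : (Fin s → ℝ) → ℝ} (hf : ContinuousOn f (cube (Fin s))) :
    Measurable fun p : GenMatrices s m × Shifts s => estimator f p.1 p.2 :=
  measurable_of_tendsto_metrizable (measurable_truncatedEstimator f)
    (tendsto_pi_nhds.2 fun p => tendsto_truncatedEstimator_atTop hf p.1 p.2)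

theorem exists_abs_estimator_le {f : (Fin s → ℝ) → ℝ} (hf : ContinuousOn f (cube (Fin s))) :
    ∃ B, ∀ (C : GenMatrices s m) (D : Shifts s), |estimator f C D| ≤ B := by
  obtain ⟨B, hB⟩ := isCompact_cube.exists_bound_of_continuousOn hf
  refine ⟨B, fun C D => ?_⟩
  have hp : (0 : ℝ) < 2 ^ m := by positivity
  rw [estimator, abs_div, abs_of_pos hp, div_le_iff₀ hp]
  refine (Finset.abs_sum_le_sum_abs _ _).trans ((Finset.sum_le_card_nsmul _ _ B
    fun i _ => hB _ (digitPoint_mem_cube _)).trans_eq ?_)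
  rw [Finset.card_range, nsmul_eq_mul]
  push_cast
  ring

/-- A bound for the variances of all truncated estimators is a bound for the mean squared error. -/
theorem IsRandomizedNet.integral_sq_sub_le [IsProbabilityMeasure P] (h : IsRandomizedNet P ν C D)
    {f : (Fin s → ℝ) → ℝ} (hf : ContinuousOn f (cube (Fin s))) {B : ℝ}
    (hB : ∀ N, ∑ K ∈ nonzeroFreq s N, (∫ x, f x * walProd K x ∂cubeMeasure (Fin s)) ^ 2
      * ν.real (freqCollision K) ≤ B) :
    Integrable (fun ω => (estimator f (C ω) (D ω) - ∫ x in cube (Fin s), f x) ^ 2) P ∧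
      ∫ ω, (estimator f (C ω) (D ω) - ∫ x in cube (Fin s), f x) ^ 2 ∂P ≤ B := by
  set I := ∫ x in cube (Fin s), f x
  obtain ⟨M, hM⟩ := exists_abs_estimator_le (m := m) hf
  obtain ⟨N₀, hN₀⟩ := exists_abs_truncatedEstimator_sub_le (m := m) hf one_pos
  have hCD := h.measurable_matrices.prodMk h.measurable_shifts
  have hmeas : Measurable fun ω => (estimator f (C ω) (D ω) - I) ^ 2 :=
    (((measurable_estimator hf).comp hCD).sub_const I).pow_const 2
  have hmeasN : ∀ N, Measurable fun ω => (truncatedEstimator f N (C ω) (D ω) - I) ^ 2 := fun N =>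
    (((measurable_truncatedEstimator f N).comp hCD).sub_const I).pow_const 2
  have hle : ∀ x : ℝ, |x| ≤ M + 1 → ‖(x - I) ^ 2‖ ≤ (M + 1 + |I|) ^ 2 := fun x hx => by
    rw [Real.norm_eq_abs, abs_pow]
    exact pow_le_pow_left₀ (abs_nonneg _) ((abs_sub _ _).trans (by linarith)) 2
  refine ⟨Integrable.of_bound hmeas.aestronglyMeasurable ((M + 1 + |I|) ^ 2)
    (ae_of_all _ fun ω => hle _ ((hM _ _).trans (by linarith))), ?_⟩
  refine le_of_tendsto' (tendsto_integral_filter_of_dominated_convergence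
    (F := fun N ω => (truncatedEstimator f N (C ω) (D ω) - I) ^ 2) (fun _ => (M + 1 + |I|) ^ 2)
    (Eventually.of_forall fun N => (hmeasN N).aestronglyMeasurable) ?_ (integrable_const _)
    (ae_of_all _ fun ω => ((tendsto_truncatedEstimator_atTop hf _ _).sub_const I).pow 2))
    fun N => ?_
  · filter_upwards [eventually_ge_atTop N₀] with N hN
    refine ae_of_all _ fun ω => hle _ ?_
    have h1 := hN₀ N hN (C ω) (D ω)
    have h2 := hM (C ω) (D ω)
    rw [abs_le] at *
    constructor <;> linarith [h1.1, h1.2, h2.1, h2.2]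
  · simp only [I, truncatedEstimator_sub_integral]
    rw [h.integral_sq_sum]
    exact hB N

end SecondMoment

/-! ### The error bound for schemes of order `d` -/

section Scheme

variable {s m : ℕ}

theorem bitPos_sum_two_pow (K : Finset ℕ) : bitPos (∑ l ∈ K, 2 ^ l) = K.image (· + 1) := by
  rw [bitPos, Finset.toFinset_bitIndices_sum_two_pow]

theorem collision_sum_two_pow (K : Fin s → Finset ℕ) :
    (collision (fun j => ∑ l ∈ K j, 2 ^ l) : Set (GenMatrices s m)) = freqCollision K := by
  ext C
  simp [collision, freqCollision, bitPos_sum_two_pow]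

/-- The indicator in the defining inequality of a scheme of order `d` is bounded by an exponential
of the excess of the digit weight over its threshold. -/
theorem SchemeOfOrder.real_freqCollision_le {ν : Measure (GenMatrices s m)} {d : ℕ}
    {t : Finset (Fin s) → ℕ} (hν : SchemeOfOrder ν d t) (hd : 0 < d) {θ c : ℝ} (hθ : 0 < θ)
    (hc : 0 < c) {u : Finset (Fin s)} {K : Fin s → Finset ℕ} (hK : ∀ j, j ∈ u ↔ (K j).Nonempty)
    (hu : u ≠ ∅) :
    ν.real (freqCollision K) ≤ (2 : ℝ) ^ ((2 * θ * c + 1) * ((t u : ℝ) - m))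
      * ∏ j : u, (4 : ℝ) ^ (θ * (c * orderWeight d ((K j).image (· + 1)) / d)) := by
  -- the integer frequency with the bits `K`
  set k : Fin s → ℕ := fun j => ∑ l ∈ K j, 2 ^ l with hk
  have hkj : ∀ j, k j ≠ 0 ↔ (K j).Nonempty := fun j => by
    simp [hk, Finset.sum_eq_zero_iff, Finset.nonempty_iff_ne_empty,
      Finset.eq_empty_iff_forall_notMem]
  have hsupp : supp k = u := by
    ext j
    simp [supp, hK, hkj]
  have hk0 : k ≠ 0 := by
    obtain ⟨j, hj⟩ := Finset.nonempty_iff_ne_empty.2 hu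
    exact fun h => (hkj j).2 ((hK j).1 hj) (congrFun h j)
  have h := hν k hk0
  rw [hsupp, hk, collision_sum_two_pow] at h
  simp only [bitPos_sum_two_pow] at h
  refine h.trans ?_
  have hd' : (0 : ℝ) < d := by exact_mod_cast hd
  set W : ℕ := ∑ j ∈ u, orderWeight d ((K j).image (· + 1)) with hW
  have hprod : ∏ j : u, (4 : ℝ) ^ (θ * (c * orderWeight d ((K j).image (· + 1)) / d))
      = (4 : ℝ) ^ (θ * (c * W / d)) := by
    rw [← Real.rpow_sum_of_pos (by norm_num),
      Finset.sum_coe_sort u fun j => θ * (c * (orderWeight d ((K j).image (· + 1)) : ℝ) / d), hW]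
    push_cast
    rw [Finset.mul_sum, Finset.sum_div, Finset.mul_sum]
  have h2 : (2 : ℝ) ^ (-(m : ℤ) + (t u : ℤ)) = (2 : ℝ) ^ ((t u : ℝ) - m) := by
    rw [← Real.rpow_intCast]
    congr 1
    push_cast
    ring
  rw [hprod, h2, show (2 * θ * c + 1) * ((t u : ℝ) - m)
      = ((t u : ℝ) - m) + 2 * (θ * (c * ((t u : ℝ) - m))) by ring,
    Real.rpow_add two_pos, Real.rpow_mul two_pos.le, mul_assoc]
  refine mul_le_mul_of_nonneg_left ?_ (by positivity)
  rw [show (2 : ℝ) ^ (2 : ℝ) = 4 by norm_num, ← Real.rpow_add (by norm_num)]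
  split_ifs with hlt
  · refine Real.one_le_rpow (by norm_num) ?_
    have hlt' : (d : ℝ) * ((m : ℝ) - t u) < W := by exact_mod_cast hlt
    have h3 : (m : ℝ) - t u ≤ W / d := by
      rw [le_div_iff₀ hd']
      linarith
    rw [← mul_add, mul_div_assoc, ← mul_add]
    exact mul_nonneg hθ.le (mul_nonneg hc.le (by linarith))
  · positivity

theorem mem_nonzeroFreq {N : ℕ} {K : Fin s → Finset ℕ} :
    K ∈ nonzeroFreq s N ↔ (∃ j, (K j).Nonempty) ∧ ∀ j, K j ⊆ Finset.range N := by
  have : K ≠ (fun _ => ∅) ↔ ∃ j, (K j).Nonempty := by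
    simp [funext_iff, Finset.nonempty_iff_ne_empty]
  simp [nonzeroFreq, freqBelow, this]

/-- The nonzero frequencies are sorted by the set of coordinates in which they are nonzero. -/
theorem sum_nonzeroFreq_le {N : ℕ} {a : (Fin s → Finset ℕ) → ℝ}
    {b : (u : Finset (Fin s)) → (u → Finset ℕ) → ℝ} (hb : ∀ u L, 0 ≤ b u L)
    (hab : ∀ u K, u ≠ ∅ → (∀ j, j ∈ u ↔ (K j).Nonempty) → a K ≤ b u fun j => K j) :
    ∑ K ∈ nonzeroFreq s N, a K
      ≤ ∑ u ∈ Finset.univ.filter (fun u : Finset (Fin s) => u ≠ ∅), ∑ L ∈ fullFreq u N, b u L := by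
  classical
  rw [← Finset.sum_fiberwise_of_maps_to (s := nonzeroFreq s N)
    (t := Finset.univ.filter fun u : Finset (Fin s) => u ≠ ∅)
    (g := fun K => Finset.univ.filter fun j => (K j).Nonempty)]
  · refine Finset.sum_le_sum fun u hu => ?_
    have hu' : u ≠ ∅ := (Finset.mem_filter.1 hu).2
    have hK : ∀ K ∈ (nonzeroFreq s N).filter
        (fun K => (Finset.univ.filter fun j => (K j).Nonempty) = u),
        ∀ j, j ∈ u ↔ (K j).Nonempty := fun K hK j => by
      rw [← (Finset.mem_filter.1 hK).2]
      simp
    refine (Finset.sum_le_sum fun K h => hab u K hu' (hK K h)).trans ?_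
    rw [← Finset.sum_image (f := b u) (g := fun (K : Fin s → Finset ℕ) (j : u) => K j)]
    · refine Finset.sum_le_sum_of_subset_of_nonneg (fun L hL => ?_) fun L _ _ => hb u L
      obtain ⟨K, h, rfl⟩ := Finset.mem_image.1 hL
      exact mem_fullFreq.2 fun j => ⟨(mem_nonzeroFreq.1 (Finset.mem_filter.1 h).1).2 j,
        (hK K h j).1 j.2⟩
    · intro K h L h' hKL
      funext j
      by_cases hj : j ∈ u
      · exact congrFun hKL ⟨j, hj⟩
      · rw [Finset.not_nonempty_iff_eq_empty.1 (mt (hK K h j).2 hj),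
          Finset.not_nonempty_iff_eq_empty.1 (mt (hK L h' j).2 hj)]
  · intro K hK
    obtain ⟨j, hj⟩ := (mem_nonzeroFreq.1 hK).1
    exact Finset.mem_filter.2 ⟨Finset.mem_univ _,
      Finset.ne_empty_of_mem (Finset.mem_filter.2 ⟨Finset.mem_univ j, hj⟩)⟩

theorem partialVitali_le_componentNorm {α : ℕ} {lam : ℝ} {f : (Fin s → ℝ) → ℝ}
    {u : Finset (Fin s)} (hu : u ≠ ∅) (v : Finset u) (a : u → ℕ) (h1 : ∀ j, a j ≤ α)
    (h2 : ∀ j ∈ v, a j = α) (h3 : ∀ j ∉ v, 0 < a j) :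
    partialVitali lam v (mixedDeriv a (anovaOn f u)) ≤ componentNorm α lam f u := by
  rw [componentNorm, if_neg hu]
  exact le_iSup_of_le v (le_iSup_of_le a (le_iSup_of_le ⟨h1, h2, h3⟩ le_rfl))

theorem relVariation_mul {α : ℕ} {lam : ℝ} {f : (Fin s → ℝ) → ℝ}
    (hnorm : variationNorm α lam f < ⊤) (u : Finset (Fin s)) :
    relVariation α lam f u * (variationNorm α lam f).toReal
      = (componentNorm α lam f u).toReal := by
  have hle : componentNorm α lam f u ≤ variationNorm α lam f :=
    le_iSup (fun u => componentNorm α lam f u) u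
  rw [relVariation, ← ENNReal.toReal_mul]
  congr 1
  by_cases h0 : variationNorm α lam f = 0
  · rw [h0, mul_zero]
    exact (le_zero_iff.1 (h0 ▸ hle)).symm
  · exact ENNReal.div_mul_cancel h0 hnorm.ne

/-- The bound for the squared error of the median that holds with high probability. -/
noncomputable def errorBound (m α : ℕ) (lam : ℝ) (f : (Fin s → ℝ) → ℝ) (t : Finset (Fin s) → ℕ)
    (θ : ℝ) : ℝ :=
  constGamma α lam f t θ * (variationNorm α lam f).toReal ^ 2
    * (2 : ℝ) ^ (-((2 * θ * ((α : ℝ) + lam) + 1) * (m : ℝ)))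

theorem errorBound_eq {α : ℕ} {lam : ℝ} {f : (Fin s → ℝ) → ℝ}
    (hnorm : variationNorm α lam f < ⊤) (t : Finset (Fin s) → ℕ) (θ : ℝ) :
    errorBound m α lam f t θ = 16 * ∑ u ∈ Finset.univ.filter (fun u : Finset (Fin s) => u ≠ ∅),
      (2 : ℝ) ^ ((2 * θ * ((α : ℝ) + lam) + 1) * ((t u : ℝ) - m))
        * (constC α lam θ ^ u.card * (componentNorm α lam f u).toReal ^ 2) := by
  rw [errorBound, constGamma, mul_assoc, mul_assoc, Finset.sum_mul]
  congr 1
  refine Finset.sum_congr rfl fun u _ => ?_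
  rw [← relVariation_mul hnorm u, mul_sub, sub_eq_add_neg, Real.rpow_add two_pos,
    mul_comm _ (t u : ℝ)]
  ring

/-- The Walsh coefficients of a function of finite variation, weighted by the probabilities that
their frequencies are not resolved. -/
theorem sum_sq_mul_real_freqCollision_le {α : ℕ} {lam : ℝ} (hlam : 0 < lam)
    {f : (Fin s → ℝ) → ℝ} (hf : MixedSmooth α f) (hnorm : variationNorm α lam f < ⊤)
    {θ : ℝ} (hθ0 : 0 < θ) (hθ1 : θ < 1) {ν : Measure (GenMatrices s m)} {d : ℕ}
    {t : Finset (Fin s) → ℕ} (hν : SchemeOfOrder ν d t) (hd : (α : ℝ) + lam ≤ d) (N : ℕ) :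
    ∑ K ∈ nonzeroFreq s N, (∫ x, f x * walProd K x ∂cubeMeasure (Fin s)) ^ 2
      * ν.real (freqCollision K) ≤ errorBound m α lam f t θ / 16 := by
  have hc : 0 < (α : ℝ) + lam := by positivity
  have hd0 : 0 < d := by
    have : (0 : ℝ) < d := hc.trans_le hd
    exact_mod_cast this
  rw [errorBound_eq hnorm, mul_div_cancel_left₀ _ (by norm_num)]
  refine (sum_nonzeroFreq_le (b := fun u L =>
    (2 : ℝ) ^ ((2 * θ * ((α : ℝ) + lam) + 1) * ((t u : ℝ) - m))
      * ((∫ y, anovaOn f u y * walProd L y ∂cubeMeasure u) ^ 2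
        * ∏ j, (4 : ℝ) ^ (θ * (((α : ℝ) + lam) * orderWeight d ((L j).image (· + 1)) / d))))
    (fun u L => by positivity) fun u K hu hK => ?_).trans (Finset.sum_le_sum fun u hu => ?_)
  · rw [integral_mul_walProd_eq_anovaOn hf u K hK, mul_left_comm]
    exact mul_le_mul_of_nonneg_left (hν.real_freqCollision_le hd0 hθ0 hc hK hu) (sq_nonneg _)
  · obtain ⟨F, hF⟩ := exists_mixedFamily_anovaOn hf u
    have hV : componentNorm α lam f u ≠ ⊤ :=
      ((le_iSup (fun u => componentNorm α lam f u) u).trans_lt hnorm).ne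
    rw [← Finset.mul_sum]
    refine mul_le_mul_of_nonneg_left ?_ (by positivity)
    have h := sum_sq_walsh_mul_weight_le hlam hθ0 hθ1 hd hF hV
      (partialVitali_le_componentNorm (Finset.mem_filter.1 hu).2) N
    rw [Fintype.card_coe] at h
    refine (le_of_eq ?_).trans h
    congr!

end Scheme

/-! ### The median of independent replicates -/

/-- Chebyshev's inequality for one replicate. If the threshold `T` is zero, then the mean squared
error vanishes and the estimator is almost surely exact. -/
theorem IsRandomizedNet.real_lt_sq_sub_le {s m : ℕ} {Ω : Type*} [MeasurableSpace Ω]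
    {P : Measure Ω} [IsProbabilityMeasure P] {ν : Measure (GenMatrices s m)}
    {C : Ω → GenMatrices s m} {D : Ω → Shifts s} (h : IsRandomizedNet P ν C D)
    {f : (Fin s → ℝ) → ℝ} (hf : ContinuousOn f (cube (Fin s))) {T : ℝ}
    (hT : ∀ N, ∑ K ∈ nonzeroFreq s N, (∫ x, f x * walProd K x ∂cubeMeasure (Fin s)) ^ 2
      * ν.real (freqCollision K) ≤ T / 16) :
    P.real {ω | T < |estimator f (C ω) (D ω) - ∫ x in cube (Fin s), f x| ^ 2} ≤ 1 / 8 := by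
  obtain ⟨hint, hle⟩ := h.integral_sq_sub_le hf hT
  simp only [sq_abs]
  set e : Ω → ℝ := fun ω => (estimator f (C ω) (D ω) - ∫ x in cube (Fin s), f x) ^ 2 with he
  have he0 : 0 ≤ e := fun ω => sq_nonneg _
  have hT0 : 0 ≤ T := by linarith [(integral_nonneg he0).trans hle]
  rcases hT0.eq_or_lt with rfl | hT0
  · have h0 : e =ᵐ[P] 0 := (integral_eq_zero_iff_of_nonneg he0 hint).1
      (le_antisymm (hle.trans_eq (by norm_num)) (integral_nonneg he0))
    have h1 : P {ω | 0 < e ω} = 0 := measure_mono_null (fun ω hω => (ne_of_gt hω : e ω ≠ 0)) h0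
    have h2 : P.real {ω | 0 < e ω} = 0 := by rw [measureReal_def, h1, ENNReal.toReal_zero]
    exact h2.trans_le (by norm_num)
  · have h1 := (mul_meas_ge_le_integral_of_nonneg (ae_of_all _ he0) hint T).trans hle
    have h2 : P.real {ω | T < e ω} ≤ P.real {ω | T ≤ e ω} :=
      measureReal_mono fun ω (hω : T < e ω) => show T ≤ e ω from hω.le
    refine h2.trans ?_
    by_contra! hlt
    nlinarith

section Median

/-- If the sample median is far from `μ`, so are `r` of the `2r - 1` samples. -/
theorem exists_card_eq_of_lt_abs_sampleMedian_sub {r : ℕ} (hr : 1 ≤ r)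
    (x : Fin (2 * r - 1) → ℝ) (μ T : ℝ) (h : T < |sampleMedian r hr x - μ| ^ 2) :
    ∃ A : Finset (Fin (2 * r - 1)), A.card = r ∧ ∀ q ∈ A, T < |x q - μ| ^ 2 := by
  set σ := Tuple.sort x with hσ
  have hmono : Monotone (x ∘ σ) := Tuple.monotone_sort x
  set i₀ : Fin (2 * r - 1) := ⟨r - 1, by omega⟩ with hi₀
  have hmed : sampleMedian r hr x = x (σ i₀) := rfl
  rw [hmed] at h
  rcases le_total μ (x (σ i₀)) with hle | hle
  · refine ⟨(Finset.Ici i₀).map σ.toEmbedding, ?_, fun q hq => ?_⟩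
    · rw [Finset.card_map, Fin.card_Ici]
      simp only [hi₀]
      omega
    · obtain ⟨i, hi, rfl⟩ := Finset.mem_map.1 hq
      have h1 : x (σ i₀) ≤ x (σ i) := hmono (Finset.mem_Ici.1 hi)
      refine h.trans_le (pow_le_pow_left₀ (abs_nonneg _) ?_ 2)
      rw [abs_of_nonneg (sub_nonneg.2 hle)]
      exact (sub_le_sub_right h1 μ).trans (le_abs_self _)
  · refine ⟨(Finset.Iic i₀).map σ.toEmbedding, ?_, fun q hq => ?_⟩
    · rw [Finset.card_map, Fin.card_Iic]
      simp only [hi₀]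
      omega
    · obtain ⟨i, hi, rfl⟩ := Finset.mem_map.1 hq
      have h1 : x (σ i) ≤ x (σ i₀) := hmono (Finset.mem_Iic.1 hi)
      refine h.trans_le (pow_le_pow_left₀ (abs_nonneg _) ?_ 2)
      rw [abs_of_nonpos (sub_nonpos.2 hle)]
      exact (neg_le_neg (sub_le_sub_right h1 μ)).trans (neg_le_abs _)

/-- If each of `2r - 1` independent replicates falls into a set with probability at most `p`, then
`r` of them do so simultaneously with probability at most `(4p)^r`. -/
theorem real_exists_card_eq_le {Ω β : Type*} [MeasurableSpace Ω] [MeasurableSpace β]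
    {P : Measure Ω} [IsProbabilityMeasure P] {r : ℕ} {X : Fin (2 * r - 1) → Ω → β}
    (hX : iIndepFun X P) {B : Set β} (hB : MeasurableSet B) {p : ℝ}
    (hp : ∀ q, P.real (X q ⁻¹' B) ≤ p) :
    P.real {ω | ∃ A : Finset (Fin (2 * r - 1)), A.card = r ∧ ∀ q ∈ A, X q ω ∈ B}
      ≤ (4 * p) ^ r := by
  have hset : {ω | ∃ A : Finset (Fin (2 * r - 1)), A.card = r ∧ ∀ q ∈ A, X q ω ∈ B}
      = ⋃ A ∈ Finset.powersetCard r (Finset.univ : Finset (Fin (2 * r - 1))),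
        ⋂ q ∈ A, X q ⁻¹' B := by
    ext ω
    simp [Finset.mem_powersetCard]
  rw [hset]
  refine (measureReal_biUnion_finset_le _ _).trans ?_
  have h1 : ∀ A ∈ Finset.powersetCard r (Finset.univ : Finset (Fin (2 * r - 1))),
      P.real (⋂ q ∈ A, X q ⁻¹' B) ≤ p ^ r := by
    intro A hA
    rw [measureReal_def, hX.measure_inter_preimage_eq_mul A fun _ _ => hB, ENNReal.toReal_prod]
    refine (Finset.prod_le_prod (fun _ _ => ENNReal.toReal_nonneg) fun q _ => hp q).trans_eq ?_
    rw [Finset.prod_const, (Finset.mem_powersetCard.1 hA).2]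
  refine (Finset.sum_le_card_nsmul _ _ _ h1).trans ?_
  rw [Finset.card_powersetCard, Finset.card_univ, Fintype.card_fin, nsmul_eq_mul, mul_pow]
  rcases Nat.eq_zero_or_pos r with rfl | hr
  · simp
  have hp0 : 0 ≤ p := measureReal_nonneg.trans (hp ⟨0, by omega⟩)
  refine mul_le_mul_of_nonneg_right ?_ (pow_nonneg hp0 r)
  have h2 : (2 * r - 1).choose r ≤ 4 ^ r := by
    calc (2 * r - 1).choose r ≤ 2 ^ (2 * r - 1) := Nat.choose_le_two_pow _ _
      _ ≤ 2 ^ (2 * r) := Nat.pow_le_pow_right two_pos (Nat.sub_le _ _)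
      _ = 4 ^ r := by rw [pow_mul]; norm_num
  exact_mod_cast h2

end Median

end MedianNet

theorem theorem5p1 {s m : ℕ} (hm : 1 ≤ m) (α : ℕ) (lam : ℝ) (hlam : 0 < lam ∧ lam ≤ 1)
    (f : (Fin s → ℝ) → ℝ) (hf : MedianNet.MixedSmooth α f)
    (hnorm : MedianNet.variationNorm α lam f < ⊤)
    (r : ℕ) (hr : 1 ≤ r) (θ : ℝ) (hθ : 0 < θ ∧ θ < 1)
    (ν : Measure (MedianNet.GenMatrices s m)) (d : ℕ) (t : Finset (Fin s) → ℕ)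
    (hν : MedianNet.SchemeOfOrder ν d t) (hd : (α : ℝ) + lam ≤ d)
    {Ω : Type*} [MeasurableSpace Ω] (P : Measure Ω) [IsProbabilityMeasure P]
    (C : Fin (2 * r - 1) → Ω → MedianNet.GenMatrices s m)
    (D : Fin (2 * r - 1) → Ω → MedianNet.Shifts s)
    (hnet : ∀ q, MedianNet.IsRandomizedNet P ν (C q) (D q))
    (hindep : iIndepFun (fun q ω => (C q ω, D q ω)) P) :
    P.real {ω |
        MedianNet.constGamma α lam f t θ * (MedianNet.variationNorm α lam f).toReal ^ 2
            * (2 : ℝ) ^ (-((2 * θ * ((α : ℝ) + lam) + 1) * (m : ℝ)))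
          < |MedianNet.sampleMedian r hr (fun q => MedianNet.estimator f (C q ω) (D q ω))
              - ∫ x in MedianNet.cube (Fin s), f x| ^ 2}
      ≤ (1 / 2 : ℝ) ^ r := by
  have hfc : ContinuousOn f (MedianNet.cube (Fin s)) := by
    simpa only [MedianNet.mixedDeriv_zero] using (hf 0 fun j => Nat.zero_le _).1
  set T := MedianNet.errorBound m α lam f t θ with hT
  set I := ∫ x in MedianNet.cube (Fin s), f x with hI
  set B : Set (MedianNet.GenMatrices s m × MedianNet.Shifts s) :=
    {p | T < |MedianNet.estimator f p.1 p.2 - I| ^ 2} with hB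
  have hBm : MeasurableSet B :=
    measurableSet_lt measurable_const
      (((MedianNet.measurable_estimator hfc).sub_const I).abs.pow_const 2)
  have hp : ∀ q, P.real ((fun ω => (C q ω, D q ω)) ⁻¹' B) ≤ 1 / 8 := fun q =>
    (hnet q).real_lt_sq_sub_le hfc
      (MedianNet.sum_sq_mul_real_freqCollision_le hlam.1 hf hnorm hθ.1 hθ.2 hν hd)
  refine (measureReal_mono fun ω hω => ?_).trans
    ((MedianNet.real_exists_card_eq_le hindep hBm hp).trans_eq (by norm_num))
  exact MedianNet.exists_card_eq_of_lt_abs_sampleMedian_sub hr _ I T hω
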